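/- **Conventions.** A finite semisimple C*-category is a C*-category with finite orthogonal direct sums in which every object is a finite orthogonal direct sum of simple objects, with a finite set $V$ of (representatives of) isomorphism classes of simple objects. For $v\in V$ and an object $x$, $\mathrm{ONB}(v,x)$ is a basis $\{\sigma\}$ of $\mathrm{Hom}(v,x)$ that is orthonormal for $\langle\sigma,\tau\rangle 1_v=\tau^\dagger\sigma$. A weight $\mu:V\to(0,\infty)$ gives the categorical trace $\mathrm{Tr}_x(\alpha)=\sum_{v\in V}\mu_v\sum_{\sigma\in \mathrm{ONB}(v,x)}\langle\alpha\sigma,\sigma\rangle$ on $\mathrm{End}(x)$. All functors between such categories are $*$-linear and bi-faithful (the functor and its adjoint are faithful). **0-cells.** A 0-cell $\Gamma_\bullet$ of $\mathbf{UC}^{\mathrm{tr}}$ consists of finite semisimple C*-categories $\mathcal M_k$ ($k\ge 0$), functors $\Gamma_k:\mathcal M_{k-1}\to\mathcal M_k$ ($k\ge 1$), and weights $\mu^k:V_{\mathcal M_k}\to(0,\infty)$ with $\sum_v\mu^0_v=1$ and $$\sum_{w\in V_{\mathcal M_k}}\dim\mathrm{Hom}(w,\Gamma_k v)\,\mu^k_w=\mu^{k-1}_v\qquad(k\ge1,\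 v\in V_{\mathcal M_{k-1}}).$$ Let $m_0=\bigoplus_{v\in V_{\mathcal M_0}}v$, $A_k=\mathrm{End}(\Gamma_k\cdots\Gamma_1m_0)$, included in $A_{k+1}$ by $\alpha\mapsto\Gamma_{k+1}\alpha$, and $A_\infty=\bigcup_kA_k$; the categorical traces define a trace $\mathrm{Tr}$ on $A_\infty$. Put $A=\mathcal{PB}(\Gamma_\bullet)=A_\infty''$, acting by left multiplication on $L^2(A_\infty,\mathrm{Tr})$. For a second 0-cell $\Delta_\bullet$, with categories $\mathcal N_k$ and weights $\nu^k$, define $n_0$, $B_k$, $B_\infty$ and $B=\mathcal{PB}(\Delta_\bullet)$ in the same way. **1-cells.** A 1-cell $\Lambda_\bullet$ from $\Gamma_\bullet$ to $\Delta_\bullet$ consists of functors $\Lambda_k:\mathcal M_k\to\mathcal N_k$ ($k\ge0$) and natural unitaries $W_k=W^\Lambda_k:\Delta_k\Lambda_{k-1}\to\Lambda_k\Gamma_k$ ($k\ge1$), such that for some $\epsilon,M>0$, for all $k\ge 0$ and $v\in V_{\mathcal M_k}$, $$\epsilon\,\mu^k_v\le\sum_{w\in V_{\mathcal N_k}}\dim\mathrm{Hom}(w,\Lambda_kv)\,\nu^k_w\le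 M\mu^k_v .$$ Put $H_k=\mathrm{Hom}(\Delta_k\cdots\Delta_1n_0,\ \Lambda_k\Gamma_k\cdots\Gamma_1m_0)$, included in $H_{k+1}$ by $\xi\mapsto (W_{k+1})_{\Gamma_k\cdots\Gamma_1m_0}\circ\Delta_{k+1}\xi$, with inner product $\langle\xi,\zeta\rangle=\mathrm{Tr}(\zeta^\dagger\xi)$; let $H$ be the completion of $\bigcup_kH_k$. The algebras $A_k$ and $B_k$ act on $H$ by bounded operators determined by $\alpha\cdot\xi\cdot\beta=\Lambda_k\alpha\circ\xi\circ\beta$ for $\xi\in H_k$ (for each $k$). By $\mathcal{PB}(\Lambda_\bullet)$ we mean $H$ with commuting normal unital $*$-actions of $A$ (left) and $B$ (right) that extend these actions of $A_k$ and $B_k$ for all $k$. Let $\Omega_\bullet$ be another 1-cell from $\Gamma_\bullet$ to $\Delta_\bullet$, with Hilbert space $G$. For a natural transformation $\eta:\Lambda_k\to\Omega_k$ let $\Phi_{\eta}:H\to G$ be the bounded operator determined, for all $l\ge k$, by post-composing elements of $H_l$ with the image of $\eta_{\Gamma_k\cdots\Gamma_1m_0}$ under the iterated maps $\gamma\mapsto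 W^{\Omega}\circ\Delta_{j+1}\gamma\circ(W^\Lambda)^{\dagger}$, $j=k,\dots,l-1$. **2-cells.** For $k\ge1$ choose a $*$-linear functor $\Delta_k'$ and natural transformations $\rho:\mathrm{id}\to\Delta_k\Delta_k'$ and $\rho':\mathrm{id}\to\Delta_k'\Delta_k$ satisfying the conjugate equations and the tracial condition commensurate with the weights: $$(\rho'_v)^\dagger\circ\Delta_k'(\sigma\tau^\dagger)\circ\rho'_v=\frac{\nu^k_w}{\nu^{k-1}_v}\langle\sigma,\tau\rangle 1_v$$ for simple $v\in\mathcal N_{k-1}$, $w\in\mathcal N_k$ and $\sigma,\tau:w\to\Delta_kv$ (such a choice exists). The loop operator $S_k:\mathrm{NT}(\Lambda_k,\Omega_k)\to\mathrm{NT}(\Lambda_{k-1},\Omega_{k-1})$ between spaces of natural transformations is $$(S_k\eta)_x=(\rho'_{\Omega_{k-1}x})^\dagger\circ\Delta_k'\big((W^\Omega_k)_x^\dagger\circ\eta_{\Gamma_kx}\circ(W^\Lambda_k)_x\big)\circ\rho'_{\Lambda_{k-1}x}.$$ A bounded quasi-flat sequence (BQFS) from $\Lambda_\bullet$ to $\Omega_\bullet$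 is a sequence $\underline\eta=\{\eta^{(k)}\in\mathrm{NT}(\Lambda_k,\Omega_k)\}_{k\ge0}$ with $S_k\eta^{(k)}=\eta^{(k-1)}$ for all $k\ge1$ and $\sup_{k,x}\|\eta^{(k)}_x\|<\infty$. These form the vector space $\mathbf{UC}^{\mathrm{tr}}_2(\Lambda_\bullet,\Omega_\bullet)$. **Theorem.** Let $\Gamma_\bullet,\Delta_\bullet$ be 0-cells of $\mathbf{UC}^{\mathrm{tr}}$ and $\Lambda_\bullet,\Omega_\bullet$ two 1-cells from $\Gamma_\bullet$ to $\Delta_\bullet$. The von Neumann $A$-$B$-bimodule structures $\mathcal{PB}(\Lambda_\bullet)$ on $H$ and $\mathcal{PB}(\Omega_\bullet)$ on $G$ exist and are unique. For every BQFS $\underline\eta$ from $\Lambda_\bullet$ to $\Omega_\bullet$ the operators $\Phi_{\eta^{(k)}}:H\to G$ converge in the strong operator topology as $k\to\infty$, the limit is an $A$-$B$-intertwiner, and $$\mathbf{UC}^{\mathrm{tr}}_2(\Lambda_\bullet,\Omega_\bullet)\ni\underline\eta\ \longmapsto\ \text{SOT-}\lim_{k\to\infty}\Phi_{\eta^{(k)}}\in{}_A\mathcal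 L_B(H,G)$$ is a linear isomorphism onto the space of all bounded $A$-$B$-intertwiners from $\mathcal{PB}(\Lambda_\bullet)$ to $\mathcal{PB}(\Omega_\bullet)$. -/

import Mathlib

open CategoryTheory Filter Topology

universe v u v₁ u₁ v₂ u₂ w

attribute [-instance] CategoryTheory.catToReflQuiver

namespace UC

/-- A C⋆-category: a complex linear category whose hom spaces are Banach spaces, with a conjugate
linear involution `dag`, a submultiplicative norm, the C⋆-identity `‖f†f‖ = ‖f‖²`, and such that
`f†f` is positive in the endomorphism algebra. Composition is in diagrammatic order:
`f ≫ dag f` is the endomorphism `f†f` of the source of `f`. -/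
class CStarCategory (C : Type u) [Category.{v} C] where
  homNormed : ∀ X Y : C, NormedAddCommGroup (X ⟶ Y)
  homSpace : ∀ X Y : C, NormedSpace ℂ (X ⟶ Y)
  homComplete : ∀ X Y : C, CompleteSpace (X ⟶ Y)
  add_comp : ∀ {X Y Z : C} (f g : X ⟶ Y) (h : Y ⟶ Z), (f + g) ≫ h = f ≫ h + g ≫ h
  comp_add : ∀ {X Y Z : C} (f : X ⟶ Y) (g h : Y ⟶ Z), f ≫ (g + h) = f ≫ g + f ≫ h
  smul_comp : ∀ {X Y Z : C} (c : ℂ) (f : X ⟶ Y) (g : Y ⟶ Z), (c • f) ≫ g = c • (f ≫ g)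
  comp_smul : ∀ {X Y Z : C} (f : X ⟶ Y) (c : ℂ) (g : Y ⟶ Z), f ≫ (c • g) = c • (f ≫ g)
  norm_comp_le : ∀ {X Y Z : C} (f : X ⟶ Y) (g : Y ⟶ Z), ‖f ≫ g‖ ≤ ‖f‖ * ‖g‖
  dag : ∀ {X Y : C}, (X ⟶ Y) → (Y ⟶ X)
  dag_dag : ∀ {X Y : C} (f : X ⟶ Y), dag (dag f) = f
  dag_add : ∀ {X Y : C} (f g : X ⟶ Y), dag (f + g) = dag f + dag g
  dag_smul : ∀ {X Y : C} (c : ℂ) (f : X ⟶ Y), dag (c • f) = (starRingEnd ℂ c) • dag f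
  dag_comp : ∀ {X Y Z : C} (f : X ⟶ Y) (g : Y ⟶ Z), dag (f ≫ g) = dag g ≫ dag f
  norm_comp_dag : ∀ {X Y : C} (f : X ⟶ Y), ‖f ≫ dag f‖ = ‖f‖ * ‖f‖
  comp_dag_pos : ∀ {X Y : C} (f : X ⟶ Y), ∃ g : X ⟶ X, f ≫ dag f = g ≫ dag g

attribute [reducible, instance] CStarCategory.homNormed CStarCategory.homSpace
attribute [instance] CStarCategory.homComplete

open CStarCategory

section basics

variable {C : Type u} [Category.{v} C] [CStarCategory C]

instance instPreadditive : Preadditive C where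
  homGroup _ _ := inferInstance
  add_comp _ _ _ := CStarCategory.add_comp
  comp_add _ _ _ := CStarCategory.comp_add

instance instLinear : Linear ℂ C where
  homModule _ _ := inferInstance
  smul_comp _ _ _ := CStarCategory.smul_comp
  comp_smul _ _ _ := CStarCategory.comp_smul

theorem dag_id (X : C) : dag (𝟙 X) = 𝟙 X := by
  have h := dag_comp (dag (𝟙 X)) (𝟙 X)
  simp only [Category.comp_id, dag_dag] at h
  exact h.symm

theorem dag_zero (X Y : C) : dag (0 : X ⟶ Y) = 0 := by
  have h := dag_smul (0 : ℂ) (0 : X ⟶ Y)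
  simpa using h

theorem dag_sum {X Y : C} {ι : Type*} (s : Finset ι) (f : ι → (X ⟶ Y)) :
    dag (∑ i ∈ s, f i) = ∑ i ∈ s, dag (f i) := by
  classical
  induction s using Finset.induction_on with
  | empty => simp [dag_zero]
  | insert a s ha ih => rw [Finset.sum_insert ha, Finset.sum_insert ha, dag_add, ih]

theorem norm_dag {X Y : C} (f : X ⟶ Y) : ‖dag f‖ = ‖f‖ := by
  have key : ∀ {X Y : C} (f : X ⟶ Y), ‖f‖ ≤ ‖dag f‖ := by
    intro X Y f
    rcases (norm_nonneg f).eq_or_lt with h | h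
    · rw [← h]; exact norm_nonneg _
    · have h1 := norm_comp_dag f
      have h2 := norm_comp_le f (dag f)
      rw [h1] at h2
      exact le_of_mul_le_mul_left h2 h
  apply le_antisymm _ (key f)
  simpa [dag_dag] using key (dag f)

/-- A morphism `u` is unitary if `u†u = 1` and `uu† = 1`. -/
def IsUnitaryHom {X Y : C} (f : X ⟶ Y) : Prop := f ≫ dag f = 𝟙 X ∧ dag f ≫ f = 𝟙 Y

theorem norm_unitary_le {X Y : C} {f : X ⟶ Y} (h : IsUnitaryHom f) : ‖f‖ ≤ 1 := by
  have h1 := norm_comp_dag f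
  have h2 := norm_comp_dag (𝟙 X)
  rw [dag_id, Category.comp_id] at h2
  rw [h.1] at h1
  have h3 : ‖𝟙 X‖ ≤ 1 := by
    rcases (norm_nonneg (𝟙 X)).eq_or_lt with h | h
    · rw [← h]; exact zero_le_one
    · nlinarith
  nlinarith [norm_nonneg f]

end basics

/-- A functor between C⋆-categories is star-linear if it is complex linear on hom spaces and
commutes with the involutions. -/
structure IsStarLinear {C : Type u₁} [Category.{v₁} C] [CStarCategory C]
    {D : Type u₂} [Category.{v₂} D] [CStarCategory D] (F : C ⥤ D) : Prop where
  map_add : ∀ {X Y : C} (f g : X ⟶ Y), F.map (f + g) = F.map f + F.map g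
  map_smul : ∀ {X Y : C} (c : ℂ) (f : X ⟶ Y), F.map (c • f) = c • F.map f
  map_dag : ∀ {X Y : C} (f : X ⟶ Y), F.map (dag f) = dag (F.map f)

/-- A functor is bi-faithful if it and its adjoint are both faithful. -/
def IsBiFaithful {C : Type u₁} [Category.{v₁} C] {D : Type u₂} [Category.{v₂} D]
    (F : C ⥤ D) : Prop :=
  F.Faithful ∧ ∃ G : D ⥤ C, Nonempty (F ⊣ G) ∧ G.Faithful

section functors

variable {C : Type u₁} [Category.{v₁} C] [CStarCategory C]
  {D : Type u₂} [Category.{v₂} D] [CStarCategory D] {F : C ⥤ D}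

theorem IsStarLinear.map_zero (h : IsStarLinear F) (X Y : C) : F.map (0 : X ⟶ Y) = 0 := by
  simpa using h.map_smul (0 : ℂ) (0 : X ⟶ Y)

theorem IsStarLinear.map_sum (h : IsStarLinear F) {X Y : C} {ι : Type*} (s : Finset ι)
    (f : ι → (X ⟶ Y)) : F.map (∑ i ∈ s, f i) = ∑ i ∈ s, F.map (f i) := by
  classical
  induction s using Finset.induction_on with
  | empty => simp [h.map_zero]
  | insert a s ha ih => rw [Finset.sum_insert ha, Finset.sum_insert ha, h.map_add, ih]

/-- The endomorphism C⋆-algebra of an object, with product `f * g = g ≫ f`. -/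
@[reducible] def endCStar (X : C) : CStarAlgebra (End X) where
  __ := (inferInstance : Ring (End X))
  __ := (CStarCategory.homNormed X X)
  norm_mul_le f g := by
    rw [mul_comm]; exact norm_comp_le g f
  star f := dag f
  star_involutive f := dag_dag f
  star_mul f g := dag_comp g f
  star_add f g := dag_add f g
  complete := (CStarCategory.homComplete X X).complete
  norm_mul_self_le f := (norm_comp_dag f).ge
  __ := (inferInstance : Algebra ℂ (End X))
  norm_smul_le c f := (norm_smul_le c (show X ⟶ X from f))
  star_smul c f := dag_smul c f

/-- Star-linear functors are contractive. -/
theorem IsStarLinear.norm_map_le (h : IsStarLinear F) {X Y : C} (f : X ⟶ Y) :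
    ‖F.map f‖ ≤ ‖f‖ := by
  let _ := endCStar X
  let _ := endCStar (F.obj X)
  let φ : End X →⋆ₙₐ[ℂ] End (F.obj X) :=
    { toFun := fun g => F.map g
      map_smul' := fun c g => h.map_smul c g
      map_zero' := h.map_zero _ _
      map_add' := fun f g => h.map_add f g
      map_mul' := fun f g => F.map_comp g f
      map_star' := fun f => h.map_dag f }
  have h1 : ‖F.map (f ≫ dag f)‖ ≤ ‖f ≫ dag f‖ := 
    NonUnitalStarAlgHom.norm_apply_le φ (show End X from f ≫ dag f)
  rw [F.map_comp, h.map_dag, norm_comp_dag, norm_comp_dag] at h1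
  exact abs_le_of_sq_le_sq' (by nlinarith) (norm_nonneg _) |>.2

end functors

/-- A finite semisimple C⋆-category: a C⋆-category with finite orthogonal direct sums, together with
a finite set `Vert` labelling a maximal set `simple` of mutually non-isomorphic simple objects, such
that every object `x` is a finite orthogonal direct sum of simple ones, that is,
`1_x = ∑ v, ∑ σ ∈ ONB(v, x), σ σ†`, where `ONB(v, x)` is an orthonormal family of isometries. -/
class FinSemisimple (C : Type u) [Category.{v} C] [CStarCategory C] where
  Vert : Type
  fintypeVert : Fintype Vert
  decEqVert : DecidableEq Vert
  simple : Vert → C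
  simple_end : ∀ (v : Vert) (f : simple v ⟶ simple v), ∃ c : ℂ, f = c • 𝟙 (simple v)
  simple_ne_zero : ∀ v : Vert, 𝟙 (simple v) ≠ 0
  simple_hom : ∀ v w : Vert, v ≠ w → ∀ f : simple v ⟶ simple w, f = 0
  decomp : ∀ x : C, ∃ (n : Vert → ℕ) (σ : ∀ v, Fin (n v) → (simple v ⟶ x)),
    (∀ v i j, σ v i ≫ dag (σ v j) = if i = j then 𝟙 (simple v) else 0) ∧
    ∑ v, ∑ i, dag (σ v i) ≫ σ v i = 𝟙 x
  directSum : ∀ (ι : Type) [Fintype ι] (f : ι → C), ∃ (x : C) (s : ∀ i, f i ⟶ x),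
    (∀ i, s i ≫ dag (s i) = 𝟙 (f i)) ∧ (∀ i j, i ≠ j → s i ≫ dag (s j) = 0) ∧
    ∑ i, dag (s i) ≫ s i = 𝟙 x

attribute [reducible, instance] FinSemisimple.fintypeVert FinSemisimple.decEqVert

open FinSemisimple

section semisimple

variable {C : Type u} [Category.{v} C] [CStarCategory C] [FinSemisimple C]

/-- The number of elements of a (chosen) orthonormal basis `ONB(v, x)` of the space of morphisms
from the simple object `v` to `x`. -/
noncomputable def mult (x : C) (v : Vert C) : ℕ := (decomp x).choose v

/-- A (chosen) orthonormal basis `ONB(v, x)`. -/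
noncomputable def onb (x : C) (v : Vert C) (i : Fin (mult x v)) : simple v ⟶ x :=
  (decomp x).choose_spec.choose v i

theorem onb_orth (x : C) (v : Vert C) (i j : Fin (mult x v)) :
    onb x v i ≫ dag (onb x v j) = if i = j then 𝟙 (simple v) else 0 :=
  (decomp x).choose_spec.choose_spec.1 v i j

theorem onb_sum (x : C) : ∑ v, ∑ i, dag (onb x v i) ≫ onb x v i = 𝟙 x :=
  (decomp x).choose_spec.choose_spec.2

/-- The scalar `c` with `f = c • 1`, for an endomorphism `f` of a simple object. For
`σ, τ : v ⟶ x` the inner product `⟨σ, τ⟩` is `scal (σ ≫ dag τ)`. -/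
noncomputable def scal {v : Vert C} (f : (simple v : C) ⟶ simple v) : ℂ := (simple_end v f).choose

theorem scal_spec {v : Vert C} (f : (simple v : C) ⟶ simple v) : f = scal f • 𝟙 (simple v) :=
  (simple_end v f).choose_spec

theorem scal_unique {v : Vert C} {f : (simple v : C) ⟶ simple v} {c : ℂ}
    (h : f = c • 𝟙 (simple v)) : scal f = c := by
  have h1 := scal_spec f
  rw [h] at h1
  by_contra hne
  have h2 : (c - scal (c • 𝟙 (simple v : C))) • 𝟙 (simple v : C) = 0 := by
    rw [sub_smul, sub_eq_zero]; exact h1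
  rcases smul_eq_zero.1 h2 with h3 | h3
  · rw [sub_eq_zero, ← h] at h3; exact hne h3.symm
  · exact simple_ne_zero v h3

theorem scal_add {v : Vert C} (f g : (simple v : C) ⟶ simple v) :
    scal (f + g) = scal f + scal g :=
  scal_unique (by rw [add_smul, ← scal_spec, ← scal_spec])

theorem scal_smul {v : Vert C} (c : ℂ) (f : (simple v : C) ⟶ simple v) :
    scal (c • f) = c * scal f :=
  scal_unique (by rw [mul_smul, ← scal_spec])

theorem scal_zero {v : Vert C} : scal (0 : (simple v : C) ⟶ simple v) = 0 :=
  scal_unique (by rw [zero_smul])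

theorem scal_id {v : Vert C} : scal (𝟙 (simple v : C)) = 1 :=
  scal_unique (by rw [one_smul])

theorem scal_sum {v : Vert C} {ι : Type*} (s : Finset ι) (f : ι → ((simple v : C) ⟶ simple v)) :
    scal (∑ i ∈ s, f i) = ∑ i ∈ s, scal (f i) := by
  classical
  induction s using Finset.induction_on with
  | empty => simp [scal_zero]
  | insert a s ha ih => rw [Finset.sum_insert ha, Finset.sum_insert ha, scal_add, ih]

theorem scal_dag {v : Vert C} (f : (simple v : C) ⟶ simple v) :
    scal (dag f) = starRingEnd ℂ (scal f) := by
  refine scal_unique ?_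
  conv_lhs => rw [scal_spec f]
  rw [dag_smul, dag_id]

theorem scal_comp {v : Vert C} (f g : (simple v : C) ⟶ simple v) :
    scal (f ≫ g) = scal f * scal g := by
  refine scal_unique ?_
  conv_lhs => rw [scal_spec f, scal_spec g]
  rw [CStarCategory.smul_comp, Category.id_comp, smul_smul]

/-- Composing with an endomorphism of a simple object is multiplication by its scalar. -/
theorem simple_comp {v : Vert C} {x : C} (f : (simple v : C) ⟶ simple v) (g : simple v ⟶ x) :
    f ≫ g = scal f • g := by
  conv_lhs => rw [scal_spec f]
  rw [CStarCategory.smul_comp, Category.id_comp]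

theorem comp_simple {v : Vert C} {x : C} (g : x ⟶ simple v) (f : (simple v : C) ⟶ simple v) :
    g ≫ f = scal f • g := by
  conv_lhs => rw [scal_spec f]
  rw [CStarCategory.comp_smul, Category.comp_id]

theorem scal_comm {v w : Vert C} (f : (simple v : C) ⟶ simple w) (g : (simple w : C) ⟶ simple v)
    (μ : Vert C → ℂ) : μ v * scal (f ≫ g) = μ w * scal (g ≫ f) := by
  by_cases h : v = w
  · subst h
    rw [scal_comp, scal_comp, mul_comm (scal f)]
  · rw [simple_hom v w h f]
    simp [scal_zero]

theorem norm_id_simple (v : Vert C) : ‖𝟙 (simple v : C)‖ = 1 := by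
  have h := norm_comp_dag (𝟙 (simple v : C))
  rw [dag_id, Category.comp_id] at h
  have h1 : ‖𝟙 (simple v : C)‖ ≠ 0 := norm_ne_zero_iff.2 (simple_ne_zero v)
  exact mul_left_cancel₀ h1 (by rw [← h, mul_one])

theorem scal_comp_dag {v : Vert C} {x : C} (f : simple v ⟶ x) :
    scal (f ≫ dag f) = ((‖f‖ ^ 2 : ℝ) : ℂ) := by
  obtain ⟨g, hg⟩ := comp_dag_pos f
  have h1 : f ≫ dag f = ((‖scal g‖ ^ 2 : ℝ) : ℂ) • 𝟙 (simple v) := by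
    refine (hg.trans (scal_spec _)).trans ?_
    rw [scal_comp, scal_dag, Complex.mul_conj, Complex.normSq_eq_norm_sq]
  have h2 : ‖f‖ * ‖f‖ = ‖scal g‖ ^ 2 := by
    rw [← norm_comp_dag, h1, norm_smul, norm_id_simple, mul_one, Complex.norm_real,
      Real.norm_of_nonneg (by positivity)]
  rw [scal_unique h1, ← h2, sq]

/-- A morphism is determined by its composites with the elements of `ONB(v, x)`. -/
theorem comp_onb_sum {x y : C} (f : x ⟶ y) :
    ∑ v, ∑ i, dag (onb x v i) ≫ onb x v i ≫ f = f := by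
  have h := congrArg (· ≫ f) (onb_sum x)
  simpa [Preadditive.sum_comp] using h

theorem sum_comp_onb {x y : C} (f : x ⟶ y) :
    ∑ v, ∑ i, (f ≫ dag (onb y v i)) ≫ onb y v i = f := by
  have h := congrArg (f ≫ ·) (onb_sum y)
  simpa [Preadditive.comp_sum] using h

/-- A morphism from a simple object expands in the orthonormal basis. -/
theorem expand_simple {v : Vert C} {y : C} (f : simple v ⟶ y) :
    ∑ i, scal (f ≫ dag (onb y v i)) • onb y v i = f := by
  conv_rhs => rw [← sum_comp_onb f]
  rw [Finset.sum_eq_single v]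
  · exact Finset.sum_congr rfl fun i _ => (simple_comp _ _).symm
  · intro w _ hw
    refine Finset.sum_eq_zero fun i _ => ?_
    rw [simple_hom v w hw.symm (f ≫ dag (onb y w i)), Limits.zero_comp]
  · simp

theorem mult_eq_finrank (x : C) (v : Vert C) :
    mult x v = Module.finrank ℂ ((simple v : C) ⟶ x) := by
  have li : LinearIndependent ℂ (onb x v) := by
    rw [Fintype.linearIndependent_iff]
    intro g hg i
    have h := congrArg (fun f => scal (f ≫ dag (onb x v i))) hg
    simpa [Preadditive.sum_comp, scal_sum, scal_smul, onb_orth, apply_ite scal, scal_id, scal_zero]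
      using h
  have sp : ⊤ ≤ Submodule.span ℂ (Set.range (onb x v)) := by
    intro f _
    rw [← expand_simple f]
    exact Submodule.sum_mem _ fun i _ => Submodule.smul_mem _ _ (Submodule.subset_span ⟨i, rfl⟩)
  rw [Module.finrank_eq_card_basis (Module.Basis.mk li sp), Fintype.card_fin]

/-- The categorical trace associated to the weight function `μ`:
`Tr_x α = ∑ v, ∑ σ ∈ ONB(v, x), μ v ⟨α σ, σ⟩`. -/
noncomputable def Tr (μ : Vert C → ℝ) (x : C) (α : x ⟶ x) : ℂ :=
  ∑ v, ∑ i, (μ v : ℂ) * scal (onb x v i ≫ α ≫ dag (onb x v i))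

theorem Tr_add (μ : Vert C → ℝ) (x : C) (α β : x ⟶ x) :
    Tr μ x (α + β) = Tr μ x α + Tr μ x β := by
  simp [Tr, scal_add, mul_add, Finset.sum_add_distrib]

theorem Tr_smul (μ : Vert C → ℝ) (x : C) (c : ℂ) (α : x ⟶ x) :
    Tr μ x (c • α) = c * Tr μ x α := by
  simp only [Tr, Finset.mul_sum]
  refine Finset.sum_congr rfl fun v _ => Finset.sum_congr rfl fun i _ => ?_
  rw [CStarCategory.smul_comp, CStarCategory.comp_smul, scal_smul]
  ring

theorem Tr_sum (μ : Vert C → ℝ) (x : C) {ι : Type*} (s : Finset ι) (f : ι → (x ⟶ x)) :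
    Tr μ x (∑ i ∈ s, f i) = ∑ i ∈ s, Tr μ x (f i) := by
  classical
  induction s using Finset.induction_on with
  | empty => simp [Tr, scal_zero]
  | insert a s ha ih => rw [Finset.sum_insert ha, Finset.sum_insert ha, Tr_add, ih]

theorem Tr_dag (μ : Vert C → ℝ) (x : C) (α : x ⟶ x) :
    Tr μ x (dag α) = starRingEnd ℂ (Tr μ x α) := by
  simp only [Tr, map_sum, map_mul, Complex.conj_ofReal]
  refine Finset.sum_congr rfl fun v _ => Finset.sum_congr rfl fun i _ => ?_
  rw [← scal_dag, dag_comp, dag_comp, dag_dag, Category.assoc]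

/-- The trace property `Tr_x (α β) = Tr_y (β α)`. -/
theorem Tr_comm (μ : Vert C → ℝ) {x y : C} (f : x ⟶ y) (g : y ⟶ x) :
    Tr μ x (f ≫ g) = Tr μ y (g ≫ f) := by
  have key : ∀ {x y : C} (f : x ⟶ y) (g : y ⟶ x), Tr μ x (f ≫ g) = ∑ v, ∑ i, ∑ w, ∑ j,
      (μ v : ℂ) * scal ((onb x v i ≫ f ≫ dag (onb y w j)) ≫ (onb y w j ≫ g ≫ dag (onb x v i))) := by
    intro x y f g
    refine Finset.sum_congr rfl fun v _ => Finset.sum_congr rfl fun i _ => ?_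
    conv_lhs => rw [← sum_comp_onb f]
    simp only [Preadditive.sum_comp, Preadditive.comp_sum, scal_sum, Finset.mul_sum, Category.assoc]
  rw [key, key]
  have h1 : ∀ v i w j, (μ v : ℂ) * scal ((onb x v i ≫ f ≫ dag (onb y w j)) ≫
      (onb y w j ≫ g ≫ dag (onb x v i))) = (μ w : ℂ) * scal ((onb y w j ≫ g ≫ dag (onb x v i)) ≫
      (onb x v i ≫ f ≫ dag (onb y w j))) :=
    fun v i w j => scal_comm _ _ fun v => (μ v : ℂ)
  simp only [h1]
  calc _ = ∑ v, ∑ w, ∑ i, ∑ j, (μ w : ℂ) * scal ((onb y w j ≫ g ≫ dag (onb x v i)) ≫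
      (onb x v i ≫ f ≫ dag (onb y w j))) :=
        Finset.sum_congr rfl fun v _ => Finset.sum_comm
    _ = ∑ w, ∑ v, ∑ i, ∑ j, (μ w : ℂ) * scal ((onb y w j ≫ g ≫ dag (onb x v i)) ≫
      (onb x v i ≫ f ≫ dag (onb y w j))) := Finset.sum_comm
    _ = ∑ w, ∑ v, ∑ j, ∑ i, (μ w : ℂ) * scal ((onb y w j ≫ g ≫ dag (onb x v i)) ≫
      (onb x v i ≫ f ≫ dag (onb y w j))) :=
        Finset.sum_congr rfl fun w _ => Finset.sum_congr rfl fun v _ => Finset.sum_comm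
    _ = _ := Finset.sum_congr rfl fun w _ => Finset.sum_comm

theorem Tr_id (μ : Vert C → ℝ) (x : C) : Tr μ x (𝟙 x) = ∑ v, (mult x v : ℂ) * μ v := by
  simp only [Tr, Category.id_comp, onb_orth, if_true, scal_id, mul_one, Finset.sum_const,
    Finset.card_univ, Fintype.card_fin, nsmul_eq_mul]

/-- `Tr (ξ†ξ) = ∑ v, μ v ∑ σ ∈ ONB(v, x), ‖ξ σ‖²`. -/
theorem Tr_comp_dag (μ : Vert C → ℝ) {x y : C} (f : x ⟶ y) :
    Tr μ x (f ≫ dag f) = ((∑ v, ∑ i, μ v * ‖onb x v i ≫ f‖ ^ 2 : ℝ) : ℂ) := by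
  simp only [Tr, Complex.ofReal_sum, Complex.ofReal_mul]
  refine Finset.sum_congr rfl fun v _ => Finset.sum_congr rfl fun i _ => ?_
  rw [← scal_comp_dag, dag_comp]
  simp only [Category.assoc]

theorem Tr_simple (μ : Vert C → ℝ) (w : Vert C) (f : (simple w : C) ⟶ simple w) :
    Tr μ (simple w) f = μ w * scal f := by
  have h : ∀ (v : Vert C) (i : Fin (mult (simple w : C) v)), (μ v : ℂ) *
      scal (onb (simple w : C) v i ≫ f ≫ dag (onb (simple w : C) v i)) = (μ w : ℂ) *
      scal ((f ≫ dag (onb (simple w : C) v i)) ≫ onb (simple w : C) v i) :=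
    fun v i => scal_comm _ _ fun v => (μ v : ℂ)
  simp only [Tr, h, ← Finset.mul_sum, ← scal_sum]
  rw [sum_comp_onb]

end semisimple

section adjacency

variable {C : Type u₁} [Category.{v₁} C] [CStarCategory C] [FinSemisimple C]
  {D : Type u₂} [Category.{v₂} D] [CStarCategory D] [FinSemisimple D]

/-- The adjacency matrix of (the bipartite graph of) a functor: the number of edges between `w` and
`v` is the dimension of the space of morphisms from `w` to `F v`. -/
noncomputable def adjacency (F : C ⥤ D) (w : Vert D) (v : Vert C) : ℕ :=
  Module.finrank ℂ ((simple w : D) ⟶ F.obj (simple v))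

/-- If `F' ν = μ`, then `F` preserves the categorical traces. -/
theorem Tr_map {F : C ⥤ D} (hF : IsStarLinear F) {μ : Vert C → ℝ} {ν : Vert D → ℝ}
    (h : ∀ v, ∑ w, (adjacency F w v : ℝ) * ν w = μ v) (x : C) (α : x ⟶ x) :
    Tr ν (F.obj x) (F.map α) = Tr μ x α := by
  have h1 : ∀ v, Tr ν (F.obj (simple v)) (𝟙 _) = μ v := by
    intro v
    rw [Tr_id, ← h v]
    push_cast
    refine Finset.sum_congr rfl fun w _ => ?_
    rw [mult_eq_finrank, adjacency]
  conv_lhs => rw [← comp_onb_sum α, hF.map_sum, Tr_sum]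
  refine Finset.sum_congr rfl fun v _ => ?_
  rw [hF.map_sum, Tr_sum]
  refine Finset.sum_congr rfl fun i _ => ?_
  rw [F.map_comp, Tr_comm, ← F.map_comp, scal_spec ((onb x v i ≫ α) ≫ dag (onb x v i)),
    hF.map_smul, Tr_smul, F.map_id, h1, Category.assoc, mul_comm]

end adjacency

section extension

variable {C : Type u₁} [Category.{v₁} C] [CStarCategory C] [FinSemisimple C]
  {D : Type u₂} [Category.{v₂} D] [CStarCategory D]

/-- A family of morphisms on simple objects extends to a natural transformation between star-linear
functors. -/
noncomputable def natOfSimple {G K : C ⥤ D} (hG : IsStarLinear G) (hK : IsStarLinear K)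
    (t : ∀ v : Vert C, G.obj (simple v) ⟶ K.obj (simple v)) : G ⟶ K where
  app x := ∑ v, ∑ i, G.map (dag (onb x v i)) ≫ t v ≫ K.map (onb x v i)
  naturality x y a := by
    rw [Preadditive.comp_sum, Preadditive.sum_comp]
    refine Finset.sum_congr rfl fun v _ => ?_
    rw [Preadditive.comp_sum, Preadditive.sum_comp]
    have h1 : ∀ i, onb x v i ≫ a =
        ∑ j, scal (onb x v i ≫ a ≫ dag (onb y v j)) • onb y v j := by
      intro i
      have h := expand_simple (onb x v i ≫ a)
      simp only [Category.assoc] at h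
      exact h.symm
    have h2 : ∀ j, a ≫ dag (onb y v j) =
        ∑ i, scal (onb x v i ≫ a ≫ dag (onb y v j)) • dag (onb x v i) := by
      intro j
      have h := congrArg dag (expand_simple (onb y v j ≫ dag a))
      simp only [dag_sum, dag_smul, dag_comp, dag_dag, ← scal_dag, Category.assoc] at h
      exact h.symm
    have h3 : ∀ j, G.map a ≫ G.map (dag (onb y v j)) ≫ t v ≫ K.map (onb y v j) =
        ∑ i, scal (onb x v i ≫ a ≫ dag (onb y v j)) •
          (G.map (dag (onb x v i)) ≫ t v ≫ K.map (onb y v j)) := by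
      intro j
      conv_lhs => rw [← Category.assoc, ← G.map_comp, h2, hG.map_sum, Preadditive.sum_comp]
      refine Finset.sum_congr rfl fun i _ => ?_
      rw [hG.map_smul, CStarCategory.smul_comp]
    have h4 : ∀ i, (G.map (dag (onb x v i)) ≫ t v ≫ K.map (onb x v i)) ≫ K.map a =
        ∑ j, scal (onb x v i ≫ a ≫ dag (onb y v j)) •
          (G.map (dag (onb x v i)) ≫ t v ≫ K.map (onb y v j)) := by
      intro i
      rw [Category.assoc, Category.assoc, ← K.map_comp, h1, hK.map_sum, Preadditive.comp_sum,
        Preadditive.comp_sum]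
      refine Finset.sum_congr rfl fun j _ => ?_
      rw [hK.map_smul, CStarCategory.comp_smul, CStarCategory.comp_smul]
    simp only [h3, h4]
    rw [Finset.sum_comm]

theorem natOfSimple_simple {G K : C ⥤ D} (hG : IsStarLinear G) (hK : IsStarLinear K)
    (t : ∀ v : Vert C, G.obj (simple v) ⟶ K.obj (simple v)) (v : Vert C) :
    (natOfSimple hG hK t).app (simple v) = t v := by
  simp only [natOfSimple]
  rw [Finset.sum_eq_single v]
  · have h1 : ∀ i, G.map (dag (onb (simple v) v i)) ≫ t v ≫ K.map (onb (simple v) v i) =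
        scal (dag (onb (simple v) v i) ≫ onb (simple v) v i) • t v := by
      intro i
      rw [scal_spec (onb (simple v : C) v i), dag_smul, dag_id, hG.map_smul, hK.map_smul, G.map_id,
        K.map_id]
      simp only [CStarCategory.smul_comp, CStarCategory.comp_smul, Category.id_comp,
        Category.comp_id, scal_smul, scal_id, smul_smul, mul_one]
    simp only [h1]
    rw [← Finset.sum_smul, ← scal_sum]
    have h2 := onb_sum (simple v : C)
    rw [Finset.sum_eq_single v] at h2
    · rw [h2, scal_id, one_smul]
    · intro w _ hw
      refine Finset.sum_eq_zero fun i _ => ?_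
      rw [simple_hom w v hw (onb (simple v) w i), Limits.comp_zero]
    · simp
  · intro w _ hw
    refine Finset.sum_eq_zero fun i _ => ?_
    rw [simple_hom w v hw (onb (simple v) w i), hK.map_zero, Limits.comp_zero, Limits.comp_zero]
  · simp

/-- Natural transformations between star-linear functors are determined on simple objects. -/
theorem nat_ext_simple {G K : C ⥤ D} (hG : IsStarLinear G) {s t : G ⟶ K}
    (h : ∀ v : Vert C, s.app (simple v) = t.app (simple v)) (x : C) : s.app x = t.app x := by
  have key : ∀ s : G ⟶ K,
      s.app x = ∑ v, ∑ i, G.map (dag (onb x v i)) ≫ s.app (simple v) ≫ K.map (onb x v i) := by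
    intro s
    conv_lhs => rw [← Category.id_comp (s.app x), ← G.map_id, ← onb_sum x, hG.map_sum,
      Preadditive.sum_comp]
    refine Finset.sum_congr rfl fun v _ => ?_
    rw [hG.map_sum, Preadditive.sum_comp]
    refine Finset.sum_congr rfl fun i _ => ?_
    rw [G.map_comp, Category.assoc, s.naturality]
  rw [key s, key t]
  simp only [h]

end extension

section tracialSolution

variable {C : Type u₁} [Category.{v₁} C] [CStarCategory C] [FinSemisimple C]
  {D : Type u₂} [Category.{v₂} D] [CStarCategory D] [FinSemisimple D]

/-- A solution `(ρ, ρ')` of the conjugate equations for the duality of a star-linear functor `F` with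
a star-linear adjoint functor `F'`, which is tracial and commensurate with the weight functions
`(μ, ν)`: `ρ'_v† ∘ F'(σ τ†) ∘ ρ'_v = (ν w / μ v) ⟨σ, τ⟩ 1_v` for all `σ, τ : w ⟶ F v`. -/
structure TracialSolution (F : C ⥤ D) (μ : Vert C → ℝ) (ν : Vert D → ℝ) where
  F' : D ⥤ C
  starLinear : IsStarLinear F'
  ρ : 𝟭 D ⟶ F' ⋙ F
  ρ' : 𝟭 C ⟶ F ⋙ F'
  conj₁ : ∀ x : C, F.map (ρ'.app x) ≫ dag (ρ.app (F.obj x)) = 𝟙 (F.obj x)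
  conj₂ : ∀ y : D, ρ'.app (F'.obj y) ≫ F'.map (dag (ρ.app y)) = 𝟙 (F'.obj y)
  tracial : ∀ (v : Vert C) (w : Vert D) (σ τ : simple w ⟶ F.obj (simple v)),
    ρ'.app (simple v) ≫ F'.map (dag τ ≫ σ) ≫ dag (ρ'.app (simple v)) =
      (((ν w / μ v : ℝ) : ℂ) * scal (σ ≫ dag τ)) • 𝟙 (simple v)

/-- Index set of the direct sum decomposition `F' y = ⨁_{w, j ∈ ONB(w, y)} ⨁_{v, e ∈ ONB(w, F v)} v`
used to construct the adjoint of `F`. -/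
abbrev AdjIdx (F : C ⥤ D) (y : D) : Type :=
  Σ w : Vert D, Fin (mult y w) × Σ v : Vert C, Fin (mult (F.obj (simple v)) w)

noncomputable def adjObj (F : C ⥤ D) (y : D) : C :=
  (directSum (AdjIdx F y) fun i => (simple i.2.2.1 : C)).choose

noncomputable def adjInj (F : C ⥤ D) (y : D) (i : AdjIdx F y) :
    (simple i.2.2.1 : C) ⟶ adjObj F y :=
  (directSum (AdjIdx F y) fun i => (simple i.2.2.1 : C)).choose_spec.choose i

theorem adjInj_self (F : C ⥤ D) (y : D) (i : AdjIdx F y) :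
    adjInj F y i ≫ dag (adjInj F y i) = 𝟙 _ :=
  (directSum (AdjIdx F y) fun i => (simple i.2.2.1 : C)).choose_spec.choose_spec.1 i

theorem adjInj_ne (F : C ⥤ D) (y : D) (i j : AdjIdx F y) (h : i ≠ j) :
    adjInj F y i ≫ dag (adjInj F y j) = 0 :=
  (directSum (AdjIdx F y) fun i => (simple i.2.2.1 : C)).choose_spec.choose_spec.2.1 i j h

theorem adjInj_sum (F : C ⥤ D) (y : D) :
    ∑ i, dag (adjInj F y i) ≫ adjInj F y i = 𝟙 _ :=
  (directSum (AdjIdx F y) fun i => (simple i.2.2.1 : C)).choose_spec.choose_spec.2.2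

noncomputable def adjMap (F : C ⥤ D) {y y' : D} (g : y ⟶ y') : adjObj F y ⟶ adjObj F y' :=
  ∑ w, ∑ j, ∑ j', ∑ p : Σ v : Vert C, Fin (mult (F.obj (simple v)) w),
    scal (onb y w j ≫ g ≫ dag (onb y' w j')) •
      (dag (adjInj F y ⟨w, j, p⟩) ≫ adjInj F y' ⟨w, j', p⟩)

theorem adjInj_comp_adjMap (F : C ⥤ D) {y y' : D} (g : y ⟶ y') (w : Vert D) (j : Fin (mult y w))
    (p : Σ v : Vert C, Fin (mult (F.obj (simple v)) w)) :
    adjInj F y ⟨w, j, p⟩ ≫ adjMap F g =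
      ∑ j', scal (onb y w j ≫ g ≫ dag (onb y' w j')) • adjInj F y' ⟨w, j', p⟩ := by
  have key : ∀ w₁ j₁ (p₁ : Σ v : Vert C, Fin (mult (F.obj (simple v)) w₁)) (z : C)
      (k : (simple p₁.1 : C) ⟶ z), (⟨w, j, p⟩ : AdjIdx F y) ≠ ⟨w₁, j₁, p₁⟩ →
      adjInj F y ⟨w, j, p⟩ ≫ dag (adjInj F y ⟨w₁, j₁, p₁⟩) ≫ k = 0 := by
    intro w₁ j₁ p₁ z k h
    rw [← Category.assoc, adjInj_ne F y _ _ h, Limits.zero_comp]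
  simp only [adjMap, Preadditive.comp_sum, CStarCategory.comp_smul]
  rw [Finset.sum_eq_single w]
  · rw [Finset.sum_eq_single j]
    · refine Finset.sum_congr rfl fun j' _ => ?_
      rw [Finset.sum_eq_single p]
      · have e : ∀ {z : C} (k : (simple p.1 : C) ⟶ z),
            adjInj F y ⟨w, j, p⟩ ≫ dag (adjInj F y ⟨w, j, p⟩) ≫ k = k := by
          intro z k
          rw [← Category.assoc, adjInj_self, Category.id_comp]
        rw [e]
      · intro p₁ _ hp
        rw [key, smul_zero]
        simpa using hp.symm
      · simp
    · intro j₁ _ hj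
      refine Finset.sum_eq_zero fun j' _ => Finset.sum_eq_zero fun p₁ _ => ?_
      rw [key, smul_zero]
      simp [hj.symm]
    · simp
  · intro w₁ _ hw
    refine Finset.sum_eq_zero fun j₁ _ => Finset.sum_eq_zero fun j' _ =>
      Finset.sum_eq_zero fun p₁ _ => ?_
    rw [key, smul_zero]
    intro h
    exact hw (congrArg Sigma.fst h).symm
  · simp

/-- Morphisms out of `adjObj F y` are determined by their restrictions to the summands. -/
theorem adj_hom_ext (F : C ⥤ D) {y : D} {z : C} {f g : adjObj F y ⟶ z}
    (h : ∀ w j p, adjInj F y ⟨w, j, p⟩ ≫ f = adjInj F y ⟨w, j, p⟩ ≫ g) : f = g := by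
  have key : ∀ f : adjObj F y ⟶ z, f = ∑ i, dag (adjInj F y i) ≫ adjInj F y i ≫ f := by
    intro f
    conv_lhs => rw [← Category.id_comp f, ← adjInj_sum F y, Preadditive.sum_comp]
    simp only [Category.assoc]
  rw [key f, key g]
  exact Finset.sum_congr rfl fun ⟨w, j, p⟩ _ => by rw [h]

noncomputable def adjFunctor (F : C ⥤ D) : D ⥤ C where
  obj := adjObj F
  map g := adjMap F g
  map_id y := by
    refine adj_hom_ext F fun w j p => ?_
    rw [adjInj_comp_adjMap, Category.comp_id, Finset.sum_eq_single j]
    · rw [Category.id_comp, onb_orth, if_pos rfl, scal_id, one_smul]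
    · intro j' _ hj
      rw [Category.id_comp, onb_orth, if_neg hj.symm, scal_zero, zero_smul]
    · simp
  map_comp {y y' y''} g h := by
    refine adj_hom_ext F fun w j p => ?_
    rw [← Category.assoc, adjInj_comp_adjMap, adjInj_comp_adjMap, Preadditive.sum_comp]
    simp only [CStarCategory.smul_comp, adjInj_comp_adjMap, Finset.smul_sum, smul_smul]
    rw [Finset.sum_comm]
    refine Finset.sum_congr rfl fun j'' _ => ?_
    rw [← Finset.sum_smul]
    congr 1
    have h1 := expand_simple (onb y w j ≫ g)
    have h2 : onb y w j ≫ (g ≫ h) ≫ dag (onb y'' w j'') =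
        (onb y w j ≫ g) ≫ h ≫ dag (onb y'' w j'') := by simp only [Category.assoc]
    rw [h2, ← h1]
    simp only [Preadditive.sum_comp, scal_sum, CStarCategory.smul_comp, scal_smul, Category.assoc]

theorem adjFunctor_starLinear (F : C ⥤ D) : IsStarLinear (adjFunctor F) where
  map_add f g := by
    change adjMap F (f + g) = adjMap F f + adjMap F g
    simp only [adjMap, CStarCategory.add_comp, CStarCategory.comp_add, scal_add,
      add_smul, Finset.sum_add_distrib]
  map_smul c f := by
    change adjMap F (c • f) = c • adjMap F f
    simp only [adjMap, CStarCategory.smul_comp, CStarCategory.comp_smul, scal_smul,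
      mul_smul, Finset.smul_sum]
  map_dag {y y'} g := by
    change adjMap F (dag g) = dag (adjMap F g)
    simp only [adjMap, dag_sum, dag_smul, dag_comp, dag_dag, ← scal_dag, Category.assoc]
    refine Finset.sum_congr rfl fun w _ => ?_
    rw [Finset.sum_comm]

theorem dag_naturality {G K : C ⥤ D} (hG : IsStarLinear G) (hK : IsStarLinear K) (t : G ⟶ K)
    {x y : C} (f : x ⟶ y) : K.map f ≫ dag (t.app y) = dag (t.app x) ≫ G.map f := by
  have h := congrArg dag (t.naturality (dag f))
  rw [dag_comp, dag_comp, hG.map_dag, hK.map_dag, dag_dag, dag_dag] at h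
  exact h.symm

theorem isStarLinear_id : IsStarLinear (𝟭 C) := ⟨fun _ _ => rfl, fun _ _ => rfl, fun _ => rfl⟩

theorem IsStarLinear.comp {E : Type w} [Category.{v} E] [CStarCategory E] {F : C ⥤ D} {G : D ⥤ E}
    (hF : IsStarLinear F) (hG : IsStarLinear G) : IsStarLinear (F ⋙ G) where
  map_add f g := by simp only [Functor.comp_map, hF.map_add, hG.map_add]
  map_smul c f := by simp only [Functor.comp_map, hF.map_smul, hG.map_smul]
  map_dag f := by simp only [Functor.comp_map, hF.map_dag, hG.map_dag]

noncomputable def adjUnitSimple (F : C ⥤ D) (μ : Vert C → ℝ) (ν : Vert D → ℝ) (v : Vert C) :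
    (simple v : C) ⟶ adjObj F (F.obj (simple v)) :=
  ∑ w, ∑ e : Fin (mult (F.obj (simple v)) w),
    ((√(ν w / μ v) : ℝ) : ℂ) • adjInj F (F.obj (simple v)) ⟨w, e, ⟨v, e⟩⟩

noncomputable def adjCounitDag (F : C ⥤ D) (μ : Vert C → ℝ) (ν : Vert D → ℝ) (y : D) :
    y ⟶ F.obj (adjObj F y) :=
  ∑ w, ∑ j, ∑ p : Σ v : Vert C, Fin (mult (F.obj (simple v)) w),
    ((√(ν w / μ p.1))⁻¹ : ℂ) •
      (dag (onb y w j) ≫ onb (F.obj (simple p.1)) w p.2 ≫ F.map (adjInj F y ⟨w, j, p⟩))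

theorem adjInj_comp_counit {F : C ⥤ D} (hF : IsStarLinear F) (μ : Vert C → ℝ) (ν : Vert D → ℝ)
    (y : D) (w : Vert D) (j : Fin (mult y w))
    (p : Σ v : Vert C, Fin (mult (F.obj (simple v)) w)) :
    F.map (adjInj F y ⟨w, j, p⟩) ≫ dag (adjCounitDag F μ ν y) =
      ((√(ν w / μ p.1))⁻¹ : ℂ) • (dag (onb (F.obj (simple p.1)) w p.2) ≫ onb y w j) := by
  have key : ∀ w₁ j₁ (p₁ : Σ v : Vert C, Fin (mult (F.obj (simple v)) w₁)) (z : D)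
      (k : F.obj (simple p₁.1 : C) ⟶ z), (⟨w, j, p⟩ : AdjIdx F y) ≠ ⟨w₁, j₁, p₁⟩ →
      F.map (adjInj F y ⟨w, j, p⟩) ≫ F.map (dag (adjInj F y ⟨w₁, j₁, p₁⟩)) ≫ k = 0 := by
    intro w₁ j₁ p₁ z k h
    rw [← Category.assoc, ← F.map_comp, adjInj_ne F y _ _ h, hF.map_zero, Limits.zero_comp]
  have e : ∀ {z : D} (k : F.obj (simple p.1 : C) ⟶ z),
      F.map (adjInj F y ⟨w, j, p⟩) ≫ F.map (dag (adjInj F y ⟨w, j, p⟩)) ≫ k = k := by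
    intro z k
    rw [← Category.assoc, ← F.map_comp, adjInj_self, F.map_id, Category.id_comp]
  simp only [adjCounitDag, dag_sum, dag_smul, dag_comp, dag_dag, ← hF.map_dag, Preadditive.comp_sum,
    CStarCategory.comp_smul, Category.assoc]
  rw [Finset.sum_eq_single w]
  · rw [Finset.sum_eq_single j]
    · rw [Finset.sum_eq_single p]
      · rw [e]
        simp
      · intro p₁ _ hp
        rw [key, smul_zero]
        simpa using hp.symm
      · simp
    · intro j₁ _ hj
      refine Finset.sum_eq_zero fun p₁ _ => ?_
      rw [key, smul_zero]
      simp [hj.symm]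
    · simp
  · intro w₁ _ hw
    refine Finset.sum_eq_zero fun j₁ _ => Finset.sum_eq_zero fun p₁ _ => ?_
    rw [key, smul_zero]
    intro h
    exact hw (congrArg Sigma.fst h).symm
  · simp

noncomputable def adjCounitNat (F : C ⥤ D) (hF : IsStarLinear F) (μ : Vert C → ℝ)
    (ν : Vert D → ℝ) : 𝟭 D ⟶ adjFunctor F ⋙ F where
  app y := adjCounitDag F μ ν y
  naturality y y' g := by
    have h : F.map (adjMap F (dag g)) ≫ dag (adjCounitDag F μ ν y) =
        dag (adjCounitDag F μ ν y') ≫ dag g := by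
      have key : ∀ (z : D) (f f' : F.obj (adjObj F y') ⟶ z),
          (∀ w j p, F.map (adjInj F y' ⟨w, j, p⟩) ≫ f = F.map (adjInj F y' ⟨w, j, p⟩) ≫ f') →
          f = f' := by
        intro z f f' hff
        have k : ∀ f : F.obj (adjObj F y') ⟶ z, f = ∑ i,
            F.map (dag (adjInj F y' i)) ≫ F.map (adjInj F y' i) ≫ f := by
          intro f
          conv_lhs => rw [← Category.id_comp f, ← F.map_id, ← adjInj_sum F y', hF.map_sum,
            Preadditive.sum_comp]
          simp only [Category.assoc, F.map_comp]
        rw [k f, k f']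
        exact Finset.sum_congr rfl fun ⟨w, j, p⟩ _ => by rw [hff]
      refine key _ _ _ fun w j p => ?_
      rw [← Category.assoc, ← F.map_comp, adjInj_comp_adjMap, ← Category.assoc,
        adjInj_comp_counit hF, hF.map_sum, Preadditive.sum_comp]
      simp only [hF.map_smul, CStarCategory.smul_comp, adjInj_comp_counit hF, Category.assoc]
      have h1 := expand_simple (onb y' w j ≫ dag g)
      conv_rhs => rw [← h1]
      simp only [Preadditive.comp_sum, CStarCategory.comp_smul, Finset.smul_sum, Category.assoc]
      refine Finset.sum_congr rfl fun j' _ => ?_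
      rw [smul_comm]
    have h2 := congrArg dag h
    rw [dag_comp, dag_comp, dag_dag, dag_dag, dag_dag, ← hF.map_dag] at h2
    have h3 : dag (adjMap F (dag g)) = adjMap F g := by
      have h4 := (adjFunctor_starLinear F).map_dag (dag g)
      rw [dag_dag] at h4
      exact h4.symm
    rw [h3] at h2
    exact h2.symm

theorem adjUnitSimple_comp (F : C ⥤ D) (μ : Vert C → ℝ) (ν : Vert D → ℝ) (v : Vert C) {y : D}
    (g : F.obj (simple v) ⟶ y) :
    adjUnitSimple F μ ν v ≫ adjMap F g = ∑ w, ∑ e, ∑ j, (((√(ν w / μ v) : ℝ) : ℂ) *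
      scal (onb (F.obj (simple v)) w e ≫ g ≫ dag (onb y w j))) • adjInj F y ⟨w, j, ⟨v, e⟩⟩ := by
  simp only [adjUnitSimple, Preadditive.sum_comp, CStarCategory.smul_comp, adjInj_comp_adjMap,
    Finset.smul_sum, smul_smul]

theorem adjInj_comp_dag_unit (F : C ⥤ D) (μ : Vert C → ℝ) (ν : Vert D → ℝ) (v : Vert C)
    (w : Vert D) (j e : Fin (mult (F.obj (simple v)) w)) :
    adjInj F (F.obj (simple v)) ⟨w, j, ⟨v, e⟩⟩ ≫ dag (adjUnitSimple F μ ν v) =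
      if e = j then ((√(ν w / μ v) : ℝ) : ℂ) • 𝟙 (simple v) else 0 := by
  have key : ∀ w₁ (e₁ : Fin (mult (F.obj (simple v)) w₁)),
      (⟨w, j, ⟨v, e⟩⟩ : AdjIdx F (F.obj (simple v))) ≠ ⟨w₁, e₁, ⟨v, e₁⟩⟩ →
      adjInj F (F.obj (simple v)) ⟨w, j, ⟨v, e⟩⟩ ≫
        dag (adjInj F (F.obj (simple v)) ⟨w₁, e₁, ⟨v, e₁⟩⟩) = 0 :=
    fun w₁ e₁ h => adjInj_ne F _ _ _ h
  simp only [adjUnitSimple, dag_sum, dag_smul, Complex.conj_ofReal, Preadditive.comp_sum,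
    CStarCategory.comp_smul]
  rw [Finset.sum_eq_single w]
  · rw [Finset.sum_eq_single e]
    · split_ifs with h
      · subst h
        rw [adjInj_self]
      · rw [key, smul_zero]
        intro h'
        simp only [Sigma.mk.injEq, heq_eq_eq, Prod.mk.injEq, true_and, and_true] at h'
        exact h h'.symm
    · intro e₁ _ he
      rw [key, smul_zero]
      intro h'
      simp only [Sigma.mk.injEq, heq_eq_eq, Prod.mk.injEq, true_and] at h'
      exact he h'.2.symm
    · simp
  · intro w₁ _ hw
    refine Finset.sum_eq_zero fun e₁ _ => ?_
    rw [key, smul_zero]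
    intro h
    exact hw (congrArg Sigma.fst h).symm
  · simp

/-- Tracial solutions commensurate with given weights exist. -/
theorem exists_tracialSolution (F : C ⥤ D) (hF : IsStarLinear F) (μ : Vert C → ℝ) (ν : Vert D → ℝ)
    (hμ : ∀ v, 0 < μ v) (hν : ∀ w, 0 < ν w) : Nonempty (TracialSolution F μ ν) := by
  have hF' := adjFunctor_starLinear F
  let ρ' : 𝟭 C ⟶ F ⋙ adjFunctor F :=
    natOfSimple isStarLinear_id (hF.comp hF') (adjUnitSimple F μ ν)
  obtain ⟨r, hr⟩ : ∃ r : ∀ x : C, x ⟶ adjObj F (F.obj x), ∀ x, r x = ρ'.app x := ⟨_, fun _ => rfl⟩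
  have rnat : ∀ {x y : C} (a : x ⟶ y), a ≫ r y = r x ≫ adjMap F (F.map a) := by
    intro x y a
    rw [hr, hr]
    exact ρ'.naturality a
  have hρ' : ∀ v, r (simple v) = adjUnitSimple F μ ν v := fun v =>
    (hr _).trans (natOfSimple_simple isStarLinear_id (hF.comp hF') _ v)
  have hpos : ∀ v w, ((√(ν w / μ v) : ℝ) : ℂ) ≠ 0 := fun v w =>
    Complex.ofReal_ne_zero.2 (Real.sqrt_ne_zero'.2 (div_pos (hν w) (hμ v)))
  refine ⟨⟨adjFunctor F, hF', adjCounitNat F hF μ ν, ρ', ?_, ?_, ?_⟩⟩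
  · intro x
    let s : F ⟶ F :=
      { app := fun x => F.map (ρ'.app x) ≫ dag ((adjCounitNat F hF μ ν).app (F.obj x))
        naturality := by
          intro x y a
          have h1 : a ≫ ρ'.app y = ρ'.app x ≫ (adjFunctor F).map (F.map a) := ρ'.naturality a
          have h2 : F.map (dag a) ≫ (adjCounitNat F hF μ ν).app (F.obj x) =
              (adjCounitNat F hF μ ν).app (F.obj y) ≫
                F.map ((adjFunctor F).map (F.map (dag a))) :=
            (adjCounitNat F hF μ ν).naturality (F.map (dag a))
          have h3 := congrArg dag h2
          rw [dag_comp, dag_comp, hF.map_dag, hF'.map_dag, hF.map_dag, dag_dag, dag_dag] at h3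
          rw [← Category.assoc, ← F.map_comp, h1, F.map_comp, Category.assoc, Category.assoc, h3] }
    have h := nat_ext_simple hF (s := s) (t := 𝟙 F) ?_ x
    · exact h
    · intro v
      change F.map (ρ'.app (simple v)) ≫ dag (adjCounitDag F μ ν (F.obj (simple v))) =
        𝟙 (F.obj (simple v))
      have h0 : ρ'.app (simple v) = adjUnitSimple F μ ν v := (hr _).symm.trans (hρ' v)
      have h1 : F.map (ρ'.app (simple v)) = F.map (adjUnitSimple F μ ν v) := congrArg F.map h0
      refine (congrArg (· ≫ dag (adjCounitDag F μ ν (F.obj (simple v)))) h1).trans ?_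
      change F.map (adjUnitSimple F μ ν v) ≫ dag (adjCounitDag F μ ν (F.obj (simple v))) =
        𝟙 (F.obj (simple v))
      rw [ adjUnitSimple, hF.map_sum, Preadditive.sum_comp]
      conv_rhs => rw [← onb_sum (F.obj (simple v))]
      refine Finset.sum_congr rfl fun w _ => ?_
      rw [hF.map_sum, Preadditive.sum_comp]
      refine Finset.sum_congr rfl fun e _ => ?_
      rw [hF.map_smul, CStarCategory.smul_comp, adjInj_comp_counit hF, smul_smul,
        mul_inv_cancel₀ (hpos v w), one_smul]
  · intro y
    refine adj_hom_ext F fun w j p => ?_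
    have h1 := rnat (adjInj F y ⟨w, j, p⟩)
    have h2 : ∀ g : F.obj (adjObj F y) ⟶ y, adjMap F (F.map (adjInj F y ⟨w, j, p⟩)) ≫ adjMap F g =
        adjMap F (F.map (adjInj F y ⟨w, j, p⟩) ≫ g) :=
      fun g => ((adjFunctor F).map_comp _ _).symm
    have h3 := congrArg (fun f => adjInj F y ⟨w, j, p⟩ ≫ f ≫ adjMap F (dag (adjCounitDag F μ ν y)))
      (hr (adjObj F y))
    refine h3.symm.trans ?_
    change adjInj F y ⟨w, j, p⟩ ≫ r (adjObj F y) ≫ adjMap F (dag (adjCounitDag F μ ν y)) =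
      adjInj F y ⟨w, j, p⟩ ≫ 𝟙 (adjObj F y)
    rw [← Category.assoc, h1, Category.assoc, h2, adjInj_comp_counit hF, hρ', adjUnitSimple_comp,
      Category.comp_id, Finset.sum_eq_single w]
    · rw [Finset.sum_eq_single p.2, Finset.sum_eq_single j]
      · simp only [CStarCategory.smul_comp, CStarCategory.comp_smul, scal_smul, Category.assoc]
        rw [onb_orth, if_pos rfl, Category.comp_id, onb_orth, if_pos rfl, scal_id, mul_one,
          mul_inv_cancel₀ (hpos _ _), one_smul]
      · intro j' _ hj
        simp only [CStarCategory.smul_comp, CStarCategory.comp_smul, scal_smul, Category.assoc]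
        rw [onb_orth, if_neg hj.symm]
        simp [scal_zero]
      · simp
      · intro e _ he
        refine Finset.sum_eq_zero fun j' _ => ?_
        simp only [CStarCategory.smul_comp, CStarCategory.comp_smul, scal_smul]
        rw [← Category.assoc, ← Category.assoc, onb_orth, if_neg he]
        simp [scal_zero]
      · simp
    · intro w' _ hw
      refine Finset.sum_eq_zero fun e _ => Finset.sum_eq_zero fun j' _ => ?_
      simp only [CStarCategory.smul_comp, CStarCategory.comp_smul, scal_smul, Category.assoc]
      rw [simple_hom w w' hw.symm (onb y w j ≫ dag (onb y w' j'))]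
      simp [scal_zero]
    · simp
  · intro v w σ τ
    have h3 := congrArg (fun f => f ≫ adjMap F (dag τ ≫ σ) ≫ dag f) (hr (simple v))
    refine h3.symm.trans ?_
    change r (simple v) ≫ adjMap F (dag τ ≫ σ) ≫ dag (r (simple v)) = _
    rw [hρ', ← Category.assoc, adjUnitSimple_comp]
    simp only [Preadditive.sum_comp, CStarCategory.smul_comp, adjInj_comp_dag_unit, smul_ite,
      smul_zero, Finset.sum_ite_eq, Finset.mem_univ, if_true, smul_smul, ← Finset.sum_smul]
    congr 1
    have h := Tr_comm (fun w => ν w / μ v) (dag τ) σ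
    rw [Tr_simple] at h
    rw [← h]
    refine Finset.sum_congr rfl fun w' _ => Finset.sum_congr rfl fun e _ => ?_
    rw [mul_right_comm, ← Complex.ofReal_mul, Real.mul_self_sqrt (div_pos (hν w') (hμ v)).le]

end tracialSolution

/-- A tracial `0`-cell: a Bratteli diagram `M 0 ⟶ M 1 ⟶ ⋯` of finite semisimple C⋆-categories and
star-linear bi-faithful functors, with positive weights `μ k` on the simple objects of `M k` such
that `∑ v, μ 0 v = 1` and `(F k)' μ (k + 1) = μ k`. -/
structure ZeroCell where
  M : ℕ → Type u
  [cat : ∀ k, Category.{v} (M k)]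
  [cstar : ∀ k, CStarCategory (M k)]
  [fin : ∀ k, FinSemisimple (M k)]
  F : ∀ k, M k ⥤ M (k + 1)
  starLinear : ∀ k, IsStarLinear (F k)
  biFaithful : ∀ k, IsBiFaithful (F k)
  μ : ∀ k, Vert (M k) → ℝ
  μ_pos : ∀ k v, 0 < μ k v
  μ_zero : ∑ v, μ 0 v = 1
  μ_harmonic : ∀ k v, ∑ w, (adjacency (F k) w v : ℝ) * μ (k + 1) w = μ k v

attribute [instance] ZeroCell.cat ZeroCell.cstar ZeroCell.fin

namespace ZeroCell

/-- The object `m₀ = ⨁ v` (sum over all simple objects of `M 0`). -/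
noncomputable def m₀ (Γ : ZeroCell.{v, u}) : Γ.M 0 :=
  (directSum (Vert (Γ.M 0)) (simple : Vert (Γ.M 0) → Γ.M 0)).choose

/-- The object `Γ_k ⋯ Γ_1 m₀`. The finite dimensional C⋆-algebra `A_k` is its endomorphism algebra,
included in `A_(k+1)` by `α ↦ Γ_(k+1) α`. -/
@[reducible] noncomputable def X (Γ : ZeroCell.{v, u}) : ∀ k, Γ.M k
  | 0 => Γ.m₀
  | k + 1 => (Γ.F k).obj (X Γ k)

end ZeroCell

/-- A sequence of objects `Q k` of `Δ.M k` with unitaries `Δ_(k+1) (Q k) ⟶ Q (k+1)`. It gives an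
inductive system `Hom(Δ_k ⋯ Δ_1 n₀, Q k)`, with the inclusions `ξ ↦ conn ∘ Δ_(k+1) ξ`. -/
structure Tower (Δ : ZeroCell.{v, u}) where
  obj : ∀ k, Δ.M k
  conn : ∀ k, (Δ.F k).obj (obj k) ⟶ obj (k + 1)
  unitary : ∀ k, IsUnitaryHom (conn k)

namespace Tower

variable {Δ : ZeroCell.{v, u}}

/-- The inclusion `Hom(Δ_k ⋯ Δ_1 n₀, Q k) ⟶ Hom(Δ_(k+1) ⋯ Δ_1 n₀, Q (k+1))`. -/
noncomputable def step (Q : Tower Δ) (k : ℕ) (ξ : Δ.X k ⟶ Q.obj k) : Δ.X (k + 1) ⟶ Q.obj (k + 1) :=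
  (Δ.F k).map ξ ≫ Q.conn k

theorem step_add (Q : Tower Δ) (k : ℕ) (ξ ζ : Δ.X k ⟶ Q.obj k) :
    Q.step k (ξ + ζ) = Q.step k ξ + Q.step k ζ := by
  simp only [step, (Δ.starLinear k).map_add, CStarCategory.add_comp]

theorem step_smul (Q : Tower Δ) (k : ℕ) (c : ℂ) (ξ : Δ.X k ⟶ Q.obj k) :
    Q.step k (c • ξ) = c • Q.step k ξ := by
  simp only [step, (Δ.starLinear k).map_smul, CStarCategory.smul_comp]

/-- The sequences which are eventually compatible with the inclusions. Modulo the sequences which are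
eventually zero this is the union of the spaces `Hom(Δ_k ⋯ Δ_1 n₀, Q k)`. -/
def coherent (Q : Tower Δ) : Submodule ℂ (∀ k, Δ.X k ⟶ Q.obj k) where
  carrier := {ξ | ∃ N, ∀ k ≥ N, ξ (k + 1) = Q.step k (ξ k)}
  add_mem' := by
    rintro ξ ζ ⟨N, hN⟩ ⟨N', hN'⟩
    refine ⟨max N N', fun k hk => ?_⟩
    rw [Pi.add_apply, Pi.add_apply, step_add, hN k (le_trans (le_max_left _ _) hk),
      hN' k (le_trans (le_max_right _ _) hk)]
  zero_mem' := by
    refine ⟨0, fun k _ => ?_⟩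
    have h := Q.step_smul k 0 0
    simpa using h.symm
  smul_mem' := by
    rintro c ξ ⟨N, hN⟩
    refine ⟨N, fun k hk => ?_⟩
    rw [Pi.smul_apply, Pi.smul_apply, step_smul, hN k hk]

/-- The union of the spaces `Hom(Δ_k ⋯ Δ_1 n₀, Q k)`, before dividing out the null vectors of the
semi-inner product below (which are the sequences that are eventually zero). -/
def Pre (Q : Tower Δ) : Type v := Q.coherent

noncomputable instance (Q : Tower Δ) : AddCommGroup Q.Pre :=
  inferInstanceAs (AddCommGroup Q.coherent)

noncomputable instance (Q : Tower Δ) : Module ℂ Q.Pre :=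
  inferInstanceAs (Module ℂ Q.coherent)

/-- The sequence underlying an element of `Pre Q`. -/
def val {Q : Tower Δ} (ξ : Q.Pre) (k : ℕ) : Δ.X k ⟶ Q.obj k := Subtype.val (p := (· ∈ Q.coherent)) ξ k

theorem val_add {Q : Tower Δ} (ξ ζ : Q.Pre) (k : ℕ) : val (ξ + ζ) k = val ξ k + val ζ k := rfl

theorem val_smul {Q : Tower Δ} (c : ℂ) (ξ : Q.Pre) (k : ℕ) : val (c • ξ) k = c • val ξ k := rfl

theorem val_coherent {Q : Tower Δ} (ξ : Q.Pre) :
    ∃ N, ∀ k ≥ N, val ξ (k + 1) = Q.step k (val ξ k) :=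
  Subtype.prop (p := (· ∈ Q.coherent)) ξ

theorem pre_ext {Q : Tower Δ} {ξ ζ : Q.Pre} (h : ∀ k, val ξ k = val ζ k) : ξ = ζ :=
  Subtype.ext (funext h)

/-- The number `Tr_k (ξ_k† ζ_k)`, which does not depend on `k` if `k` is large. -/
noncomputable def trInner (Q : Tower Δ) (ξ ζ : Q.Pre) (k : ℕ) : ℂ :=
  Tr (Δ.μ k) (Δ.X k) (val ζ k ≫ dag (val ξ k))

theorem exists_trInner (Q : Tower Δ) (ξ ζ : Q.Pre) :
    ∃ c, Tendsto (Q.trInner ξ ζ) atTop (𝓝 c) := by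
  obtain ⟨N, hN⟩ := val_coherent ξ
  obtain ⟨N', hN'⟩ := val_coherent ζ
  refine ⟨Q.trInner ξ ζ (max N N'), tendsto_atTop_of_eventually_const (i₀ := max N N') fun k hk => ?_⟩
  induction k, hk using Nat.le_induction with
  | base => rfl
  | succ k hk ih =>
    rw [← ih, trInner, trInner, hN k (le_trans (le_max_left _ _) hk),
      hN' k (le_trans (le_max_right _ _) hk), ← Tr_map (Δ.starLinear k) (Δ.μ_harmonic k)]
    congr 1
    simp only [step, dag_comp, Category.assoc]
    rw [← Category.assoc (Q.conn k), (Q.unitary k).1, Category.id_comp, (Δ.F k).map_comp,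
      (Δ.starLinear k).map_dag]

/-- The semi-inner product `⟨ξ, ζ⟩ = Tr (ξ† ζ)`, conjugate linear in the first variable. -/
@[reducible] noncomputable def core (Q : Tower Δ) : PreInnerProductSpace.Core ℂ Q.Pre where
  inner ξ ζ := (Q.exists_trInner ξ ζ).choose
  conj_inner_symm ξ ζ := by
    refine tendsto_nhds_unique ?_ (Q.exists_trInner ξ ζ).choose_spec
    have h := (Complex.continuous_conj.tendsto _).comp (Q.exists_trInner ζ ξ).choose_spec
    refine h.congr fun k => ?_
    simp only [Function.comp, trInner]
    rw [← Tr_dag, dag_comp, dag_dag]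
  re_inner_nonneg ξ := by
    have h := (Complex.continuous_re.tendsto _).comp (Q.exists_trInner ξ ξ).choose_spec
    refine ge_of_tendsto' h fun k => ?_
    simp only [Function.comp, trInner]
    rw [Tr_comp_dag, Complex.ofReal_re]
    exact Finset.sum_nonneg fun v _ => Finset.sum_nonneg fun i _ =>
      mul_nonneg (Δ.μ_pos k v).le (sq_nonneg _)
  add_left ξ ξ' ζ := by
    refine tendsto_nhds_unique (Q.exists_trInner (ξ + ξ') ζ).choose_spec ?_
    have h := (Q.exists_trInner ξ ζ).choose_spec.add (Q.exists_trInner ξ' ζ).choose_spec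
    refine h.congr fun k => ?_
    simp only [trInner]
    rw [← Tr_add, ← CStarCategory.comp_add, ← dag_add]
    rfl
  smul_left ξ ζ c := by
    refine tendsto_nhds_unique (Q.exists_trInner (c • ξ) ζ).choose_spec ?_
    have h := (Q.exists_trInner ξ ζ).choose_spec.const_mul (starRingEnd ℂ c)
    refine h.congr fun k => ?_
    simp only [trInner]
    rw [← Tr_smul, ← CStarCategory.comp_smul, ← dag_smul]
    rfl

noncomputable instance (Q : Tower Δ) : SeminormedAddCommGroup Q.Pre :=
  @InnerProductSpace.Core.toSeminormedAddCommGroup ℂ Q.Pre _ _ _ Q.core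

noncomputable instance (Q : Tower Δ) : InnerProductSpace ℂ Q.Pre :=
  InnerProductSpace.ofCore Q.core

theorem tendsto_trInner (Q : Tower Δ) (ξ ζ : Q.Pre) :
    Tendsto (Q.trInner ξ ζ) atTop (𝓝 (inner ℂ ξ ζ)) :=
  (Q.exists_trInner ξ ζ).choose_spec

theorem tendsto_norm (Q : Tower Δ) (ξ : Q.Pre) :
    Tendsto (fun k => (Q.trInner ξ ξ k).re) atTop (𝓝 (‖ξ‖ ^ 2)) := by
  have h := (Complex.continuous_re.tendsto _).comp (Q.tendsto_trInner ξ ξ)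
  have h2 : (inner ℂ ξ ξ : ℂ).re = ‖ξ‖ ^ 2 := inner_self_eq_norm_sq (𝕜 := ℂ) ξ
  rw [h2] at h
  exact h

/-- The Hilbert space completion of the union of the spaces `Hom(Δ_k ⋯ Δ_1 n₀, Q k)` with respect to
`⟨ξ, ζ⟩ = Tr (ξ† ζ)`. -/
abbrev L2 (Q : Tower Δ) : Type v := UniformSpace.Completion Q.Pre

variable {Q R : Tower Δ}

/-- The inclusion `Hom(Q k, R k) ⟶ Hom(Q (k+1), R (k+1))`, `γ ↦ conn ∘ Δ_(k+1) γ ∘ conn†`. -/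
def transport (Q R : Tower Δ) (k : ℕ) (γ : Q.obj k ⟶ R.obj k) : Q.obj (k + 1) ⟶ R.obj (k + 1) :=
  dag (Q.conn k) ≫ (Δ.F k).map γ ≫ R.conn k

/-- The composite inclusion `Hom(Q k, R k) ⟶ Hom(Q n, R n)` for `k ≤ n`. -/
def lift (Q R : Tower Δ) {k n : ℕ} (h : k ≤ n) (γ : Q.obj k ⟶ R.obj k) : Q.obj n ⟶ R.obj n :=
  Nat.leRec (motive := fun n _ => Q.obj n ⟶ R.obj n) γ (fun n _ => transport Q R n) h

theorem lift_succ {k n : ℕ} (h : k ≤ n) (γ : Q.obj k ⟶ R.obj k) :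
    lift Q R (le_trans h n.le_succ) γ = transport Q R n (lift Q R h γ) :=
  Nat.leRec_succ _ _ _

theorem norm_lift_le {k n : ℕ} (h : k ≤ n) (γ : Q.obj k ⟶ R.obj k) : ‖lift Q R h γ‖ ≤ ‖γ‖ := by
  induction n, h using Nat.le_induction with
  | base => rw [lift, Nat.leRec_self]
  | succ n hn ih =>
    rw [lift_succ hn, transport]
    have h1 := norm_comp_le (dag (Q.conn n)) ((Δ.F n).map (lift Q R hn γ) ≫ R.conn n)
    have h2 := norm_comp_le ((Δ.F n).map (lift Q R hn γ)) (R.conn n)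
    have h3 := (Δ.starLinear n).norm_map_le (lift Q R hn γ)
    have h4 := norm_unitary_le (Q.unitary n)
    have h5 := norm_unitary_le (R.unitary n)
    rw [norm_dag] at h1
    calc _ ≤ ‖Q.conn n‖ * ‖(Δ.F n).map (lift Q R hn γ) ≫ R.conn n‖ := h1
      _ ≤ 1 * ‖(Δ.F n).map (lift Q R hn γ) ≫ R.conn n‖ := by gcongr
      _ ≤ 1 * (‖(Δ.F n).map (lift Q R hn γ)‖ * ‖R.conn n‖) := by gcongr
      _ ≤ 1 * (‖γ‖ * 1) := by gcongr; exact h3.trans ih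
      _ = ‖γ‖ := by ring

theorem norm_le_of_tr {ξ : Q.Pre} {ζ : R.Pre} {c : ℝ} (hc : 0 ≤ c)
    (h : ∀ k, (R.trInner ζ ζ k).re ≤ c ^ 2 * (Q.trInner ξ ξ k).re) : ‖ζ‖ ≤ c * ‖ξ‖ := by
  have h1 := le_of_tendsto_of_tendsto' (R.tendsto_norm ζ) ((Q.tendsto_norm ξ).const_mul (c ^ 2)) h
  rw [← mul_pow] at h1
  exact abs_le_of_sq_le_sq' h1 (by positivity) |>.2

theorem trInner_nonneg (Q : Tower Δ) (ξ : Q.Pre) (k : ℕ) : 0 ≤ (Q.trInner ξ ξ k).re := by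
  simp only [trInner]
  rw [Tr_comp_dag, Complex.ofReal_re]
  exact Finset.sum_nonneg fun v _ => Finset.sum_nonneg fun i _ =>
    mul_nonneg (Δ.μ_pos k v).le (sq_nonneg _)

theorem Tr_comp_le {C : Type u} [Category.{v} C] [CStarCategory C] [FinSemisimple C]
    {μ : Vert C → ℝ} (hμ : ∀ v, 0 < μ v) {x y z : C} (f : x ⟶ y) (g : y ⟶ z) {c : ℝ}
    (hg : ‖g‖ ≤ c) :
    (Tr μ x ((f ≫ g) ≫ dag (f ≫ g))).re ≤ c ^ 2 * (Tr μ x (f ≫ dag f)).re := by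
  rw [Tr_comp_dag, Tr_comp_dag, Complex.ofReal_re, Complex.ofReal_re, Finset.mul_sum]
  refine Finset.sum_le_sum fun v _ => ?_
  rw [Finset.mul_sum]
  refine Finset.sum_le_sum fun i _ => ?_
  have h1 : ‖onb x v i ≫ f ≫ g‖ ≤ ‖onb x v i ≫ f‖ * c := by
    rw [← Category.assoc]
    exact (norm_comp_le _ _).trans (by gcongr)
  have h2 : ‖onb x v i ≫ f ≫ g‖ ^ 2 ≤ (‖onb x v i ≫ f‖ * c) ^ 2 := by gcongr
  have h3 := mul_le_mul_of_nonneg_left h2 (hμ v).le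
  linarith

/-- The operator `Φ_γ : ξ ↦ γ ∘ ξ` on the union of the spaces `Hom(Δ_n ⋯ Δ_1 n₀, Q n)`, `n ≥ k`. -/
noncomputable def leftPre (k : ℕ) (γ : Q.obj k ⟶ R.obj k) : Q.Pre →ₗ[ℂ] R.Pre where
  toFun ξ := ⟨fun n => if h : k ≤ n then val ξ n ≫ lift Q R h γ else 0, by
    obtain ⟨N, hN⟩ := val_coherent ξ
    refine ⟨max N k, fun n hn => ?_⟩
    have hk : k ≤ n := le_trans (le_max_right _ _) hn
    dsimp only
    rw [dif_pos hk, dif_pos (le_trans hk n.le_succ), hN n (le_trans (le_max_left _ _) hn),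
      lift_succ hk, step, step, transport, (Δ.F n).map_comp]
    simp only [Category.assoc]
    rw [← Category.assoc (Q.conn n), (Q.unitary n).1, Category.id_comp]⟩
  map_add' ξ ζ := by
    refine pre_ext fun n => ?_
    change (if h : k ≤ n then (val ξ n + val ζ n) ≫ lift Q R h γ else 0) =
      (if h : k ≤ n then val ξ n ≫ lift Q R h γ else 0) +
      (if h : k ≤ n then val ζ n ≫ lift Q R h γ else 0)
    split_ifs
    · rw [CStarCategory.add_comp]
    · rw [add_zero]
  map_smul' c ξ := by
    refine pre_ext fun n => ?_
    change (if h : k ≤ n then (c • val ξ n) ≫ lift Q R h γ else 0) =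
      c • (if h : k ≤ n then val ξ n ≫ lift Q R h γ else 0)
    split_ifs
    · rw [CStarCategory.smul_comp]
    · rw [smul_zero]

theorem norm_leftPre_le (k : ℕ) (γ : Q.obj k ⟶ R.obj k) (ξ : Q.Pre) :
    ‖leftPre k γ ξ‖ ≤ ‖γ‖ * ‖ξ‖ := by
  refine norm_le_of_tr (norm_nonneg _) fun n => ?_
  by_cases h : k ≤ n
  · have e : val (leftPre k γ ξ) n = val ξ n ≫ lift Q R h γ := dif_pos h
    simp only [trInner, e]
    exact Tr_comp_le (Δ.μ_pos n) _ _ (norm_lift_le h γ)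
  · have e : val (leftPre k γ ξ) n = 0 := dif_neg h
    have h1 : (R.trInner (leftPre k γ ξ) (leftPre k γ ξ) n).re = 0 := by
      simp [trInner, e, Tr, scal_zero]
    rw [h1]
    exact mul_nonneg (sq_nonneg _) (trInner_nonneg _ _ _)

/-- The bounded operator `Φ_γ` for `γ ∈ Hom(Q k, R k)`: it sends `ξ ∈ Hom(Δ_n ⋯ Δ_1 n₀, Q n)`,
`n ≥ k`, to `γ ∘ ξ`, where `γ` is viewed as an element of `Hom(Q n, R n)`. -/
noncomputable def leftOp (k : ℕ) (γ : Q.obj k ⟶ R.obj k) : Q.L2 →L[ℂ] R.L2 :=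
  ((leftPre k γ).mkContinuous ‖γ‖ (norm_leftPre_le k γ)).completion

/-- The tower `Δ_k ⋯ Δ_1 n₀`. -/
@[reducible] noncomputable def base (Δ : ZeroCell.{v, u}) : Tower Δ where
  obj := Δ.X
  conn _ := 𝟙 _
  unitary _ := ⟨by rw [dag_id, Category.comp_id], by rw [dag_id]; exact Category.comp_id _⟩

/-- The operator `ξ ↦ ξ ∘ β` on the union of the spaces `Hom(Δ_n ⋯ Δ_1 n₀, Q n)`, `n ≥ k`. -/
noncomputable def rightPre (Q : Tower Δ) (k : ℕ) (β : Δ.X k ⟶ Δ.X k) : Q.Pre →ₗ[ℂ] Q.Pre where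
  toFun ξ := ⟨fun n => if h : k ≤ n then lift (base Δ) (base Δ) h β ≫ val ξ n else 0, by
    obtain ⟨N, hN⟩ := val_coherent ξ
    refine ⟨max N k, fun n hn => ?_⟩
    have hk : k ≤ n := le_trans (le_max_right _ _) hn
    have e : transport (base Δ) (base Δ) n (lift (base Δ) (base Δ) hk β) =
        (Δ.F n).map (lift (base Δ) (base Δ) hk β) := by
      change dag (𝟙 _) ≫ (Δ.F n).map (lift (base Δ) (base Δ) hk β) ≫ 𝟙 _ = _
      rw [dag_id]
      exact (Category.id_comp _).trans (Category.comp_id _)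
    dsimp only
    rw [dif_pos hk, dif_pos (le_trans hk n.le_succ), hN n (le_trans (le_max_left _ _) hn),
      lift_succ hk, step, step, e]
    exact ((Category.assoc _ _ _).symm.trans
      (congrArg (· ≫ Q.conn n) ((Δ.F n).map_comp (lift (base Δ) (base Δ) hk β) (val ξ n)).symm))⟩
  map_add' ξ ζ := by
    refine pre_ext fun n => ?_
    change (if h : k ≤ n then lift (base Δ) (base Δ) h β ≫ (val ξ n + val ζ n) else 0) =
      (if h : k ≤ n then lift (base Δ) (base Δ) h β ≫ val ξ n else 0) +
      (if h : k ≤ n then lift (base Δ) (base Δ) h β ≫ val ζ n else 0)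
    split_ifs
    · exact CStarCategory.comp_add _ _ _
    · exact (add_zero _).symm
  map_smul' c ξ := by
    refine pre_ext fun n => ?_
    change (if h : k ≤ n then lift (base Δ) (base Δ) h β ≫ (c • val ξ n) else 0) =
      c • (if h : k ≤ n then lift (base Δ) (base Δ) h β ≫ val ξ n else 0)
    split_ifs
    · exact CStarCategory.comp_smul _ _ _
    · exact (smul_zero _).symm

theorem norm_rightPre_le (Q : Tower Δ) (k : ℕ) (β : Δ.X k ⟶ Δ.X k) (ξ : Q.Pre) :
    ‖rightPre Q k β ξ‖ ≤ ‖β‖ * ‖ξ‖ := by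
  refine norm_le_of_tr (norm_nonneg _) fun n => ?_
  by_cases h : k ≤ n
  · obtain ⟨b, hb, hbn⟩ : ∃ b : Δ.X n ⟶ Δ.X n, lift (base Δ) (base Δ) h β = b ∧ ‖b‖ ≤ ‖β‖ :=
      ⟨_, rfl, norm_lift_le (Q := base Δ) (R := base Δ) h β⟩
    have e : val (rightPre Q k β ξ) n = b ≫ val ξ n :=
      (dif_pos h).trans (by rw [hb])
    simp only [trInner, e]
    have h1 := Tr_comp_le (Δ.μ_pos n) (dag (val ξ n)) (dag b) ((norm_dag b).le.trans hbn)
    rw [← dag_comp, dag_dag, dag_dag, Tr_comm, Tr_comm _ (dag (val ξ n))] at h1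
    exact h1
  · have e : val (rightPre Q k β ξ) n = 0 := dif_neg h
    have h1 : (Q.trInner (rightPre Q k β ξ) (rightPre Q k β ξ) n).re = 0 := by
      simp [trInner, e, Tr, scal_zero]
    rw [h1]
    exact mul_nonneg (sq_nonneg _) (trInner_nonneg _ _ _)

/-- The bounded operator `ξ ↦ ξ ∘ β` for `β ∈ End(Δ_k ⋯ Δ_1 n₀)`: the right action of `B_k`. -/
noncomputable def rightOp (Q : Tower Δ) (k : ℕ) (β : Δ.X k ⟶ Δ.X k) : Q.L2 →L[ℂ] Q.L2 :=
  ((rightPre Q k β).mkContinuous ‖β‖ (norm_rightPre_le Q k β)).completion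

end Tower

/-- A `1`-cell from `Γ` to `Δ`: star-linear bi-faithful functors `Λ k : M k ⥤ N k` and natural
unitaries `W (k+1) : Δ_(k+1) Λ_k ⟶ Λ_(k+1) Γ_(k+1)`, such that
`ε μ^k ≤ (Λ k)' ν^k ≤ M μ^k` for all `k`, for some constants `ε, M > 0`. -/
structure OneCell (Γ : ZeroCell.{v₁, u₁}) (Δ : ZeroCell.{v₂, u₂}) where
  Λ : ∀ k, Γ.M k ⥤ Δ.M k
  starLinear : ∀ k, IsStarLinear (Λ k)
  biFaithful : ∀ k, IsBiFaithful (Λ k)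
  W : ∀ k, Λ k ⋙ Δ.F k ⟶ Γ.F k ⋙ Λ (k + 1)
  unitary : ∀ k x, IsUnitaryHom ((W k).app x)
  bounded : ∃ ε M : ℝ, 0 < ε ∧ 0 < M ∧ ∀ k v,
    ε * Γ.μ k v ≤ ∑ w, (adjacency (Λ k) w v : ℝ) * Δ.μ k w ∧
    ∑ w, (adjacency (Λ k) w v : ℝ) * Δ.μ k w ≤ M * Γ.μ k v

namespace ZeroCell

/-- The tracial solution to the conjugate equations for the duality of `Δ_(k+1)`, commensurate with
the weights. -/
noncomputable def sol (Δ : ZeroCell.{v, u}) (k : ℕ) :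
    TracialSolution (Δ.F k) (Δ.μ k) (Δ.μ (k + 1)) :=
  (exists_tracialSolution (Δ.F k) (Δ.starLinear k) _ _ (Δ.μ_pos k) (Δ.μ_pos (k + 1))).some

/-- The left multiplication operator on `L²(A_∞, Tr)` by an element of
`A_k = End(Γ_k ⋯ Γ_1 m₀)`. -/
noncomputable def mulOp (Γ : ZeroCell.{v, u}) (k : ℕ) (α : Γ.X k ⟶ Γ.X k) :
    (Tower.base Γ).L2 →L[ℂ] (Tower.base Γ).L2 :=
  Tower.leftOp (Q := Tower.base Γ) (R := Tower.base Γ) k α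

/-- The operators of left multiplication by elements of `A_∞ = ⋃ A_k`. -/
def mulOps (Γ : ZeroCell.{v, u}) : Set ((Tower.base Γ).L2 →L[ℂ] (Tower.base Γ).L2) :=
  {T | ∃ k α, T = Γ.mulOp k α}

/-- The von Neumann algebra `PB(Γ) = A_∞''` acting on `L²(A_∞, Tr)`. -/
noncomputable def vN (Γ : ZeroCell.{v, u}) : VonNeumannAlgebra (Tower.base Γ).L2 where
  toStarSubalgebra := StarSubalgebra.centralizer ℂ
    (StarSubalgebra.centralizer ℂ Γ.mulOps : Set ((Tower.base Γ).L2 →L[ℂ] (Tower.base Γ).L2))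
  centralizer_centralizer' := by
    change Set.centralizer (Set.centralizer ((StarSubalgebra.centralizer ℂ
      (StarSubalgebra.centralizer ℂ Γ.mulOps : Set ((Tower.base Γ).L2 →L[ℂ] (Tower.base Γ).L2)) :
        StarSubalgebra ℂ _) : Set ((Tower.base Γ).L2 →L[ℂ] (Tower.base Γ).L2))) =
      ((StarSubalgebra.centralizer ℂ
      (StarSubalgebra.centralizer ℂ Γ.mulOps : Set ((Tower.base Γ).L2 →L[ℂ] (Tower.base Γ).L2)) :
        StarSubalgebra ℂ _) : Set ((Tower.base Γ).L2 →L[ℂ] (Tower.base Γ).L2))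
    rw [StarSubalgebra.coe_centralizer_centralizer, Set.centralizer_centralizer_centralizer]

theorem mulOp_mem_vN (Γ : ZeroCell.{v, u}) (k : ℕ) (α : Γ.X k ⟶ Γ.X k) :
    Γ.mulOp k α ∈ Γ.vN.toStarSubalgebra := by
  change _ ∈ ((StarSubalgebra.centralizer ℂ
      (StarSubalgebra.centralizer ℂ Γ.mulOps : Set ((Tower.base Γ).L2 →L[ℂ] (Tower.base Γ).L2)) :
        StarSubalgebra ℂ _) : Set ((Tower.base Γ).L2 →L[ℂ] (Tower.base Γ).L2))
  rw [StarSubalgebra.coe_centralizer_centralizer]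
  exact Set.subset_centralizer_centralizer (Or.inl ⟨k, α, rfl⟩)

/-- An element of `A_k`, viewed as an element of the von Neumann algebra `PB(Γ)`. -/
noncomputable def toVN (Γ : ZeroCell.{v, u}) (k : ℕ) (α : Γ.X k ⟶ Γ.X k) :
    Γ.vN.toStarSubalgebra :=
  ⟨Γ.mulOp k α, Γ.mulOp_mem_vN k α⟩

end ZeroCell

section vonNeumann

variable {K : Type u} [NormedAddCommGroup K] [InnerProductSpace ℂ K] [CompleteSpace K]
  {L : Type v} [NormedAddCommGroup L] [InnerProductSpace ℂ L] [CompleteSpace L]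
  {H : Type w} [NormedAddCommGroup H] [InnerProductSpace ℂ H] [CompleteSpace H]
  {G : Type w} [NormedAddCommGroup G] [InnerProductSpace ℂ G] [CompleteSpace G]

/-- A functional on a von Neumann algebra on `K` is normal (ultraweakly continuous) if it is of the
form `a ↦ ∑ n, ⟨y n, a (x n)⟩` with square summable sequences of vectors of `K`. -/
def IsNormalFunctional (A : VonNeumannAlgebra K) (φ : A.toStarSubalgebra → ℂ) : Prop :=
  ∃ x y : ℕ → K, Summable (fun n => ‖x n‖ ^ 2) ∧ Summable (fun n => ‖y n‖ ^ 2) ∧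
    ∀ a, φ a = ∑' n, inner ℂ (y n) ((a : K →L[ℂ] K) (x n))

/-- A representation of a von Neumann algebra is normal if its matrix coefficients are normal. -/
def IsNormalAction (A : VonNeumannAlgebra K) (π : A.toStarSubalgebra → (H →L[ℂ] H)) : Prop :=
  ∀ ξ ζ : H, IsNormalFunctional A fun a => inner ℂ ζ (π a ξ)

/-- A von Neumann `A`-`B`-bimodule structure on a Hilbert space `H`: commuting normal unital
star-representations of `A` and of the opposite algebra of `B`. -/
@[ext]
structure VNBimodule (A : VonNeumannAlgebra K) (B : VonNeumannAlgebra L) (H : Type w)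
    [NormedAddCommGroup H] [InnerProductSpace ℂ H] [CompleteSpace H] where
  left : A.toStarSubalgebra →⋆ₐ[ℂ] (H →L[ℂ] H)
  right : (B.toStarSubalgebra)ᵐᵒᵖ →⋆ₐ[ℂ] (H →L[ℂ] H)
  left_normal : IsNormalAction A left
  right_normal : IsNormalAction B fun b => right (MulOpposite.op b)
  commute : ∀ a b, Commute (left a) (right b)

/-- The space of `A`-`B`-intertwiners: bounded operators commuting with both actions. -/
def VNBimodule.intertwiners {A : VonNeumannAlgebra K} {B : VonNeumannAlgebra L}
    (𝓗 : VNBimodule A B H) (𝓖 : VNBimodule A B G) : Submodule ℂ (H →L[ℂ] G) where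
  carrier := {T | (∀ a ξ, T (𝓗.left a ξ) = 𝓖.left a (T ξ)) ∧
    ∀ b ξ, T (𝓗.right b ξ) = 𝓖.right b (T ξ)}
  add_mem' := by
    rintro S T ⟨h1, h2⟩ ⟨h3, h4⟩
    exact ⟨fun a ξ => by simp [h1, h3], fun b ξ => by simp [h2, h4]⟩
  zero_mem' := ⟨fun a ξ => by simp, fun b ξ => by simp⟩
  smul_mem' := by
    rintro c T ⟨h1, h2⟩
    exact ⟨fun a ξ => by simp [h1], fun b ξ => by simp [h2]⟩

end vonNeumann

namespace OneCell

variable {Γ : ZeroCell.{v₁, u₁}} {Δ : ZeroCell.{v₂, u₂}}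

/-- The objects `Λ_k Γ_k ⋯ Γ_1 m₀` with the unitaries `W`. The inductive system of this tower is
`H_k = Hom(Δ_k ⋯ Δ_1 n₀, Λ_k Γ_k ⋯ Γ_1 m₀)` with the inclusions `ξ ↦ W ∘ Δ_(k+1) ξ`. -/
noncomputable def tower (Λ : OneCell Γ Δ) : Tower Δ where
  obj k := (Λ.Λ k).obj (Γ.X k)
  conn k := (Λ.W k).app (Γ.X k)
  unitary k := Λ.unitary k (Γ.X k)

/-- The Hilbert space `H` of the bimodule `PB(Λ)`. -/
abbrev H (Λ : OneCell Γ Δ) : Type v₂ := Λ.tower.L2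

/-- A von Neumann bimodule structure on `H` is the one of `PB(Λ)` if it extends the left action
`ξ ↦ Λ_k α ∘ ξ` of `α ∈ A_k` and the right action `ξ ↦ ξ ∘ β` of `β ∈ B_k`, for all `k`. -/
def IsPB (Λ : OneCell Γ Δ) (𝓗 : VNBimodule Γ.vN Δ.vN Λ.H) : Prop :=
  (∀ k (α : Γ.X k ⟶ Γ.X k), 𝓗.left (Γ.toVN k α) =
    Tower.leftOp (Q := Λ.tower) (R := Λ.tower) k ((Λ.Λ k).map α)) ∧
  ∀ k (β : Δ.X k ⟶ Δ.X k), 𝓗.right (MulOpposite.op (Δ.toVN k β)) = Λ.tower.rightOp k β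

variable (Λ Ω : OneCell Γ Δ)

/-- The loop operator `S_(k+1) : NT(Λ_(k+1), Ω_(k+1)) ⟶ NT(Λ_k, Ω_k)`:
`(S η)_x = ρ'† ∘ Δ'((W^Ω_x)† ∘ η_(Γ x) ∘ W^Λ_x) ∘ ρ'`. -/
noncomputable def loop (k : ℕ) : (Λ.Λ (k + 1) ⟶ Ω.Λ (k + 1)) →ₗ[ℂ] (Λ.Λ k ⟶ Ω.Λ k) where
  toFun η :=
    { app := fun x => (Δ.sol k).ρ'.app ((Λ.Λ k).obj x) ≫
        (Δ.sol k).F'.map ((Λ.W k).app x ≫ η.app ((Γ.F k).obj x) ≫ dag ((Ω.W k).app x)) ≫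
        dag ((Δ.sol k).ρ'.app ((Ω.Λ k).obj x))
      naturality := by
        intro x y f
        have h1 := (Δ.sol k).ρ'.naturality ((Λ.Λ k).map f)
        have h2 := dag_naturality isStarLinear_id
          ((Δ.starLinear k).comp (Δ.sol k).starLinear) (Δ.sol k).ρ' ((Ω.Λ k).map f)
        have h3 := (Λ.W k).naturality f
        have h4 := dag_naturality ((Ω.starLinear k).comp (Δ.starLinear k))
          ((Γ.starLinear k).comp (Ω.starLinear (k + 1))) (Ω.W k) f
        have h5 := η.naturality ((Γ.F k).map f)
        simp only [Functor.id_map, Functor.comp_map] at h1 h2 h3 h4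
        have h6 : (Δ.F k).map ((Λ.Λ k).map f) ≫
            ((Λ.W k).app y ≫ η.app ((Γ.F k).obj y) ≫ dag ((Ω.W k).app y)) =
            ((Λ.W k).app x ≫ η.app ((Γ.F k).obj x) ≫ dag ((Ω.W k).app x)) ≫
              (Δ.F k).map ((Ω.Λ k).map f) := by
          rw [Category.assoc, Category.assoc, ← h4, ← Category.assoc, h3, Category.assoc,
            ← Category.assoc ((Λ.Λ (k + 1)).map _), h5, Category.assoc]
        have h7 := ((Δ.sol k).F'.map_comp _ _).symm.trans
          ((congrArg (Δ.sol k).F'.map h6).trans ((Δ.sol k).F'.map_comp _ _))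
        rw [Category.assoc, Category.assoc, ← h2, ← Category.assoc, h1]
        exact (Category.assoc _ _ _).trans (congrArg ((Δ.sol k).ρ'.app ((Λ.Λ k).obj x) ≫ ·)
          ((Category.assoc _ _ _).symm.trans ((congrArg (· ≫ dag ((Δ.sol k).ρ'.app
            ((Ω.Λ k).obj y))) h7).trans (Category.assoc _ _ _)))) }
  map_add' η η' := by
    ext x
    simp only [NatTrans.app_add, CStarCategory.add_comp, CStarCategory.comp_add,
      (Δ.sol k).starLinear.map_add]
  map_smul' c η := by
    ext x
    simp only [NatTrans.app_smul, CStarCategory.smul_comp, CStarCategory.comp_smul,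
      (Δ.sol k).starLinear.map_smul, RingHom.id_apply]

/-- The space of bounded quasi-flat sequences from `Λ` to `Ω`. -/
noncomputable def BQFS : Submodule ℂ (∀ k, Λ.Λ k ⟶ Ω.Λ k) where
  carrier := {η | (∀ k, loop Λ Ω k (η (k + 1)) = η k) ∧ ∃ c : ℝ, ∀ k x, ‖(η k).app x‖ ≤ c}
  add_mem' := by
    rintro η η' ⟨h1, c, hc⟩ ⟨h2, c', hc'⟩
    refine ⟨fun k => ?_, c + c', fun k x => ?_⟩
    · rw [Pi.add_apply, Pi.add_apply, map_add, h1, h2]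
    · exact (norm_add_le _ _).trans (add_le_add (hc k x) (hc' k x))
  zero_mem' := ⟨fun k => by simp, 0, fun k x => by simp⟩
  smul_mem' := by
    rintro a η ⟨h1, c, hc⟩
    refine ⟨fun k => ?_, ‖a‖ * c, fun k x => ?_⟩
    · rw [Pi.smul_apply, Pi.smul_apply, map_smul, h1]
    · exact (norm_smul_le a ((η k).app x)).trans (by gcongr; exact hc k x)

variable {Λ Ω}

/-- The bounded operator `Φ_γ : H ⟶ G` for `γ = η_(Γ_k ⋯ Γ_1 m₀)`, where `η ∈ NT(Λ_k, Ω_k)`. -/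
noncomputable def Φ (k : ℕ) (η : Λ.Λ k ⟶ Ω.Λ k) : Λ.H →L[ℂ] Ω.H :=
  Tower.leftOp (Q := Λ.tower) (R := Ω.tower) k (η.app (Γ.X k))

end OneCell

end UC

/-! The argument runs level by level. Because the functors are bi-faithful, the objects `X k` of a
0-cell contain every simple object. Hence `Hom(Δ.X k, Q.obj k)`, with its trace inner product, is a
finite-dimensional Hilbert space on which the maps commuting with the right action of B_k are
compositions with morphisms γ, and the norm of γ is bounded by the Hilbert space operator norm. For
the same reason a γ that commutes with A_k is the component at `Γ.X k` of exactly one natural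
transformation Λ_k → Ω_k.

From intertwiners to sequences: compress an intertwiner T to level k. The compression is a natural
transformation η^(k) of norm at most ‖T‖. Compressing to level k+1 and then to level k is the same
as compressing to level k at once. By the tracial condition the second of these compressions is the
conditional expectation of `Hom(Q (k+1), R (k+1))` onto `Hom(Q k, R k)`, that is, the loop operator.
So the η^(k) form a bounded quasi-flat sequence, and they converge strongly to T because the
projections onto the levels increase to 1.

From sequences to intertwiners: on a vector of a fixed level a bounded quasi-flat sequence is a
bounded martingale, which converges by Pythagoras. The limit commutes with A_k and B_k since
Φ_{η^(n)} does for n ≥ k. Its compressions are the η^(k) again, which gives injectivity. The lemmas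
are `exists_compression`, `inner_expect` and `exists_limit_of_expect`.

The bimodule structure: for ξ at some level, the orbit map R_ξ : α ↦ Λα ∘ ξ is bounded from L²(A_∞)
to H, by the upper bound in the comparison of the weights. Every a in A is the strong limit of a
bounded sequence in A_∞, so π(a)ξ = R_ξ(aΩ), with Ω the trace vector, defines a bounded operator.
The operator |R_ξ| commutes with A, and this turns the matrix coefficients of π into sums of vector
functionals (`exists_normal_extension`). The right action arises in the same way from the
conjugation J of L²(B_∞). Uniqueness, commutation of the two actions and the passage from A_∞ to A
all come from one fact: normal functionals are continuous along bounded strongly convergent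
sequences (`IsNormalAction.intertwine`). -/

namespace UC

open CStarCategory FinSemisimple

/-! ### Hilbert space tools: strong limits, martingales, normal extension of representations -/

section hilbert

variable {H : Type*} [NormedAddCommGroup H] [InnerProductSpace ℂ H] [CompleteSpace H]
  {G : Type*} [NormedAddCommGroup G] [InnerProductSpace ℂ G] [CompleteSpace G]
  {K : Type*} [NormedAddCommGroup K] [InnerProductSpace ℂ K] [CompleteSpace K]

/-- A bounded sequence of operators which converges on a dense set converges strongly. -/
theorem exists_strong_limit {D : Type*} {ι : D → H} (hι : DenseRange ι) {T : ℕ → H →L[ℂ] G}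
    {C : ℝ} (hC : ∀ k, ‖T k‖ ≤ C) (hT : ∀ d, CauchySeq fun k => T k (ι d)) :
    ∃ S : H →L[ℂ] G, ∀ x, Tendsto (fun k => T k x) atTop (𝓝 (S x)) := by
  have hC0 : 0 ≤ C := (norm_nonneg _).trans (hC 0)
  have key : ∀ x, CauchySeq fun k => T k x := by
    intro x
    rw [Metric.cauchySeq_iff]
    intro ε hε
    -- `C + 1` replaces `C` so that the radius makes sense when `C = 0`.
    obtain ⟨d, hd⟩ := hι.exists_dist_lt x (show 0 < ε / (3 * (C + 1)) by positivity)
    obtain ⟨N, hN⟩ := Metric.cauchySeq_iff.1 (hT d) (ε / 3) (by positivity)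
    refine ⟨N, fun m hm n hn => ?_⟩
    have h1 : ∀ k, dist (T k x) (T k (ι d)) < ε / 3 := by
      intro k
      rw [dist_eq_norm, ← map_sub]
      rw [dist_eq_norm] at hd
      calc _ ≤ ‖T k‖ * ‖x - ι d‖ := (T k).le_opNorm _
        _ ≤ C * ‖x - ι d‖ := by gcongr; exact hC k
        _ ≤ (C + 1) * ‖x - ι d‖ := by gcongr; linarith
        _ < (C + 1) * (ε / (3 * (C + 1))) := by gcongr
        _ = ε / 3 := by field_simp
    have h2 := hN m hm n hn
    have h3 := h1 n
    rw [dist_comm] at h3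
    calc _ ≤ dist (T m x) (T m (ι d)) + dist (T m (ι d)) (T n (ι d)) + dist (T n (ι d)) (T n x) :=
          dist_triangle4 _ _ _ _
      _ < ε := by linarith [h1 m]
  choose f hf using fun x => cauchySeq_tendsto_of_complete (key x)
  exact ⟨continuousLinearMapOfTendsto T (tendsto_pi_nhds.2 hf), hf⟩

/-- `exists_strong_limit` supplies some bounded limit operator; it agrees with `S` on a dense set,
hence everywhere. -/
theorem strong_limit_of_dense {D : Type*} {ι : D → H} (hι : DenseRange ι) {T : ℕ → H →L[ℂ] G}
    {S : H →L[ℂ] G} {C : ℝ} (hC : ∀ k, ‖T k‖ ≤ C)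
    (hT : ∀ d, Tendsto (fun k => T k (ι d)) atTop (𝓝 (S (ι d)))) (x : H) :
    Tendsto (fun k => T k x) atTop (𝓝 (S x)) := by
  obtain ⟨S', hS'⟩ := exists_strong_limit hι hC fun d => (hT d).cauchySeq
  have h : S' = S := by
    have := hι.equalizer S'.continuous S.continuous
      (funext fun d => tendsto_nhds_unique (hS' (ι d)) (hT d))
    exact DFunLike.coe_injective this
  exact h ▸ hS' x

/-- A bounded martingale in a Hilbert space converges. -/
theorem cauchySeq_of_orthogonal_increments {x : ℕ → H} {C : ℝ} {N : ℕ}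
    (hC : ∀ k ≥ N, ‖x k‖ ≤ C)
    (hx : ∀ k n, N ≤ k → k ≤ n → inner ℂ (x k) (x n) = inner ℂ (x k) (x k)) : CauchySeq x := by
  -- The increment is orthogonal to `x k`, so the squared norms increase; being bounded they
  -- converge, and their differences control the increments.
  have pyth : ∀ k n, N ≤ k → k ≤ n → ‖x n - x k‖ ^ 2 = ‖x n‖ ^ 2 - ‖x k‖ ^ 2 := by
    intro k n hk hn
    have h1 := @norm_sub_sq ℂ H _ _ _ (x n) (x k)
    have h2 : RCLike.re (inner ℂ (x n) (x k) : ℂ) = ‖x k‖ ^ 2 := by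
      rw [inner_re_symm, hx k n hk hn, inner_self_eq_norm_sq]
    rw [h1, h2]
    ring
  have mono : Monotone fun k => ‖x (N + k)‖ ^ 2 := by
    intro k n hkn
    have h1 := pyth (N + k) (N + n) (by omega) (by omega)
    have h2 : 0 ≤ ‖x (N + n) - x (N + k)‖ ^ 2 := sq_nonneg _
    dsimp only
    linarith
  have bdd : BddAbove (Set.range fun k => ‖x (N + k)‖ ^ 2) := by
    refine ⟨C ^ 2, ?_⟩
    rintro _ ⟨k, rfl⟩
    have := hC (N + k) (by omega)
    dsimp only
    gcongr
  have conv := (tendsto_atTop_ciSup mono bdd).cauchySeq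
  have h : CauchySeq fun k => x (N + k) := by
    rw [Metric.cauchySeq_iff'] at conv ⊢
    intro ε hε
    obtain ⟨M, hM⟩ := conv (ε ^ 2) (by positivity)
    refine ⟨M, fun n hn => ?_⟩
    have h1 := hM n hn
    rw [Real.dist_eq] at h1
    have h2 := pyth (N + M) (N + n) (by omega) (by omega)
    rw [dist_eq_norm]
    refine lt_of_pow_lt_pow_left₀ 2 hε.le ?_
    rw [h2]
    exact (le_abs_self _).trans_lt h1
  have h2 := (cauchySeq_shift (u := x) N).1 (by simpa only [add_comm] using h)
  exact h2

/-- Used to split a matrix coefficient at an arbitrary vector into countably many coefficients at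
vectors of the dense subspace, with norm control. -/
theorem exists_summable_of_denseRange {D : Type*} [AddCommGroup D] {ι : D →+ H} (hι : DenseRange ι)
    (x : H) : ∃ d : ℕ → D, (Summable fun n => ‖ι (d n)‖) ∧ HasSum (fun n => ι (d n)) x := by
  have hx : x ∈ closure (ι.range : Set H) := by
    rw [AddMonoidHom.coe_range]
    exact hι x
  have hpos : ∀ n : ℕ, 0 < (1 / 2 : ℝ) ^ n := fun n => by positivity
  obtain ⟨v, h1, hv, -, h2⟩ := controlled_sum_of_mem_closure hx hpos
  choose d hd using hv
  obtain rfl : (fun n => ι (d n)) = v := funext hd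
  -- The geometric control starts only at index 1: the first term approximates `x` itself and can be
  -- large.
  have h0 : ∀ n, ‖ι (d (n + 1))‖ ≤ (1 / 2 : ℝ) ^ (n + 1) := fun n => (h2 (n + 1) n.succ_pos).le
  have hg : Summable fun n : ℕ => (1 / 2 : ℝ) ^ (n + 1) :=
    (summable_nat_add_iff (f := fun n : ℕ => (1 / 2 : ℝ) ^ n) 1).2 summable_geometric_two
  have h3 : Summable fun n => ‖ι (d n)‖ :=
    (summable_nat_add_iff (f := fun n => ‖ι (d n)‖) 1).1
      (Summable.of_nonneg_of_le (fun n => norm_nonneg (ι (d (n + 1)))) h0 hg)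
  have h4 : HasSum (fun n => ι (d n)) (∑' n, ι (d n)) := h3.of_norm.hasSum
  have h5 : Tendsto (fun n => ∑ i ∈ Finset.range (n + 1), ι (d i)) atTop (𝓝 (∑' n, ι (d n))) :=
    (tendsto_add_atTop_iff_nat (f := fun n => ∑ i ∈ Finset.range n, ι (d i)) 1).2 h4.tendsto_sum_nat
  refine ⟨d, h3, ?_⟩
  rw [tendsto_nhds_unique h1 h5]
  exact h4

/-- A functional dominated by `η ↦ ‖h η‖` factors through `h`. -/
theorem exists_inner_factor (R : K →L[ℂ] H) (h : K →L[ℂ] K) (hR : ∀ η, ‖R η‖ = ‖h η‖) (ζ : H) :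
    ∃ y : K, ‖y‖ ≤ ‖ζ‖ ∧ ∀ η, inner ℂ ζ (R η) = inner ℂ y (h η) := by
  have hker : h.toLinearMap.ker ≤ (innerSL ℂ ζ ∘L R).toLinearMap.ker := by
    intro η hη
    have h1 : h η = 0 := hη
    have h2 := hR η
    rw [h1, norm_zero, norm_eq_zero] at h2
    change inner ℂ ζ (R η) = 0
    rw [h2, inner_zero_right]
  obtain ⟨g, hg⟩ : ∃ g : h.toLinearMap.range →ₗ[ℂ] ℂ, ∀ η,
      g (h.toLinearMap.rangeRestrict η) = inner ℂ ζ (R η) := by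
    refine ⟨(h.toLinearMap.ker.liftQ (innerSL ℂ ζ ∘L R).toLinearMap hker) ∘ₗ
      h.toLinearMap.quotKerEquivRange.symm.toLinearMap, fun η => ?_⟩
    have : h.toLinearMap.rangeRestrict η = h.toLinearMap.quotKerEquivRange (Submodule.Quotient.mk η) := by
      ext
      simp
    rw [this]
    simp
  let g' : h.toLinearMap.range →L[ℂ] ℂ := g.mkContinuous ‖ζ‖ (by
    rintro ⟨_, η, rfl⟩
    have := hg η
    have e : (⟨h.toLinearMap η, ⟨η, rfl⟩⟩ : h.toLinearMap.range) = h.toLinearMap.rangeRestrict η := rfl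
    rw [e, hg]
    refine (norm_inner_le_norm _ _).trans ?_
    rw [hR]
    rfl)
  -- The functional `h η ↦ ⟨ζ, R η⟩` is bounded by `‖ζ‖` on the range of `h`. Hahn–Banach and Riesz
  -- give `y`, which plays the role of `u† ζ` for the partial isometry in the polar decomposition `R
  -- = u h`.
  obtain ⟨f, hf, hfn⟩ := exists_extension_norm_eq _ g'
  refine ⟨(InnerProductSpace.toDual ℂ K).symm f, ?_, fun η => ?_⟩
  · rw [LinearIsometryEquiv.norm_map, hfn]
    exact g.mkContinuous_norm_le (norm_nonneg _) _
  · rw [InnerProductSpace.toDual_symm_apply]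
    have := hf (h.toLinearMap.rangeRestrict η)
    rw [← hg η]
    exact this.symm

/-- On the operators `s` commuting with `R†R`, the functional `s ↦ ⟨ζ, R s Ω⟩` is a vector functional
with norm control. -/
theorem exists_vector_functional (R : K →L[ℂ] H) (Ω : K) (ζ : H) :
    ∃ x y : K, ‖x‖ = ‖R Ω‖ ∧ ‖y‖ ≤ ‖ζ‖ ∧ ∀ s : K →L[ℂ] K,
      Commute (ContinuousLinearMap.adjoint R ∘L R) s → inner ℂ ζ (R (s Ω)) = inner ℂ y (s x) := by
  have hpos : 0 ≤ ContinuousLinearMap.adjoint R ∘L R := by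
    rw [ContinuousLinearMap.nonneg_iff_isPositive]
    exact ContinuousLinearMap.isPositive_adjoint_comp_self R
  -- With `h = |R|`, which commutes with `s`, one gets `⟨ζ, R s Ω⟩ = ⟨y, h s Ω⟩ = ⟨y, s (h Ω)⟩`.
  -- Moving `h` onto `Ω` bounds `x` by `‖R Ω‖` alone; the operator norm of `R`, which is not
  -- controlled along a dense set, never appears.
  set h : K →L[ℂ] K := CFC.sqrt (ContinuousLinearMap.adjoint R ∘L R) with hh
  have hsq : h * h = ContinuousLinearMap.adjoint R ∘L R := CFC.sqrt_mul_sqrt_self _ hpos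
  have hsa : IsSelfAdjoint h := IsSelfAdjoint.of_nonneg (CFC.sqrt_nonneg _)
  have hR : ∀ η, ‖R η‖ = ‖h η‖ := by
    intro η
    have h1 : (inner ℂ (R η) (R η) : ℂ) = inner ℂ (h η) (h η) := by
      rw [← ContinuousLinearMap.adjoint_inner_right, ← ContinuousLinearMap.comp_apply, ← hsq,
        mul_apply_eq_comp, ← ContinuousLinearMap.adjoint_inner_right h]
      have : ContinuousLinearMap.adjoint h = h := hsa
      rw [this]
    rw [inner_self_eq_norm_sq_to_K, inner_self_eq_norm_sq_to_K] at h1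
    have h2 : ‖R η‖ ^ 2 = ‖h η‖ ^ 2 := by exact_mod_cast h1
    exact (pow_left_inj₀ (norm_nonneg _) (norm_nonneg _) two_ne_zero).1 h2
  obtain ⟨y, hy, hy'⟩ := exists_inner_factor R h hR ζ
  refine ⟨h Ω, y, (hR Ω).symm, hy, fun s hs => ?_⟩
  rw [hy']
  have : Commute h s := hs.cfcₙ_nnreal _
  exact congrArg (inner ℂ y) (DFunLike.congr_fun this.eq Ω)

/-- Extension of a representation: let `θ` be a representation of `P` on `K` with a vector `Ω`, and
let `R d : K → H` be intertwiners for a partially defined representation `Rel` of `P` on `H`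
such that the vectors `R d Ω = ι d` are dense. If each `p : P` is a bounded strong limit of
elements for which `Rel` is defined, then `Rel` extends to `P` and the matrix coefficients of the
extension are sums of vector functionals of `θ`. -/
theorem exists_normal_extension {P : Type*} [Ring P] [StarRing P] [Algebra ℂ P]
    {D : Type*} [AddCommGroup D] (θ : P →⋆ₐ[ℂ] (K →L[ℂ] K)) (Ω : K) {ι : D →+ H}
    (hι : DenseRange ι) (R : D → K →L[ℂ] H) (hR : ∀ d, R d Ω = ι d)
    (Rel : P → (H →L[ℂ] H) → Prop)
    (h1 : ∀ {s T}, Rel s T → ∀ d x, R d (θ s x) = T (R d x))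
    (h2 : ∀ {s T}, Rel s T → Rel (star s) (ContinuousLinearMap.adjoint T))
    (h3 : ∀ p, ∃ (s : ℕ → P) (T : ℕ → H →L[ℂ] H) (C : ℝ), (∀ k, Rel (s k) (T k)) ∧
      (∀ k, ‖T k‖ ≤ C) ∧ ∀ x, Tendsto (fun k => θ (s k) x) atTop (𝓝 (θ p x))) :
    ∃ π : P →⋆ₐ[ℂ] (H →L[ℂ] H), (∀ s T, Rel s T → π s = T) ∧
      ∀ ξ ζ, ∃ x y : ℕ → K, Summable (fun n => ‖x n‖ ^ 2) ∧ Summable (fun n => ‖y n‖ ^ 2) ∧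
        ∀ p, inner ℂ ζ (π p ξ) = ∑' n, inner ℂ (y n) (θ p (x n)) := by
  have ext : ∀ {S T : H →L[ℂ] H}, (∀ d, S (ι d) = T (ι d)) → S = T := by
    intro S T h
    exact DFunLike.coe_injective (hι.equalizer S.continuous T.continuous (funext h))
  -- Intertwining forces the value `R d (θ p Ω)` at `ι d`. That this is well defined and bounded
  -- follows because it is the strong limit of the bounded sequence `T k`.
  have ex : ∀ p, ∃ S : H →L[ℂ] H, ∀ d, S (ι d) = R d (θ p Ω) := by
    intro p
    obtain ⟨s, T, C, hs, hC, hp⟩ := h3 p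
    have lim : ∀ d, Tendsto (fun k => T k (ι d)) atTop (𝓝 (R d (θ p Ω))) := by
      intro d
      have h := ((R d).continuous.tendsto _).comp (hp Ω)
      refine h.congr fun k => ?_
      rw [Function.comp, h1 (hs k), hR]
    obtain ⟨S, hS⟩ := exists_strong_limit hι hC fun d => (lim d).cauchySeq
    exact ⟨S, fun d => tendsto_nhds_unique (hS _) (lim d)⟩
  choose π hπ using ex
  have approx : ∀ p, ∃ (s : ℕ → P) (T : ℕ → H →L[ℂ] H) (C : ℝ), (∀ k, Rel (s k) (T k)) ∧
      (∀ k, ‖T k‖ ≤ C) ∧ (∀ x, Tendsto (fun k => θ (s k) x) atTop (𝓝 (θ p x))) ∧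
      ∀ x, Tendsto (fun k => T k x) atTop (𝓝 (π p x)) := by
    intro p
    obtain ⟨s, T, C, hs, hC, hp⟩ := h3 p
    refine ⟨s, T, C, hs, hC, hp, strong_limit_of_dense hι hC fun d => ?_⟩
    rw [hπ]
    have h := ((R d).continuous.tendsto _).comp (hp Ω)
    refine h.congr fun k => ?_
    rw [Function.comp, h1 (hs k), hR]
  have mul : ∀ p q, π (p * q) = π p * π q := by
    intro p q
    refine ext fun d => ?_
    obtain ⟨s, T, C, hs, hC, hp, hT⟩ := approx p
    rw [hπ, mul_apply_eq_comp, hπ q d, map_mul, mul_apply_eq_comp]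
    refine tendsto_nhds_unique ?_ (hT _)
    have h := ((R d).continuous.tendsto _).comp (hp (θ q Ω))
    refine h.congr fun k => ?_
    rw [Function.comp, h1 (hs k)]
  have inter : ∀ p d x, R d (θ p x) = π p (R d x) := by
    intro p d x
    obtain ⟨s, T, C, hs, hC, hp, hT⟩ := approx p
    refine tendsto_nhds_unique ?_ (hT _)
    have h := ((R d).continuous.tendsto _).comp (hp x)
    refine h.congr fun k => ?_
    rw [Function.comp, h1 (hs k)]
  have str : ∀ p, π (star p) = star (π p) := by
    intro p
    refine ext fun d => ?_
    -- Strong convergence does not pass to adjoints, so the adjoints of `T k` are evaluated only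
    -- inside an inner product and moved back to `θ (s k)` acting on `(R d)† z`.
    have h : ∀ z : H, inner ℂ z (π (star p) (ι d)) = inner ℂ (π p z) (ι d) := by
      intro z
      obtain ⟨s, T, C, hs, hC, hp, hT⟩ := approx p
      have l1 : Tendsto (fun k => inner ℂ (T k z) (ι d)) atTop (𝓝 (inner ℂ (π p z) (ι d))) :=
        (hT z).inner tendsto_const_nhds
      have l2 := (hp (ContinuousLinearMap.adjoint (R d) z)).inner
        (tendsto_const_nhds (x := Ω) (f := atTop (α := ℕ)) ) (𝕜 := ℂ)
      have e : inner ℂ (θ p (ContinuousLinearMap.adjoint (R d) z)) Ω =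
          inner ℂ z (π (star p) (ι d)) := by
        rw [hπ, map_star, ContinuousLinearMap.star_eq_adjoint, ← ContinuousLinearMap.adjoint_inner_left,
          ContinuousLinearMap.adjoint_inner_right]
      rw [e] at l2
      refine tendsto_nhds_unique l2 (l1.congr fun k => ?_)
      rw [← ContinuousLinearMap.adjoint_inner_right (T k), ← hR d, ← h1 (h2 (hs k)), map_star,
        ContinuousLinearMap.star_eq_adjoint, ← ContinuousLinearMap.adjoint_inner_left (R d),
        ContinuousLinearMap.adjoint_inner_right]
    refine ext_inner_left ℂ fun z => ?_
    rw [h, ContinuousLinearMap.star_eq_adjoint, ContinuousLinearMap.adjoint_inner_right]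
  let rep : P →⋆ₐ[ℂ] (H →L[ℂ] H) :=
    { toFun := π
      map_one' := ext fun d => by rw [hπ, map_one]; exact hR d
      map_mul' := mul
      map_zero' := ext fun d => by rw [hπ, map_zero]; simp
      map_add' := fun p q => ext fun d => by
        rw [hπ, map_add, add_apply, add_apply, hπ, hπ,
          map_add]
      commutes' := fun c => ext fun d => by
        rw [hπ, AlgHomClass.commutes, Algebra.algebraMap_eq_smul_one, Algebra.algebraMap_eq_smul_one,
          smul_apply, smul_apply, map_smul]
        exact congrArg (c • ·) (hR d)
      map_star' := str }
  refine ⟨rep, fun s T hs => ext fun d => ?_, fun ξ ζ => ?_⟩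
  · change π s (ι d) = _
    rw [hπ, h1 hs, hR]
  · obtain ⟨d, hd, hsum⟩ := exists_summable_of_denseRange hι ξ
    choose x y hx hy hxy using fun n => exists_vector_functional (R (d n)) Ω ζ
    -- `R d` intertwines the actions of both `p` and `star p`; taking adjoints of the second
    -- relation shows that `(R d)† R d` commutes with `θ p`.
    have comm : ∀ d p, Commute (ContinuousLinearMap.adjoint (R d) ∘L R d) (θ p) := by
      intro d p
      have e : R d ∘L θ p = π p ∘L R d := by ext x; exact inter p d x
      have e' : R d ∘L θ (star p) = π (star p) ∘L R d := by ext x; exact inter _ d x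
      have e2 := congrArg ContinuousLinearMap.adjoint e'
      rw [ContinuousLinearMap.adjoint_comp, ContinuousLinearMap.adjoint_comp, map_star, str,
        ContinuousLinearMap.star_eq_adjoint, ContinuousLinearMap.star_eq_adjoint,
        ContinuousLinearMap.adjoint_adjoint, ContinuousLinearMap.adjoint_adjoint] at e2
      change (ContinuousLinearMap.adjoint (R d) ∘L R d) ∘L θ p =
        θ p ∘L (ContinuousLinearMap.adjoint (R d) ∘L R d)
      rw [ContinuousLinearMap.comp_assoc, e, ← ContinuousLinearMap.comp_assoc, ← e2,
        ContinuousLinearMap.comp_assoc]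
    -- Here `x n` has norm `‖ι (d n)‖`, which is summable, while `y n` is merely bounded. Moving a
    -- factor `c n` from `x n` to `y n` makes both square summable. If `c n = 0` then `x n = 0`, so
    -- the convention `0⁻¹ = 0` is harmless.
    let c : ℕ → ℝ := fun n => √‖ι (d n)‖
    have hc : ∀ n, c n * c n = ‖ι (d n)‖ := fun n => Real.mul_self_sqrt (norm_nonneg _)
    have hc0 : ∀ n, 0 ≤ c n := fun n => Real.sqrt_nonneg _
    refine ⟨fun n => ((c n)⁻¹ : ℂ) • x n, fun n => (c n : ℂ) • y n, ?_, ?_, fun p => ?_⟩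
    · refine Summable.of_nonneg_of_le (fun n => by positivity) (fun n => ?_) hd
      rw [norm_smul, hx, hR, norm_inv, Complex.norm_real, Real.norm_of_nonneg (hc0 n), ← hc, mul_pow]
      rcases eq_or_ne (c n) 0 with h | h
      · simp [h]
      · field_simp
        rfl
    · refine Summable.of_nonneg_of_le (fun n => by positivity) (fun n => ?_) (hd.mul_right (‖ζ‖ ^ 2))
      rw [norm_smul, Complex.norm_real, Real.norm_of_nonneg (hc0 n), mul_pow, sq (c n), hc]
      gcongr
      exact hy n
    · have h := (hsum.mapL (innerSL ℂ ζ ∘L π p)).tsum_eq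
      refine h.symm.trans (tsum_congr fun n => ?_)
      change inner ℂ ζ (π p (ι (d n))) = _
      rw [hπ, hxy n _ (comm _ _), map_smul, inner_smul_left, inner_smul_right, Complex.conj_ofReal]
      rcases eq_or_ne (c n) 0 with h | h
      · have h' := hc n
        rw [h, mul_zero] at h'
        have hx0 : x n = 0 := norm_eq_zero.1 (by rw [hx, hR, ← h'])
        simp [hx0]
      · rw [← mul_assoc, mul_inv_cancel₀ (Complex.ofReal_ne_zero.2 h), one_mul]

end hilbert

/-! ### Norms, traces and full objects in a finite semisimple C⋆-category -/

section semisimple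

variable {C : Type u} [Category.{v} C] [CStarCategory C] [FinSemisimple C]

theorem norm_isometry {v : Vert C} {x : C} {s : simple v ⟶ x} (hs : s ≫ dag s = 𝟙 (simple v)) :
    ‖s‖ = 1 := by
  have h := norm_comp_dag s
  rw [hs, norm_id_simple] at h
  nlinarith [norm_nonneg s]

theorem norm_onb (x : C) (v : Vert C) (i : Fin (mult x v)) : ‖onb x v i‖ = 1 :=
  norm_isometry (by rw [onb_orth, if_pos rfl])

/-- The norm of a morphism is determined by its composites with morphisms from simple objects. -/
theorem norm_le_of_simple {y z : C} (g : y ⟶ z) {c : ℝ} (hc : 0 ≤ c)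
    (h : ∀ v (f : simple v ⟶ y), ‖f ≫ g‖ ≤ c * ‖f‖) : ‖g‖ ≤ c := by
  let _ := endCStar y
  -- The same bound holds for `dag g`, by the C⋆-identity applied to `f ≫ dag g`; together the two
  -- bounds can be iterated along powers of `g ≫ dag g`.
  have h1 : ∀ v (f : simple v ⟶ z), ‖f ≫ dag g‖ ≤ c * ‖f‖ := by
    intro v f
    have e : ‖f ≫ dag g‖ * ‖f ≫ dag g‖ = ‖((f ≫ dag g) ≫ g) ≫ dag f‖ := by
      rw [← norm_comp_dag, dag_comp, dag_dag]
      simp only [Category.assoc]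
    have e2 : ‖((f ≫ dag g) ≫ g) ≫ dag f‖ ≤ (c * ‖f ≫ dag g‖) * ‖f‖ := by
      refine (norm_comp_le _ _).trans ?_
      rw [norm_dag]
      gcongr
      exact h v _
    rcases (norm_nonneg (f ≫ dag g)).eq_or_lt with h0 | h0
    · rw [← h0]; positivity
    · refine le_of_mul_le_mul_left ?_ h0
      rw [e]
      linarith
  let p : End y := g ≫ dag g
  have hp : IsSelfAdjoint p := by
    change dag (g ≫ dag g) = g ≫ dag g
    rw [dag_comp, dag_dag]
  have h2 : ∀ (n : ℕ) v (f : simple v ⟶ y), ‖f ≫ (p ^ n : End y)‖ ≤ (c ^ 2) ^ n * ‖f‖ := by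
    intro n
    induction n with
    | zero =>
      intro v f
      rw [pow_zero, pow_zero, one_mul]
      exact (congrArg norm (Category.comp_id f)).le
    | succ n ih =>
      intro v f
      have e : f ≫ (p ^ (n + 1) : End y) = ((f ≫ g) ≫ dag g) ≫ (p ^ n : End y) := by
        rw [pow_succ]
        change f ≫ ((g ≫ dag g) ≫ (p ^ n : End y)) = _
        simp only [Category.assoc]
      rw [e]
      calc _ ≤ (c ^ 2) ^ n * ‖(f ≫ g) ≫ dag g‖ := ih v _
        _ ≤ (c ^ 2) ^ n * (c * (c * ‖f‖)) := by
          gcongr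
          exact (h1 v _).trans (by gcongr; exact h v f)
        _ = (c ^ 2) ^ (n + 1) * ‖f‖ := by ring
  -- Summing over an orthonormal basis costs a factor, the total multiplicity of `y`, but this
  -- factor does not depend on `n`.
  have h3 : ∀ n : ℕ, ‖p ^ n‖ ≤ (∑ v, (mult y v : ℝ)) * (c ^ 2) ^ n := by
    intro n
    have e := comp_onb_sum (p ^ n : End y)
    calc ‖p ^ n‖ = ‖∑ v, ∑ i, dag (onb y v i) ≫ onb y v i ≫ (p ^ n : End y)‖ := by rw [e]
      _ ≤ ∑ v, ∑ i : Fin (mult y v), (c ^ 2) ^ n := by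
        refine (norm_sum_le _ _).trans (Finset.sum_le_sum fun v _ => ?_)
        refine (norm_sum_le _ _).trans (Finset.sum_le_sum fun i _ => ?_)
        have := h2 n v (onb y v i)
        rw [norm_onb, mul_one] at this
        refine (norm_comp_le _ _).trans ?_
        rw [norm_dag, norm_onb, one_mul]
        exact this
      _ = _ := by
        simp only [Finset.sum_const, Finset.card_univ, Fintype.card_fin, nsmul_eq_mul]
        rw [Finset.sum_mul]
  -- For selfadjoint `p` the norm is multiplicative on the powers `2 ^ j`, so the constant in `h3`
  -- is negligible as `j` grows and `‖p‖ ≤ c ^ 2` remains.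
  have h4 : ∀ j : ℕ, ‖p‖ ^ 2 ^ j ≤ (∑ v, (mult y v : ℝ)) * (c ^ 2) ^ 2 ^ j := by
    intro j
    have e := hp.nnnorm_pow_two_pow j
    have e' : ‖p ^ 2 ^ j‖ = ‖p‖ ^ 2 ^ j :=
      (congrArg NNReal.toReal e).trans (NNReal.coe_pow _ _)
    rw [← e']
    exact h3 _
  have h5 : ‖p‖ ≤ c ^ 2 := by
    by_contra hlt
    push Not at hlt
    have hp0 : 0 < ‖p‖ := lt_of_le_of_lt (by positivity) hlt
    rcases hc.eq_or_lt with h0 | h0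
    · have := h4 0
      rw [← h0] at this
      norm_num at this
      rw [this] at hp0
      simp at hp0
    · have hr : 1 < ‖p‖ / c ^ 2 := by rwa [one_lt_div (by positivity)]
      obtain ⟨n, hn⟩ := pow_unbounded_of_one_lt (∑ v, (mult y v : ℝ)) hr
      have h6 := h4 n
      have h7 : (‖p‖ / c ^ 2) ^ n ≤ (‖p‖ / c ^ 2) ^ 2 ^ n :=
        pow_le_pow_right₀ hr.le n.lt_two_pow_self.le
      rw [div_pow _ _ (2 ^ n)] at h7
      have h8 := hn.trans_le h7
      rw [lt_div_iff₀ (by positivity)] at h8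
      linarith
  have h6 : ‖g‖ * ‖g‖ ≤ c ^ 2 := by
    rw [← norm_comp_dag]
    exact h5
  nlinarith [norm_nonneg g]

theorem eq_zero_of_onb {x y : C} {f : x ⟶ y} (h : ∀ v i, onb x v i ≫ f = 0) : f = 0 := by
  rw [← comp_onb_sum f]
  exact Finset.sum_eq_zero fun v _ => Finset.sum_eq_zero fun i _ => by rw [h, Limits.comp_zero]

theorem eq_zero_of_Tr {μ : Vert C → ℝ} (hμ : ∀ v, 0 < μ v) {x y : C} {f : x ⟶ y}
    (h : Tr μ x (f ≫ dag f) = 0) : f = 0 := by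
  refine eq_zero_of_onb fun v i => ?_
  rw [Tr_comp_dag] at h
  have h1 := Complex.ofReal_eq_zero.1 h
  have hnn : ∀ w j, 0 ≤ μ w * ‖onb x w j ≫ f‖ ^ 2 := fun w j =>
    mul_nonneg (hμ w).le (sq_nonneg _)
  rw [Finset.sum_eq_zero_iff_of_nonneg fun w _ => Finset.sum_nonneg fun j _ => hnn w j] at h1
  have h2 := h1 v (Finset.mem_univ v)
  rw [Finset.sum_eq_zero_iff_of_nonneg fun j _ => hnn v j] at h2
  have h3 := h2 i (Finset.mem_univ i)
  rcases mul_eq_zero.1 h3 with h4 | h4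
  · exact absurd h4 (hμ v).ne'
  · exact norm_eq_zero.1 (pow_eq_zero_iff two_ne_zero |>.1 h4)

/-- The matrix coefficients with respect to orthonormal bases of `x` and `y` determine a morphism.
Finite dimension provides the orthogonal projections onto the levels of a tower. -/
instance finite_hom (x y : C) : Module.Finite ℂ (x ⟶ y) := by
  let L : (x ⟶ y) →ₗ[ℂ] ((Σ v : Vert C, Fin (mult x v) × Fin (mult y v)) → ℂ) :=
    { toFun := fun f p => scal (onb x p.1 p.2.1 ≫ f ≫ dag (onb y p.1 p.2.2))
      map_add' := fun f g => by
        ext p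
        simp [scal_add]
      map_smul' := fun c f => by
        ext p
        simp [scal_smul] }
  refine Module.Finite.of_injective L ((injective_iff_map_eq_zero L).2 fun f hf => ?_)
  refine eq_zero_of_onb fun v i => ?_
  rw [← expand_simple (onb x v i ≫ f)]
  refine Finset.sum_eq_zero fun j _ => ?_
  have := congrFun hf ⟨v, i, j⟩
  have e : scal (onb x v i ≫ f ≫ dag (onb y v j)) = 0 := this
  rw [Category.assoc, e, zero_smul]

/-- An object is full if it contains every simple object. -/
def IsFull (x : C) : Prop := ∀ v : Vert C, ∃ s : simple v ⟶ x, s ≫ dag s = 𝟙 (simple v)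

/-- If `ONB(v, x)` were empty, the expansion of `f` in it would be an empty sum. -/
theorem exists_isometry_of_ne_zero {v : Vert C} {x : C} {f : simple v ⟶ x} (hf : f ≠ 0) :
    ∃ s : simple v ⟶ x, s ≫ dag s = 𝟙 (simple v) := by
  by_contra h
  push Not at h
  refine hf ?_
  rw [← expand_simple f]
  exact Finset.sum_eq_zero fun i _ => absurd (by rw [onb_orth, if_pos rfl]) (h (onb x v i))

/-- A full object generates every object. -/
theorem IsFull.exists_frame {x : C} (hx : IsFull x) (y : C) :
    ∃ a : (Σ v : Vert C, Fin (mult y v)) → (x ⟶ y), ∑ i, dag (a i) ≫ a i = 𝟙 y := by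
  choose s hs using hx
  refine ⟨fun i => dag (s i.1) ≫ onb y i.1 i.2, ?_⟩
  rw [Fintype.sum_sigma, ← onb_sum y]
  refine Finset.sum_congr rfl fun v _ => Finset.sum_congr rfl fun i _ => ?_
  rw [dag_comp, dag_dag, Category.assoc, ← Category.assoc (s v), hs, Category.id_comp]

/-- Composition with `g` is bounded on the Hilbert space `Hom(x, y)` by the norm of `g` if `x` is
full. -/
theorem IsFull.norm_le_of_Tr {x : C} (hx : IsFull x) {μ : Vert C → ℝ} (hμ : ∀ v, 0 < μ v) {y z : C}
    (g : y ⟶ z) {c : ℝ} (hc : 0 ≤ c)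
    (h : ∀ f : x ⟶ y, (Tr μ x ((f ≫ g) ≫ dag (f ≫ g))).re ≤ c ^ 2 * (Tr μ x (f ≫ dag f)).re) :
    ‖g‖ ≤ c := by
  refine norm_le_of_simple g hc fun v f => ?_
  obtain ⟨s, hs⟩ := hx v
  -- The test vectors are supported on one copy of `v` inside `x`: their trace norm is the norm of
  -- `f` up to the factor `μ v`, which cancels on the two sides.
  have key : ∀ {z : C} (f : simple v ⟶ z),
      (Tr μ x ((dag s ≫ f) ≫ dag (dag s ≫ f))).re = μ v * ‖f‖ ^ 2 := by
    intro z f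
    have e : (dag s ≫ f) ≫ dag (dag s ≫ f) = dag s ≫ (f ≫ dag f) ≫ s := by
      rw [dag_comp, dag_dag]
      simp only [Category.assoc]
    have e2 : ((f ≫ dag f) ≫ s) ≫ dag s = f ≫ dag f := by
      rw [Category.assoc, hs, Category.comp_id]
    rw [e, Tr_comm, e2, Tr_simple, scal_comp_dag, ← Complex.ofReal_mul, Complex.ofReal_re]
  have h1 := h (dag s ≫ f)
  have e3 : (dag s ≫ f) ≫ g = dag s ≫ f ≫ g := Category.assoc _ _ _
  rw [e3, key, key] at h1
  have h2 : ‖f ≫ g‖ ^ 2 ≤ (c * ‖f‖) ^ 2 := by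
    have := hμ v
    refine le_of_mul_le_mul_left ?_ this
    linarith
  exact abs_le_of_sq_le_sq' h2 (by positivity) |>.2

end semisimple

/-! ### Natural transformations seen at a full object -/

section nat

variable {C : Type u₁} [Category.{v₁} C] [CStarCategory C] [FinSemisimple C]
  {D : Type u₂} [Category.{v₂} D] [CStarCategory D]

/-- Naturality at the isometry `s` exhibits the component at `v` as a corner of the component at
`x`. This is how data at one full object control all components. -/
theorem IsFull.app_simple {x : C} {G K : C ⥤ D} (η : G ⟶ K) {v : Vert C} {s : simple v ⟶ x}
    (hs : s ≫ dag s = 𝟙 (simple v)) :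
    η.app (simple v) = G.map s ≫ η.app x ≫ K.map (dag s) := by
  rw [← η.naturality, ← Category.assoc, ← G.map_comp, hs, G.map_id, Category.id_comp]

theorem IsFull.nat_ext {x : C} (hx : IsFull x) {G K : C ⥤ D} (hG : IsStarLinear G) {η η' : G ⟶ K}
    (h : η.app x = η'.app x) : η = η' := by
  ext y
  refine nat_ext_simple hG (fun v => ?_) y
  obtain ⟨s, hs⟩ := hx v
  rw [IsFull.app_simple η hs, IsFull.app_simple η' hs, h]

/-- The corners of `γ` at the simple summands of `x` define a natural transformation; commutation
with `End x` is what makes its component at `x` equal to `γ`. -/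
theorem IsFull.exists_nat {x : C} (hx : IsFull x) {G K : C ⥤ D} (hG : IsStarLinear G)
    (hK : IsStarLinear K) (γ : G.obj x ⟶ K.obj x)
    (h : ∀ α : x ⟶ x, G.map α ≫ γ = γ ≫ K.map α) : ∃ η : G ⟶ K, η.app x = γ := by
  choose s hs using hx
  refine ⟨natOfSimple hG hK fun v => G.map (s v) ≫ γ ≫ K.map (dag (s v)), ?_⟩
  have e : ∀ v i, G.map (dag (onb x v i)) ≫ (G.map (s v) ≫ γ ≫ K.map (dag (s v))) ≫
      K.map (onb x v i) = γ ≫ K.map (dag (onb x v i) ≫ onb x v i) := by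
    intro v i
    -- This endomorphism of `x` is a matrix unit from the `i`-th copy of `v` to the chosen one, and
    -- it carries the corner of `γ` at the chosen copy to the `i`-th copy.
    have h1 := h (dag (onb x v i) ≫ s v)
    have h2 : dag (onb x v i) ≫ onb x v i =
        (dag (onb x v i) ≫ s v) ≫ dag (s v) ≫ onb x v i := by
      rw [Category.assoc, ← Category.assoc (s v), hs, Category.id_comp]
    rw [h2, K.map_comp, ← Category.assoc γ, ← h1, G.map_comp, K.map_comp]
    simp only [Category.assoc]
  simp only [natOfSimple, e]
  simp only [← Preadditive.comp_sum, ← hK.map_sum, onb_sum, K.map_id, Category.comp_id]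

/-- The component at `y` is an orthogonal sum of copies of components at simple objects, and each of
those is a corner of the component at `x`. This reduces uniform bounds to a single object at each
level. -/
theorem IsFull.norm_app_le [FinSemisimple D] {x : C} (hx : IsFull x) {G K : C ⥤ D}
    (hG : IsStarLinear G) (hK : IsStarLinear K) (η : G ⟶ K) (y : C) : ‖η.app y‖ ≤ ‖η.app x‖ := by
  have h1 : ∀ v, ‖η.app (simple v)‖ ≤ ‖η.app x‖ := by
    intro v
    obtain ⟨s, hs⟩ := hx v
    rw [IsFull.app_simple η hs]
    have h2 := hG.norm_map_le s
    have h3 := hK.norm_map_le (dag s)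
    rw [norm_isometry hs] at h2
    rw [norm_dag, norm_isometry hs] at h3
    calc _ ≤ ‖G.map s‖ * (‖η.app x‖ * ‖K.map (dag s)‖) :=
          (norm_comp_le _ _).trans (by gcongr; exact norm_comp_le _ _)
      _ ≤ 1 * (‖η.app x‖ * 1) := by gcongr
      _ = _ := by ring
  -- Pythagoras along the decomposition of `y` into simple objects; `η` respects the decomposition,
  -- so it can be estimated summand by summand.
  have key : ∀ {K : C ⥤ D} (hK : IsStarLinear K) {w : Vert D} (f : simple w ⟶ K.obj y),
      ‖f‖ ^ 2 = ∑ v, ∑ i, ‖f ≫ K.map (dag (onb y v i))‖ ^ 2 := by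
    intro K hK w f
    have e : f ≫ dag f = ∑ v, ∑ i, (f ≫ K.map (dag (onb y v i))) ≫
        dag (f ≫ K.map (dag (onb y v i))) := by
      have e1 : ∀ v i, (f ≫ K.map (dag (onb y v i))) ≫ dag (f ≫ K.map (dag (onb y v i))) =
          f ≫ K.map (dag (onb y v i) ≫ onb y v i) ≫ dag f := by
        intro v i
        rw [dag_comp, ← hK.map_dag, dag_dag, K.map_comp]
        simp only [Category.assoc]
      simp only [e1]
      simp only [← Preadditive.comp_sum, ← Preadditive.sum_comp, ← hK.map_sum, onb_sum, K.map_id,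
        Category.id_comp]
    have e2 := congrArg scal e
    simp only [scal_sum, scal_comp_dag] at e2
    exact_mod_cast e2
  refine norm_le_of_simple _ (norm_nonneg _) fun w f => ?_
  have h2 : ‖f ≫ η.app y‖ ^ 2 ≤ (‖η.app x‖ * ‖f‖) ^ 2 := by
    rw [key hK, mul_pow, key hG f, Finset.mul_sum]
    refine Finset.sum_le_sum fun v _ => ?_
    rw [Finset.mul_sum]
    refine Finset.sum_le_sum fun i _ => ?_
    rw [Category.assoc, ← η.naturality, ← Category.assoc, ← mul_pow]
    gcongr
    refine (norm_comp_le _ _).trans ?_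
    rw [mul_comm]
    gcongr
    exact h1 v
  exact abs_le_of_sq_le_sq' h2 (by positivity) |>.2

end nat

/-! ### The conditional expectation attached to a tracial solution -/

section expectation

variable {C : Type u₁} [Category.{v₁} C] [CStarCategory C] [FinSemisimple C]
  {D : Type u₂} [Category.{v₂} D] [CStarCategory D] [FinSemisimple D] {F : C ⥤ D}
  {μ : Vert C → ℝ} {ν : Vert D → ℝ}

/-- The conditional expectation `c ↦ ρ'† ∘ F' c ∘ ρ'` of `Hom(F y, F z)` onto `Hom(y, z)`. -/
noncomputable def TracialSolution.expect (S : TracialSolution F μ ν) {y z : C}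
    (c : F.obj y ⟶ F.obj z) : y ⟶ z :=
  S.ρ'.app y ≫ S.F'.map c ≫ dag (S.ρ'.app z)

variable (S : TracialSolution F μ ν)

/-- Naturality of `ρ'`. With `expect_comp_map` this is the bimodule property of a conditional
expectation. -/
theorem TracialSolution.map_comp_expect {y y' z : C} (β : y ⟶ y') (c : F.obj y' ⟶ F.obj z) :
    β ≫ S.expect c = S.expect (F.map β ≫ c) := by
  have h : β ≫ S.ρ'.app y' = S.ρ'.app y ≫ S.F'.map (F.map β) := S.ρ'.naturality β
  rw [expect, expect, S.F'.map_comp, ← Category.assoc, h]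
  simp only [Category.assoc]

theorem TracialSolution.expect_comp_map (hF : IsStarLinear F) {y z z' : C} (c : F.obj y ⟶ F.obj z)
    (β : z ⟶ z') : S.expect c ≫ β = S.expect (c ≫ F.map β) := by
  have h : S.F'.map (F.map β) ≫ dag (S.ρ'.app z') = dag (S.ρ'.app z) ≫ β :=
    dag_naturality isStarLinear_id (hF.comp S.starLinear) S.ρ' β
  rw [expect, expect, S.F'.map_comp, Category.assoc, Category.assoc, Category.assoc, h]

theorem TracialSolution.expect_sum {y z : C} {ι : Type*} (s : Finset ι)
    (c : ι → (F.obj y ⟶ F.obj z)) : S.expect (∑ i ∈ s, c i) = ∑ i ∈ s, S.expect (c i) := by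
  simp only [expect, S.starLinear.map_sum, Preadditive.comp_sum, Preadditive.sum_comp]

/-- The tracial condition enters here: the ratio `ν w / μ v` turns the `μ`-weighted scalar into the
`ν`-weighted trace. -/
theorem TracialSolution.scal_expect (hμ : ∀ v, 0 < μ v) (v : Vert C)
    (c : F.obj (simple v) ⟶ F.obj (simple v)) :
    (μ v : ℂ) * scal (S.expect c) = Tr ν (F.obj (simple v)) c := by
  have h : S.expect c = ∑ w, ∑ i, (((ν w / μ v : ℝ) : ℂ) * scal (onb (F.obj (simple v)) w i ≫
      c ≫ dag (onb (F.obj (simple v)) w i))) • 𝟙 (simple v) := by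
    conv_lhs => rw [← sum_comp_onb c]
    rw [S.expect_sum]
    refine Finset.sum_congr rfl fun w _ => ?_
    rw [S.expect_sum]
    refine Finset.sum_congr rfl fun i _ => ?_
    -- For `σ` in the basis and `τ = c ∘`-adjoint applied to `σ`, that is `σ ≫ dag c`, the product
    -- `dag τ ≫ σ` is the part of `c` that ends in the summand `σ`.
    have := S.tracial v w (onb (F.obj (simple v)) w i) (onb (F.obj (simple v)) w i ≫ dag c)
    rw [dag_comp, dag_dag] at this
    exact this
  simp only [← Finset.sum_smul] at h
  rw [scal_unique h, Finset.mul_sum]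
  refine Finset.sum_congr rfl fun w _ => ?_
  rw [Finset.mul_sum]
  refine Finset.sum_congr rfl fun i _ => ?_
  rw [← mul_assoc, ← Complex.ofReal_mul, mul_div_cancel₀ _ (hμ v).ne']

/-- Cutting by `ONB(v, y)` and using the bimodule property reduces preservation of the trace to
simple objects. -/
theorem TracialSolution.Tr_expect_self (hF : IsStarLinear F) (hμ : ∀ v, 0 < μ v) {y : C}
    (c : F.obj y ⟶ F.obj y) : Tr μ y (S.expect c) = Tr ν (F.obj y) c := by
  have e : ∀ v i, (μ v : ℂ) * scal (onb y v i ≫ S.expect c ≫ dag (onb y v i)) =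
      Tr ν (F.obj y) (c ≫ F.map (dag (onb y v i) ≫ onb y v i)) := by
    intro v i
    rw [S.expect_comp_map hF, S.map_comp_expect, S.scal_expect hμ, Tr_comm, F.map_comp,
      Category.assoc]
  simp only [Tr, e]
  change ∑ v, ∑ i, Tr ν (F.obj y) (c ≫ F.map (dag (onb y v i) ≫ onb y v i)) = Tr ν (F.obj y) c
  simp only [← Tr_sum, ← Preadditive.comp_sum, ← hF.map_sum, onb_sum, F.map_id, Category.comp_id]

/-- The conditional expectation is adjoint to the functor with respect to the traces. -/
theorem TracialSolution.Tr_expect (hF : IsStarLinear F) (hμ : ∀ v, 0 < μ v) {y z : C}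
    (c : F.obj y ⟶ F.obj z) (β : z ⟶ y) :
    Tr μ y (S.expect c ≫ β) = Tr ν (F.obj y) (c ≫ F.map β) := by
  rw [S.expect_comp_map hF, S.Tr_expect_self hF hμ]

end expectation

/-! ### Fullness of the objects of a 0-cell -/

namespace ZeroCell

/-- The right adjoint `G` is faithful, so the counit at `w` is epi and therefore nonzero.
Decomposing `G w` yields a nonzero morphism from some `F v` to `w`; since `v` sits inside `x`, it
gives a nonzero morphism from `F x` to `w`, whose adjoint witnesses that `w` occurs in `F x`. -/
theorem isFull_map {C : Type u₁} [Category.{v₁} C] [CStarCategory C] [FinSemisimple C]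
    {D : Type u₂} [Category.{v₂} D] [CStarCategory D] [FinSemisimple D] {F : C ⥤ D}
    (hF : IsStarLinear F) (hb : IsBiFaithful F) {x : C} (hx : IsFull x) : IsFull (F.obj x) := by
  intro w
  obtain ⟨-, G, ⟨adj⟩, hG⟩ := hb
  have hepi : Epi (adj.counit.app (simple w)) := inferInstance
  have h1 : adj.counit.app (simple w) ≠ 0 := by
    intro h0
    refine simple_ne_zero w ((cancel_epi (adj.counit.app (simple w))).1 ?_)
    rw [h0, Limits.zero_comp, Limits.zero_comp]
  have h2 : ∃ v i, F.map (onb (G.obj (simple w)) v i) ≫ adj.counit.app (simple w) ≠ 0 := by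
    by_contra h
    push Not at h
    refine h1 ?_
    have e : F.map (𝟙 (G.obj (simple w))) ≫ adj.counit.app (simple w) =
        adj.counit.app (simple w) := by
      rw [F.map_id]
      exact Category.id_comp _
    rw [← e, ← onb_sum, hF.map_sum, Preadditive.sum_comp]
    refine Finset.sum_eq_zero fun v _ => ?_
    rw [hF.map_sum, Preadditive.sum_comp]
    refine Finset.sum_eq_zero fun i _ => ?_
    rw [F.map_comp, Category.assoc, h, Limits.comp_zero]
  obtain ⟨v, i, h3⟩ := h2
  obtain ⟨s, hs⟩ := hx v
  set f := F.map (onb (G.obj (simple w)) v i) ≫ adj.counit.app (simple w)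
  refine exists_isometry_of_ne_zero (f := dag (F.map (dag s) ≫ f)) fun h4 => h3 ?_
  have h5 := congrArg dag h4
  rw [dag_dag, dag_zero] at h5
  have h6 := congrArg (F.map s ≫ ·) h5
  simp only [Limits.comp_zero] at h6
  rw [← Category.assoc, ← F.map_comp, hs, F.map_id] at h6
  rwa [Category.id_comp] at h6

/-- The objects `Γ_k ⋯ Γ_1 m₀` contain all simple objects. -/
theorem isFull_X (Γ : ZeroCell.{v, u}) (k : ℕ) : IsFull (Γ.X k) := by
  induction k with
  | zero =>
    intro v
    obtain ⟨s, h, -⟩ :=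
      (directSum (Vert (Γ.M 0)) (simple : Vert (Γ.M 0) → Γ.M 0)).choose_spec
    exact ⟨s v, h v⟩
  | succ k ih => exact isFull_map (Γ.starLinear k) (Γ.biFaithful k) ih

end ZeroCell

/-! ### The levels of a tower inside its Hilbert space, and the operators on them -/

namespace Tower

variable {Δ : ZeroCell.{v, u}} {Q R : Tower Δ}

/-- The composite inclusion `Hom(Δ_k ⋯ Δ_1 n₀, Q k) ⟶ Hom(Δ_n ⋯ Δ_1 n₀, Q n)` for `k ≤ n`. -/
noncomputable def push (Q : Tower Δ) {k n : ℕ} (h : k ≤ n) (ξ : Δ.X k ⟶ Q.obj k) :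
    Δ.X n ⟶ Q.obj n :=
  Nat.leRec (motive := fun n _ => Δ.X n ⟶ Q.obj n) ξ (fun n _ => Q.step n) h

theorem push_self (Q : Tower Δ) (k : ℕ) (ξ : Δ.X k ⟶ Q.obj k) : Q.push le_rfl ξ = ξ :=
  Nat.leRec_self _ _

theorem push_succ (Q : Tower Δ) {k n : ℕ} (h : k ≤ n) (ξ : Δ.X k ⟶ Q.obj k) :
    Q.push (le_trans h n.le_succ) ξ = Q.step n (Q.push h ξ) :=
  Nat.leRec_succ _ _ _

theorem push_add (Q : Tower Δ) {k n : ℕ} (h : k ≤ n) (ξ ζ : Δ.X k ⟶ Q.obj k) :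
    Q.push h (ξ + ζ) = Q.push h ξ + Q.push h ζ := by
  induction n, h using Nat.le_induction with
  | base => simp only [push_self]
  | succ n hn ih => rw [push_succ _ hn, push_succ _ hn, push_succ _ hn, ih, step_add]

theorem push_smul (Q : Tower Δ) {k n : ℕ} (h : k ≤ n) (c : ℂ) (ξ : Δ.X k ⟶ Q.obj k) :
    Q.push h (c • ξ) = c • Q.push h ξ := by
  induction n, h using Nat.le_induction with
  | base => simp only [push_self]
  | succ n hn ih => rw [push_succ _ hn, push_succ _ hn, ih, step_smul]

theorem lift_self {k : ℕ} (γ : Q.obj k ⟶ R.obj k) : lift Q R le_rfl γ = γ :=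
  Nat.leRec_self _ _

theorem push_eq_of_coherent {ξ : Q.Pre} {N : ℕ} (hN : ∀ k ≥ N, val ξ (k + 1) = Q.step k (val ξ k))
    {k n : ℕ} (hk : N ≤ k) (h : k ≤ n) : Q.push h (val ξ k) = val ξ n := by
  induction n, h using Nat.le_induction with
  | base => rw [push_self]
  | succ n hn ih => rw [push_succ _ hn, ih, hN n (le_trans hk hn)]

/-- The connecting unitary cancels its adjoint, so composition is compatible with passing to the
next level. -/
theorem step_comp_transport (k : ℕ) (ξ : Δ.X k ⟶ Q.obj k) (γ : Q.obj k ⟶ R.obj k) :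
    Q.step k ξ ≫ transport Q R k γ = R.step k (ξ ≫ γ) := by
  rw [step, step, transport, (Δ.F k).map_comp, Category.assoc, Category.assoc,
    ← Category.assoc (Q.conn k), (Q.unitary k).1, Category.id_comp]

theorem push_comp_lift {j k n : ℕ} (hj : j ≤ k) (h : k ≤ n) (ξ : Δ.X k ⟶ Q.obj k)
    (γ : Q.obj j ⟶ R.obj j) :
    Q.push h ξ ≫ lift Q R (hj.trans h) γ = R.push h (ξ ≫ lift Q R hj γ) := by
  induction n, h using Nat.le_induction with
  | base => rw [push_self, push_self]
  | succ n hn ih =>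
    rw [push_succ _ hn, push_succ _ hn, lift_succ (hj.trans hn), step_comp_transport, ih]

theorem transport_base (k : ℕ) (β : Δ.X k ⟶ Δ.X k) :
    transport (base Δ) (base Δ) k β = (Δ.F k).map β := by
  change dag (𝟙 _) ≫ (Δ.F k).map β ≫ 𝟙 _ = _
  rw [dag_id]
  exact (Category.id_comp _).trans (Category.comp_id _)

theorem step_base (k : ℕ) (β : Δ.X k ⟶ Δ.X k) : (base Δ).step k β = (Δ.F k).map β :=
  Category.comp_id _

theorem map_comp_step (Q : Tower Δ) (k : ℕ) (β : Δ.X k ⟶ Δ.X k) (ξ : Δ.X k ⟶ Q.obj k) :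
    (Δ.F k).map β ≫ Q.step k ξ = Q.step k (β ≫ ξ) := by
  rw [step, step, (Δ.F k).map_comp, Category.assoc]

theorem lift_comp_push {j k n : ℕ} (hj : j ≤ k) (h : k ≤ n) (ξ : Δ.X k ⟶ Q.obj k)
    (β : Δ.X j ⟶ Δ.X j) : (show Δ.X n ⟶ Δ.X n from lift (base Δ) (base Δ) (hj.trans h) β) ≫
      Q.push h ξ = Q.push h ((show Δ.X k ⟶ Δ.X k from lift (base Δ) (base Δ) hj β) ≫ ξ) := by
  induction n, h using Nat.le_induction with
  | base => rw [push_self, push_self]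
  | succ n hn ih =>
    rw [push_succ _ hn, push_succ _ hn, lift_succ (hj.trans hn), transport_base, map_comp_step, ih]

theorem transport_dag (k : ℕ) (γ : Q.obj k ⟶ R.obj k) :
    transport R Q k (dag γ) = dag (transport Q R k γ) := by
  rw [transport, transport, dag_comp, dag_comp, dag_dag, (Δ.starLinear k).map_dag, Category.assoc]

theorem lift_dag {k n : ℕ} (h : k ≤ n) (γ : Q.obj k ⟶ R.obj k) :
    lift R Q h (dag γ) = dag (lift Q R h γ) := by
  induction n, h using Nat.le_induction with
  | base => rw [lift_self, lift_self]
  | succ n hn ih => rw [lift_succ hn, lift_succ hn, ih, transport_dag]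

theorem lift_transport {k n : ℕ} (h : k + 1 ≤ n) (γ : Q.obj k ⟶ R.obj k) :
    lift Q R h (transport Q R k γ) = lift Q R (le_trans k.le_succ h) γ := by
  induction n, h using Nat.le_induction with
  | base => rw [lift_self, lift_succ (le_refl k), lift_self]
  | succ n hn ih => rw [lift_succ hn, lift_succ (le_trans k.le_succ hn), ih]

theorem lift_comp {S : Tower Δ} {k n : ℕ} (h : k ≤ n) (γ : Q.obj k ⟶ R.obj k)
    (δ : R.obj k ⟶ S.obj k) : lift Q R h γ ≫ lift R S h δ = lift Q S h (γ ≫ δ) := by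
  induction n, h using Nat.le_induction with
  | base => simp only [lift_self]
  | succ n hn ih =>
    rw [lift_succ hn, lift_succ hn, lift_succ hn, ← ih]
    simp only [transport, (Δ.F n).map_comp, Category.assoc]
    rw [← Category.assoc (R.conn n), (R.unitary n).1, Category.id_comp]

/-- `Tr` of products is preserved by the inclusions. -/
theorem Tr_step (Q : Tower Δ) (k : ℕ) (ξ ζ : Δ.X k ⟶ Q.obj k) :
    Tr (Δ.μ (k + 1)) (Δ.X (k + 1)) (Q.step k ξ ≫ dag (Q.step k ζ)) =
      Tr (Δ.μ k) (Δ.X k) (ξ ≫ dag ζ) := by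
  rw [← Tr_map (Δ.starLinear k) (Δ.μ_harmonic k)]
  congr 1
  simp only [step, dag_comp, Category.assoc]
  rw [← Category.assoc (Q.conn k), (Q.unitary k).1, Category.id_comp, (Δ.F k).map_comp,
    (Δ.starLinear k).map_dag]

theorem Tr_push (Q : Tower Δ) {k n : ℕ} (h : k ≤ n) (ξ ζ : Δ.X k ⟶ Q.obj k) :
    Tr (Δ.μ n) (Δ.X n) (Q.push h ξ ≫ dag (Q.push h ζ)) = Tr (Δ.μ k) (Δ.X k) (ξ ≫ dag ζ) := by
  induction n, h using Nat.le_induction with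
  | base => rw [push_self, push_self]
  | succ n hn ih => rw [push_succ _ hn, push_succ _ hn, Tr_step, ih]

/-- The coherent sequence generated by an element of `Hom(Δ_k ⋯ Δ_1 n₀, Q k)`. -/
noncomputable def ofLevel (Q : Tower Δ) (k : ℕ) : (Δ.X k ⟶ Q.obj k) →ₗ[ℂ] Q.Pre where
  toFun ξ := ⟨fun n => if h : k ≤ n then Q.push h ξ else 0, by
    refine ⟨k, fun n hn => ?_⟩
    dsimp only
    rw [dif_pos hn, dif_pos (le_trans hn n.le_succ), push_succ _ hn]⟩
  map_add' ξ ζ := by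
    refine pre_ext fun n => ?_
    change (if h : k ≤ n then Q.push h (ξ + ζ) else 0) =
      (if h : k ≤ n then Q.push h ξ else 0) + (if h : k ≤ n then Q.push h ζ else 0)
    split_ifs
    · rw [push_add]
    · rw [add_zero]
  map_smul' c ξ := by
    refine pre_ext fun n => ?_
    change (if h : k ≤ n then Q.push h (c • ξ) else 0) = c • (if h : k ≤ n then Q.push h ξ else 0)
    split_ifs
    · rw [push_smul]
    · rw [smul_zero]

theorem val_ofLevel (Q : Tower Δ) {k n : ℕ} (h : k ≤ n) (ξ : Δ.X k ⟶ Q.obj k) :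
    val (Q.ofLevel k ξ) n = Q.push h ξ := dif_pos h

/-- Coherent sequences which are eventually equal define the same vector. -/
theorem coe_eq_coe {ξ ζ : Q.Pre} {N : ℕ} (h : ∀ n ≥ N, val ξ n = val ζ n) :
    (ξ : Q.L2) = (ζ : Q.L2) := by
  rw [← sub_eq_zero, ← UniformSpace.Completion.coe_sub, ← norm_eq_zero,
    UniformSpace.Completion.norm_coe]
  have h1 := Q.tendsto_norm (ξ - ζ)
  have h2 : Tendsto (fun n => (Q.trInner (ξ - ζ) (ξ - ζ) n).re) atTop (𝓝 0) := by
    refine tendsto_atTop_of_eventually_const (i₀ := N) fun n hn => ?_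
    have e : val (ξ - ζ) n = 0 := by
      change val ξ n - val ζ n = 0
      rw [h n hn, sub_self]
    simp [trInner, e, Tr, scal_zero]
  exact pow_eq_zero_iff two_ne_zero |>.1 (tendsto_nhds_unique h1 h2)

/-- The inclusion of `Hom(Δ_k ⋯ Δ_1 n₀, Q k)` into the Hilbert space. -/
noncomputable def lev (Q : Tower Δ) (k : ℕ) : (Δ.X k ⟶ Q.obj k) →ₗ[ℂ] Q.L2 :=
  (UniformSpace.Completion.toComplL (𝕜 := ℂ) (E := Q.Pre)).toLinearMap ∘ₗ Q.ofLevel k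

theorem lev_eq (Q : Tower Δ) (k : ℕ) (ξ : Δ.X k ⟶ Q.obj k) :
    Q.lev k ξ = (Q.ofLevel k ξ : Q.Pre) := rfl

theorem coe_eq_lev {ξ : Q.Pre} {N : ℕ} (hN : ∀ k ≥ N, val ξ (k + 1) = Q.step k (val ξ k)) {n : ℕ}
    (hn : N ≤ n) : (ξ : Q.L2) = Q.lev n (val ξ n) :=
  coe_eq_coe (N := n) fun m hm => by rw [val_ofLevel _ hm, push_eq_of_coherent hN hn hm]

theorem exists_coe_eq_lev (ξ : Q.Pre) : ∃ N, ∀ n ≥ N, (ξ : Q.L2) = Q.lev n (val ξ n) := by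
  obtain ⟨N, hN⟩ := val_coherent ξ
  exact ⟨N, fun n hn => coe_eq_lev hN hn⟩

theorem lev_push (Q : Tower Δ) {k n : ℕ} (h : k ≤ n) (ξ : Δ.X k ⟶ Q.obj k) :
    Q.lev n (Q.push h ξ) = Q.lev k ξ := by
  have hk : ∀ m ≥ k, val (Q.ofLevel k ξ) (m + 1) = Q.step m (val (Q.ofLevel k ξ) m) := by
    intro m hm
    rw [val_ofLevel _ hm, val_ofLevel _ (le_trans hm m.le_succ), push_succ _ hm]
  rw [lev_eq Q k, coe_eq_lev hk h, val_ofLevel _ h]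

theorem lev_step (Q : Tower Δ) (k : ℕ) (ξ : Δ.X k ⟶ Q.obj k) :
    Q.lev (k + 1) (Q.step k ξ) = Q.lev k ξ := by
  rw [← Q.lev_push k.le_succ, push_succ _ (le_refl k), push_self]

theorem inner_lev (Q : Tower Δ) (k : ℕ) (ξ ζ : Δ.X k ⟶ Q.obj k) :
    inner ℂ (Q.lev k ξ) (Q.lev k ζ) = Tr (Δ.μ k) (Δ.X k) (ζ ≫ dag ξ) := by
  rw [lev_eq, lev_eq, UniformSpace.Completion.inner_coe]
  refine tendsto_nhds_unique (Q.tendsto_trInner _ _)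
    (tendsto_atTop_of_eventually_const (i₀ := k) fun n hn => ?_)
  rw [trInner, val_ofLevel _ hn, val_ofLevel _ hn, Tr_push]

theorem norm_lev_sq (Q : Tower Δ) (k : ℕ) (ξ : Δ.X k ⟶ Q.obj k) :
    ‖Q.lev k ξ‖ ^ 2 = (Tr (Δ.μ k) (Δ.X k) (ξ ≫ dag ξ)).re := by
  rw [← inner_lev]
  exact (inner_self_eq_norm_sq (𝕜 := ℂ) _).symm

/-- The trace is faithful because all weights are positive. -/
theorem lev_injective (Q : Tower Δ) (k : ℕ) : Function.Injective (Q.lev k) := by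
  rw [injective_iff_map_eq_zero]
  intro ξ hξ
  refine eq_zero_of_Tr (Δ.μ_pos k) ?_
  rw [← inner_lev, hξ, inner_zero_left]

theorem denseRange_coe (Q : Tower Δ) : DenseRange ((↑) : Q.Pre → Q.L2) :=
  UniformSpace.Completion.denseRange_coe

/-- Continuous maps which agree on `Hom(Δ_n ⋯ Δ_1 n₀, Q n)` for all large `n` are equal. -/
theorem eq_of_lev {E : Type*} [TopologicalSpace E] [T2Space E] {f g : Q.L2 → E} (hf : Continuous f)
    (hg : Continuous g) (N : ℕ) (h : ∀ n ≥ N, ∀ ξ, f (Q.lev n ξ) = g (Q.lev n ξ)) : f = g := by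
  refine Q.denseRange_coe.equalizer hf hg (funext fun ξ => ?_)
  obtain ⟨M, hM⟩ := exists_coe_eq_lev ξ
  rw [Function.comp, Function.comp, hM _ (le_max_right N M)]
  exact h _ (le_max_left N M) _

theorem clm_ext {E : Type*} [NormedAddCommGroup E] [NormedSpace ℂ E] {S T : Q.L2 →L[ℂ] E} (N : ℕ)
    (h : ∀ n ≥ N, ∀ ξ, S (Q.lev n ξ) = T (Q.lev n ξ)) : S = T :=
  DFunLike.coe_injective (eq_of_lev S.continuous T.continuous N h)

theorem leftOp_lev {k n : ℕ} (h : k ≤ n) (γ : Q.obj k ⟶ R.obj k) (ξ : Δ.X n ⟶ Q.obj n) :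
    leftOp k γ (Q.lev n ξ) = R.lev n (ξ ≫ lift Q R h γ) := by
  rw [leftOp, lev_eq, lev_eq, ContinuousLinearMap.completion_apply_coe]
  refine coe_eq_coe (N := n) fun m hm => ?_
  rw [val_ofLevel _ hm, ← push_comp_lift, ← val_ofLevel]
  exact dif_pos (h.trans hm)

theorem leftOp_lev_self (k : ℕ) (γ : Q.obj k ⟶ R.obj k) (ξ : Δ.X k ⟶ Q.obj k) :
    leftOp k γ (Q.lev k ξ) = R.lev k (ξ ≫ γ) := by
  rw [leftOp_lev le_rfl, lift_self]

theorem rightOp_lev (Q : Tower Δ) {k n : ℕ} (h : k ≤ n) (β : Δ.X k ⟶ Δ.X k)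
    (ξ : Δ.X n ⟶ Q.obj n) : Q.rightOp k β (Q.lev n ξ) =
      Q.lev n ((show Δ.X n ⟶ Δ.X n from lift (base Δ) (base Δ) h β) ≫ ξ) := by
  rw [rightOp, lev_eq, lev_eq, ContinuousLinearMap.completion_apply_coe]
  refine coe_eq_coe (N := n) fun m hm => ?_
  rw [val_ofLevel _ hm, ← lift_comp_push, ← val_ofLevel]
  exact dif_pos (h.trans hm)

theorem rightOp_lev_self (Q : Tower Δ) (k : ℕ) (β : Δ.X k ⟶ Δ.X k) (ξ : Δ.X k ⟶ Q.obj k) :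
    Q.rightOp k β (Q.lev k ξ) = Q.lev k (β ≫ ξ) := by
  rw [rightOp_lev _ le_rfl]
  congr 2
  exact lift_self (Q := base Δ) (R := base Δ) β

theorem norm_leftOp_le (k : ℕ) (γ : Q.obj k ⟶ R.obj k) : ‖leftOp k γ‖ ≤ ‖γ‖ := by
  refine ContinuousLinearMap.opNorm_le_bound _ (norm_nonneg _) fun x => ?_
  induction x using UniformSpace.Completion.induction_on with
  | hp => exact isClosed_le (by fun_prop) (by fun_prop)
  | ih x =>
    rw [leftOp, ContinuousLinearMap.completion_apply_coe, UniformSpace.Completion.norm_coe,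
      UniformSpace.Completion.norm_coe]
    exact norm_leftPre_le k γ x

theorem norm_rightOp_le (Q : Tower Δ) (k : ℕ) (β : Δ.X k ⟶ Δ.X k) : ‖Q.rightOp k β‖ ≤ ‖β‖ := by
  refine ContinuousLinearMap.opNorm_le_bound _ (norm_nonneg _) fun x => ?_
  induction x using UniformSpace.Completion.induction_on with
  | hp => exact isClosed_le (by fun_prop) (by fun_prop)
  | ih x =>
    rw [rightOp, ContinuousLinearMap.completion_apply_coe, UniformSpace.Completion.norm_coe,
      UniformSpace.Completion.norm_coe]
    exact norm_rightPre_le Q k β x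

theorem leftOp_transport (k : ℕ) (γ : Q.obj k ⟶ R.obj k) :
    leftOp (k + 1) (transport Q R k γ) = leftOp k γ :=
  clm_ext (k + 1) fun n hn ξ => by
    rw [leftOp_lev hn, leftOp_lev (le_trans k.le_succ hn), lift_transport]

theorem leftOp_lift {k n : ℕ} (h : k ≤ n) (γ : Q.obj k ⟶ R.obj k) :
    leftOp n (lift Q R h γ) = leftOp k γ := by
  induction n, h using Nat.le_induction with
  | base => rw [lift_self]
  | succ n hn ih => rw [lift_succ hn, leftOp_transport, ih]

theorem leftOp_rightOp (k j : ℕ) (γ : Q.obj k ⟶ R.obj k) (β : Δ.X j ⟶ Δ.X j) (x : Q.L2) :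
    leftOp k γ (Q.rightOp j β x) = R.rightOp j β (leftOp k γ x) := by
  refine congrFun (eq_of_lev (f := fun x => leftOp k γ (Q.rightOp j β x))
    (g := fun x => R.rightOp j β (leftOp k γ x)) (by fun_prop) (by fun_prop) (max k j)
    fun n hn ξ => ?_) x
  have hk := le_trans (le_max_left k j) hn
  have hj := le_trans (le_max_right k j) hn
  rw [rightOp_lev _ hj, leftOp_lev hk, leftOp_lev hk, rightOp_lev _ hj, Category.assoc]

theorem leftOp_comp {S : Tower Δ} (k : ℕ) (γ : Q.obj k ⟶ R.obj k) (δ : R.obj k ⟶ S.obj k)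
    (x : Q.L2) : leftOp k δ (leftOp k γ x) = leftOp k (γ ≫ δ) x := by
  refine congrFun (eq_of_lev (f := fun x => leftOp k δ (leftOp k γ x))
    (g := fun x => leftOp k (γ ≫ δ) x) (by fun_prop) (by fun_prop) k fun n hn ξ => ?_) x
  rw [leftOp_lev hn, leftOp_lev hn, leftOp_lev hn, Category.assoc]
  rw [lift_comp]

theorem inner_leftOp (k : ℕ) (γ : Q.obj k ⟶ R.obj k) (x : Q.L2) (y : R.L2) :
    inner ℂ (leftOp k (dag γ) y) x = inner ℂ y (leftOp k γ x) := by
  have key : ∀ n ≥ k, ∀ ξ ζ, inner ℂ (leftOp k (dag γ) (R.lev n ζ)) (Q.lev n ξ) =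
      inner ℂ (R.lev n ζ) (leftOp k γ (Q.lev n ξ)) := by
    intro n hn ξ ζ
    rw [leftOp_lev hn, leftOp_lev hn, inner_lev, inner_lev, lift_dag, dag_comp, dag_dag,
      Category.assoc]
  have h1 : ∀ n ≥ k, ∀ ζ, inner ℂ (leftOp k (dag γ) (R.lev n ζ)) x =
      inner ℂ (R.lev n ζ) (leftOp k γ x) := by
    intro n hn ζ
    refine congrFun (eq_of_lev (f := fun x => inner ℂ (leftOp k (dag γ) (R.lev n ζ)) x)
      (g := fun x => inner ℂ (R.lev n ζ) (leftOp k γ x)) (by fun_prop) (by fun_prop) n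
      fun m hm ξ => ?_) x
    -- The level `n` vector is pushed up to level `m`, since `key` needs both arguments on a common
    -- level.
    rw [← R.lev_push hm, key m (le_trans hn hm)]
  exact congrFun (eq_of_lev (f := fun y => inner ℂ (leftOp k (dag γ) y) x)
    (g := fun y => inner ℂ y (leftOp k γ x)) (by fun_prop) (by fun_prop) k h1) y

theorem adjoint_leftOp (k : ℕ) (γ : Q.obj k ⟶ R.obj k) :
    ContinuousLinearMap.adjoint (leftOp k γ) = leftOp k (dag γ) := by
  refine ((ContinuousLinearMap.eq_adjoint_iff _ _).2 fun y x => ?_).symm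
  exact inner_leftOp k γ x y

/-- In contrast with `inner_leftOp`, the morphism has to travel around the trace, so the trace
property is needed. -/
theorem inner_rightOp (Q : Tower Δ) (k : ℕ) (β : Δ.X k ⟶ Δ.X k) (x y : Q.L2) :
    inner ℂ (Q.rightOp k (dag β) y) x = inner ℂ y (Q.rightOp k β x) := by
  have key : ∀ n ≥ k, ∀ ξ ζ, inner ℂ (Q.rightOp k (dag β) (Q.lev n ζ)) (Q.lev n ξ) =
      inner ℂ (Q.lev n ζ) (Q.rightOp k β (Q.lev n ξ)) := by
    intro n hn ξ ζ
    have e := lift_dag (Q := base Δ) (R := base Δ) hn β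
    rw [rightOp_lev _ hn, rightOp_lev _ hn, inner_lev, inner_lev, e, dag_comp, dag_dag,
      ← Category.assoc, Tr_comm, Category.assoc]
  have h1 : ∀ n ≥ k, ∀ ζ, inner ℂ (Q.rightOp k (dag β) (Q.lev n ζ)) x =
      inner ℂ (Q.lev n ζ) (Q.rightOp k β x) := by
    intro n hn ζ
    refine congrFun (eq_of_lev (f := fun x => inner ℂ (Q.rightOp k (dag β) (Q.lev n ζ)) x)
      (g := fun x => inner ℂ (Q.lev n ζ) (Q.rightOp k β x)) (by fun_prop) (by fun_prop) n
      fun m hm ξ => ?_) x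
    rw [← Q.lev_push hm, key m (le_trans hn hm)]
  exact congrFun (eq_of_lev (f := fun y => inner ℂ (Q.rightOp k (dag β) y) x)
    (g := fun y => inner ℂ y (Q.rightOp k β x)) (by fun_prop) (by fun_prop) k h1) y

theorem adjoint_rightOp (Q : Tower Δ) (k : ℕ) (β : Δ.X k ⟶ Δ.X k) :
    ContinuousLinearMap.adjoint (Q.rightOp k β) = Q.rightOp k (dag β) := by
  refine ((ContinuousLinearMap.eq_adjoint_iff _ _).2 fun y x => ?_).symm
  exact inner_rightOp Q k β x y

end Tower

/-! ### Compressions to the levels, martingales and strong limits -/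

namespace Tower

variable {Δ : ZeroCell.{v, u}} {Q R : Tower Δ}

/-- The subspace `Hom(Δ_k ⋯ Δ_1 n₀, Q k)` of the Hilbert space. -/
noncomputable def levelSpace (Q : Tower Δ) (k : ℕ) : Submodule ℂ Q.L2 := LinearMap.range (Q.lev k)

instance (Q : Tower Δ) (k : ℕ) : FiniteDimensional ℂ (Q.levelSpace k) :=
  inferInstanceAs (FiniteDimensional ℂ (LinearMap.range (Q.lev k)))

theorem levelSpace_mono (Q : Tower Δ) : Monotone Q.levelSpace := by
  rintro k n h _ ⟨ξ, rfl⟩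
  exact ⟨Q.push h ξ, Q.lev_push h ξ⟩

/-- The levels increase and their union is dense, since every coherent sequence lies in some level.
-/
theorem starProjection_levelSpace_tendsto (Q : Tower Δ) (x : Q.L2) :
    Tendsto (fun k => (Q.levelSpace k).starProjection x) atTop (𝓝 x) := by
  refine Submodule.starProjection_tendsto_self _ Q.levelSpace_mono x ?_
  intro y _
  refine closure_mono ?_ (Q.denseRange_coe y)
  rintro _ ⟨ξ, rfl⟩
  obtain ⟨N, hN⟩ := exists_coe_eq_lev ξ
  rw [hN N le_rfl]
  exact Submodule.mem_iSup_of_mem N ⟨_, rfl⟩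

/-- The compression to `Hom(Δ_k ⋯ Δ_1 n₀, Q k)` of an operator which commutes with the right
action of `B_k` is composition with a morphism. -/
theorem exists_compression (T : Q.L2 →L[ℂ] R.L2) (k : ℕ)
    (hT : ∀ (β : Δ.X k ⟶ Δ.X k) x, T (Q.rightOp k β x) = R.rightOp k β (T x)) :
    ∃ γ : Q.obj k ⟶ R.obj k, ‖γ‖ ≤ ‖T‖ ∧
      ∀ ξ ζ, inner ℂ (R.lev k ζ) (R.lev k (ξ ≫ γ)) = inner ℂ (R.lev k ζ) (T (Q.lev k ξ)) := by
  -- `t ξ` represents the orthogonal projection of `T ξ` onto level `k`.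
  have ht : ∀ ξ, ∃ t : Δ.X k ⟶ R.obj k, ∀ ζ,
      inner ℂ (R.lev k ζ) (R.lev k t) = inner ℂ (R.lev k ζ) (T (Q.lev k ξ)) := by
    intro ξ
    obtain ⟨t, ht⟩ : (R.levelSpace k).starProjection (T (Q.lev k ξ)) ∈ R.levelSpace k :=
      Submodule.starProjection_apply_mem _ _
    refine ⟨t, fun ζ => ?_⟩
    rw [ht, ← Submodule.inner_starProjection_left_eq_right,
      Submodule.starProjection_eq_self_iff.2 (show R.lev k ζ ∈ R.levelSpace k from ⟨ζ, rfl⟩)]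
  choose t ht using ht
  -- The `a i` generate `Hom(Δ.X k, Q.obj k)` as a B_k-module: each `ξ` is the sum of `(ξ ≫ dag (a
  -- i)) ≫ a i` with coefficients in `End (Δ.X k)`. By right linearity the compression is determined
  -- by the values `t (a i)`.
  obtain ⟨a, ha⟩ := (Δ.isFull_X k).exists_frame (Q.obj k)
  have comp : ∀ ξ ζ, inner ℂ (R.lev k ζ) (R.lev k (ξ ≫ ∑ i, dag (a i) ≫ t (a i))) =
      inner ℂ (R.lev k ζ) (T (Q.lev k ξ)) := by
    intro ξ ζ
    have e : ∀ i, inner ℂ (R.lev k ζ) (R.lev k (ξ ≫ dag (a i) ≫ t (a i))) =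
        inner ℂ (R.lev k ζ) (T (Q.lev k (ξ ≫ dag (a i) ≫ a i))) := by
      intro i
      have e1 : R.lev k (ξ ≫ dag (a i) ≫ t (a i)) =
          R.rightOp k (ξ ≫ dag (a i)) (R.lev k (t (a i))) := by
        rw [rightOp_lev_self, Category.assoc]
      have e2 : Q.lev k (ξ ≫ dag (a i) ≫ a i) = Q.rightOp k (ξ ≫ dag (a i)) (Q.lev k (a i)) := by
        rw [rightOp_lev_self, Category.assoc]
      rw [e1, e2, hT, ← inner_rightOp, ← inner_rightOp, rightOp_lev_self, ht]
    simp only [Preadditive.comp_sum, map_sum, inner_sum, e]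
    rw [← inner_sum, ← map_sum, ← map_sum, ← Preadditive.comp_sum, ha, Category.comp_id]
  refine ⟨_, ?_, comp⟩
  refine (Δ.isFull_X k).norm_le_of_Tr (Δ.μ_pos k) _ (norm_nonneg T) fun ξ => ?_
  rw [← norm_lev_sq, ← norm_lev_sq, ← mul_pow]
  set x := R.lev k (ξ ≫ ∑ i, dag (a i) ≫ t (a i)) with hx
  -- Testing `comp` against `x` itself replaces one factor by `T ξ`.
  have h1 : ‖x‖ * ‖x‖ ≤ ‖x‖ * (‖T‖ * ‖Q.lev k ξ‖) := by
    have h2 : ‖x‖ * ‖x‖ = ‖(inner ℂ x (T (Q.lev k ξ)) : ℂ)‖ := by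
      rw [← comp, ← hx, inner_self_eq_norm_sq_to_K]
      simp [sq]
    rw [h2]
    exact (norm_inner_le_norm _ _).trans (by gcongr; exact T.le_opNorm _)
  gcongr
  rcases (norm_nonneg x).eq_or_lt with h0 | h0
  · rw [← h0]; positivity
  · exact le_of_mul_le_mul_left h1 h0

/-- An operator which commutes with the right actions of all `B_k` is the strong limit of its
compressions. -/
theorem tendsto_leftOp_compression (T : Q.L2 →L[ℂ] R.L2) {γ : ∀ k, Q.obj k ⟶ R.obj k} {C : ℝ}
    (hC : ∀ k, ‖γ k‖ ≤ C) (hγ : ∀ k ξ ζ,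
      inner ℂ (R.lev k ζ) (R.lev k (ξ ≫ γ k)) = inner ℂ (R.lev k ζ) (T (Q.lev k ξ))) (x : Q.L2) :
    Tendsto (fun k => leftOp k (γ k) x) atTop (𝓝 (T x)) := by
  refine strong_limit_of_dense Q.denseRange_coe (fun k => (norm_leftOp_le k (γ k)).trans (hC k))
    (fun ξ => ?_) x
  obtain ⟨N, hN⟩ := exists_coe_eq_lev ξ
  refine (R.starProjection_levelSpace_tendsto (T ξ)).congr' ?_
  filter_upwards [eventually_ge_atTop N] with k hk
  rw [hN k hk, leftOp_lev_self]
  -- For `k ≥ N` the vector lies in level `k`, and there the compression acts as `T` followed by the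
  -- projection onto level `k`; these projections converge strongly to the identity.
  refine Submodule.eq_starProjection_of_mem_of_inner_eq_zero (K := R.levelSpace k) ⟨_, rfl⟩ ?_
  rintro _ ⟨ζ, rfl⟩
  rw [inner_sub_left, sub_eq_zero, ← inner_conj_symm, ← hγ, inner_conj_symm]

/-- The conditional expectation of `Hom(Q (k+1), R (k+1))` onto `Hom(Q k, R k)`. -/
noncomputable def expect (Q R : Tower Δ) (k : ℕ) (γ : Q.obj (k + 1) ⟶ R.obj (k + 1)) :
    Q.obj k ⟶ R.obj k :=
  (Δ.sol k).expect (Q.conn k ≫ γ ≫ dag (R.conn k))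

/-- The adjointness `Tr_expect` says that the algebraic expectation is the Hilbert space compression
from level `k + 1` to level `k`. This is the bridge between the loop operator and operators on the
completions. -/
theorem inner_expect (k : ℕ) (γ : Q.obj (k + 1) ⟶ R.obj (k + 1)) (ξ : Δ.X k ⟶ Q.obj k)
    (ζ : Δ.X k ⟶ R.obj k) :
    inner ℂ (R.lev k ζ) (R.lev k (ξ ≫ expect Q R k γ)) =
      inner ℂ (R.lev k ζ) (leftOp (k + 1) γ (Q.lev k ξ)) := by
  rw [← Q.lev_step, leftOp_lev_self, ← R.lev_step k ζ, inner_lev, R.lev_step, inner_lev,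
    Category.assoc, Tr_comm, Category.assoc, expect,
    (Δ.sol k).Tr_expect (Δ.starLinear k) (Δ.μ_pos k), (Δ.F k).map_comp, (Δ.starLinear k).map_dag]
  simp only [step, dag_comp, Category.assoc]
  rw [Tr_comm (Δ.μ (k + 1)) ((Δ.F k).map ξ)]
  simp only [Category.assoc]

/-- A bounded sequence which is compatible with the conditional expectations converges strongly. -/
theorem exists_limit_of_expect {γ : ∀ k, Q.obj k ⟶ R.obj k} {C : ℝ} (hC : ∀ k, ‖γ k‖ ≤ C)
    (hγ : ∀ k, expect Q R k (γ (k + 1)) = γ k) :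
    ∃ T : Q.L2 →L[ℂ] R.L2, (∀ x, Tendsto (fun k => leftOp k (γ k) x) atTop (𝓝 (T x))) ∧
      ∀ k ξ ζ, inner ℂ (R.lev k ζ) (R.lev k (ξ ≫ γ k)) = inner ℂ (R.lev k ζ) (T (Q.lev k ξ)) := by
  -- By descent from `n` to `k`, all later operators have the same compression to level `k`; on a
  -- level `k` vector this is the martingale property.
  have mart : ∀ k n, k ≤ n → ∀ ξ ζ, inner ℂ (R.lev k ζ) (leftOp n (γ n) (Q.lev k ξ)) =
      inner ℂ (R.lev k ζ) (R.lev k (ξ ≫ γ k)) := by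
    intro k n h
    induction n, h using Nat.le_induction with
    | base => intro ξ ζ; rw [leftOp_lev_self]
    | succ n hn ih =>
      intro ξ ζ
      rw [← ih ξ ζ, ← R.lev_push hn, ← Q.lev_push hn, ← inner_expect, hγ, leftOp_lev_self]
  obtain ⟨T, hT⟩ := exists_strong_limit (T := fun k => leftOp k (γ k)) Q.denseRange_coe
    (fun k => (norm_leftOp_le k (γ k)).trans (hC k)) fun ξ => by
      obtain ⟨N, hN⟩ := exists_coe_eq_lev ξ
      refine cauchySeq_of_orthogonal_increments (C := C * ‖(ξ : Q.L2)‖) (N := N)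
        (fun k _ => ?_) fun k n hk hn => ?_
      · exact (ContinuousLinearMap.le_opNorm _ _).trans
          (by gcongr; exact (norm_leftOp_le k (γ k)).trans (hC k))
      · rw [hN k hk, leftOp_lev_self, mart k n hn]
  refine ⟨T, hT, fun k ξ ζ => ?_⟩
  refine tendsto_nhds_unique (tendsto_atTop_of_eventually_const (i₀ := k) fun n hn =>
    mart k n hn ξ ζ) (Filter.Tendsto.inner tendsto_const_nhds (hT _))

/-- The vectors `ζ` exhaust the level, so all composites `ξ ≫ γ` are determined, and a frame
recovers `γ` from them. -/
theorem eq_of_inner_lev {k : ℕ} {γ γ' : Q.obj k ⟶ R.obj k}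
    (h : ∀ ξ ζ, inner ℂ (R.lev k ζ) (R.lev k (ξ ≫ γ)) = inner ℂ (R.lev k ζ) (R.lev k (ξ ≫ γ'))) :
    γ = γ' := by
  have h1 : ∀ ξ : Δ.X k ⟶ Q.obj k, ξ ≫ γ = ξ ≫ γ' := by
    intro ξ
    refine R.lev_injective k (sub_eq_zero.1 ?_)
    rw [← map_sub]
    refine inner_self_eq_zero (𝕜 := ℂ).1 ?_
    nth_rewrite 2 [map_sub]
    rw [inner_sub_right, h, sub_self]
  obtain ⟨a, ha⟩ := (Δ.isFull_X k).exists_frame (Q.obj k)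
  rw [← Category.id_comp γ, ← Category.id_comp γ', ← ha, Preadditive.sum_comp, Preadditive.sum_comp]
  exact Finset.sum_congr rfl fun i _ => by rw [Category.assoc, Category.assoc, h1]

/-! ### The conjugation J on L²(B_∞) -/

/-- The modular conjugation `β ↦ β†` on sequences. -/
noncomputable def conjPre (Δ : ZeroCell.{v, u}) : (base Δ).Pre →ₛₗ[starRingEnd ℂ] (base Δ).Pre where
  toFun ξ := ⟨fun n => (dag (show Δ.X n ⟶ Δ.X n from val ξ n)), by
    obtain ⟨N, hN⟩ := val_coherent ξ
    refine ⟨N, fun n hn => ?_⟩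
    dsimp only
    rw [hN n hn, step_base, step_base, (Δ.starLinear n).map_dag]⟩
  map_add' ξ ζ := pre_ext fun n => dag_add _ _
  map_smul' c ξ := pre_ext fun n => dag_smul c _

theorem val_conjPre (ξ : (base Δ).Pre) (n : ℕ) :
    val (conjPre Δ ξ) n = dag (show Δ.X n ⟶ Δ.X n from val ξ n) := rfl

theorem norm_conjPre_le (ξ : (base Δ).Pre) : ‖conjPre Δ ξ‖ ≤ 1 * ‖ξ‖ := by
  refine norm_le_of_tr zero_le_one fun n => ?_
  rw [one_pow, one_mul, trInner, trInner, val_conjPre, dag_dag]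
  exact (congrArg Complex.re (Tr_comm (Δ.μ n) (show Δ.X n ⟶ Δ.X n from dag (val ξ n)) (val ξ n))).le

/-- The modular conjugation `β ↦ β†` on `L²(B_∞)`. -/
noncomputable def conj (Δ : ZeroCell.{v, u}) : (base Δ).L2 →SL[starRingEnd ℂ] (base Δ).L2 :=
  ((conjPre Δ).mkContinuous 1 norm_conjPre_le).completion

theorem conj_lev (n : ℕ) (β : Δ.X n ⟶ Δ.X n) :
    conj Δ ((base Δ).lev n β) = (base Δ).lev n (show Δ.X n ⟶ Δ.X n from dag β) := by
  rw [conj, lev_eq, ContinuousLinearMap.completion_apply_coe, LinearMap.mkContinuous_apply]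
  have hk : ∀ m ≥ n, val (conjPre Δ ((base Δ).ofLevel n β)) (m + 1) =
      (base Δ).step m (val (conjPre Δ ((base Δ).ofLevel n β)) m) := by
    intro m hm
    rw [val_conjPre, val_conjPre, val_ofLevel _ hm, val_ofLevel _ (le_trans hm m.le_succ),
      push_succ _ hm, step_base, step_base, (Δ.starLinear m).map_dag]
  rw [coe_eq_lev hk le_rfl, val_conjPre, val_ofLevel _ le_rfl, push_self]

theorem conj_conj (x : (base Δ).L2) : conj Δ (conj Δ x) = x := by
  refine congrFun (eq_of_lev (f := fun x => conj Δ (conj Δ x)) (g := fun x => x)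
    (by fun_prop) (by fun_prop) 0 fun n _ β => ?_) x
  exact (congrArg (conj Δ) (conj_lev n β)).trans ((conj_lev n _).trans
    (congrArg ((base Δ).lev n) (dag_dag (show Δ.X n ⟶ Δ.X n from β))))

/-- On a common level this is the trace property, and it expresses that J is antiunitary. -/
theorem inner_conj (x y : (base Δ).L2) : inner ℂ (conj Δ x) y = inner ℂ (conj Δ y) x := by
  have key : ∀ n (α β : Δ.X n ⟶ Δ.X n), inner ℂ (conj Δ ((base Δ).lev n α)) ((base Δ).lev n β) =
      inner ℂ (conj Δ ((base Δ).lev n β)) ((base Δ).lev n α) := by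
    intro n α β
    rw [conj_lev, conj_lev, inner_lev, inner_lev]
    have := Tr_comm (Δ.μ n) α β
    rw [← dag_dag α, ← dag_dag β] at this
    simp only [dag_dag] at this ⊢
    exact this.symm
  have h1 : ∀ n ≥ 0, ∀ α, inner ℂ (conj Δ ((base Δ).lev n α)) y =
      inner ℂ (conj Δ y) ((base Δ).lev n α) := by
    intro n _ α
    refine congrFun (eq_of_lev (f := fun y => inner ℂ (conj Δ ((base Δ).lev n α)) y)
      (g := fun y => inner ℂ (conj Δ y) ((base Δ).lev n α)) (by fun_prop) (by fun_prop) n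
      fun m hm β => ?_) y
    rw [← (base Δ).lev_push hm, key]
  exact congrFun (eq_of_lev (f := fun x => inner ℂ (conj Δ x) y)
    (g := fun x => inner ℂ (conj Δ y) x) (by fun_prop) (by fun_prop) 0 h1) x

/-- J exchanges left and right multiplications, so statements about the left action of `Δ.vN`
transfer to the right one. -/
theorem conj_leftOp (k : ℕ) (β : Δ.X k ⟶ Δ.X k) (x : (base Δ).L2) :
    conj Δ (leftOp (Q := base Δ) (R := base Δ) k (dag β) (conj Δ x)) = (base Δ).rightOp k β x := by
  refine congrFun (eq_of_lev
    (f := fun x => conj Δ (leftOp (Q := base Δ) (R := base Δ) k (dag β) (conj Δ x)))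
    (g := fun x => (base Δ).rightOp k β x) (by fun_prop) (by fun_prop) k fun n hn ξ => ?_) x
  rw [conj_lev, leftOp_lev hn, conj_lev, rightOp_lev _ hn, lift_dag (Q := base Δ) (R := base Δ)]
  congr 1
  exact (dag_comp (C := Δ.M n) _ _).trans (congrArg₂ (· ≫ ·) (dag_dag _) (dag_dag _))

end Tower

/-! ### Bounded approximation in the von Neumann algebra of a 0-cell -/

namespace ZeroCell

variable (Γ : ZeroCell.{v, u})

theorem star_mulOp (k : ℕ) (α : Γ.X k ⟶ Γ.X k) : star (Γ.mulOp k α) = Γ.mulOp k (dag α) :=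
  Tower.adjoint_leftOp (Q := Tower.base Γ) (R := Tower.base Γ) k α

theorem star_toVN (k : ℕ) (α : Γ.X k ⟶ Γ.X k) : star (Γ.toVN k α) = Γ.toVN k (dag α) :=
  Subtype.ext (Γ.star_mulOp k α)

/-- Right multiplications commute with the generators `mulOps`, hence lie in their commutant, with
which the double commutant commutes. -/
theorem vN_comm_rightOp (a : Γ.vN.toStarSubalgebra) (k : ℕ) (β : Γ.X k ⟶ Γ.X k)
    (x : (Tower.base Γ).L2) : (a : (Tower.base Γ).L2 →L[ℂ] (Tower.base Γ).L2)
      ((Tower.base Γ).rightOp k β x) = (Tower.base Γ).rightOp k β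
        ((a : (Tower.base Γ).L2 →L[ℂ] (Tower.base Γ).L2) x) := by
  have h1 : (Tower.base Γ).rightOp k β ∈ StarSubalgebra.centralizer ℂ Γ.mulOps := by
    rw [StarSubalgebra.mem_centralizer_iff]
    rintro _ ⟨j, α, rfl⟩
    have h : ∀ α, Γ.mulOp j α * (Tower.base Γ).rightOp k β =
        (Tower.base Γ).rightOp k β * Γ.mulOp j α := fun α =>
      ContinuousLinearMap.ext fun x =>
        Tower.leftOp_rightOp (Q := Tower.base Γ) (R := Tower.base Γ) j k α β x
    exact ⟨h α, by rw [star_mulOp]; exact h _⟩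
  have h2 : (a : (Tower.base Γ).L2 →L[ℂ] (Tower.base Γ).L2) ∈ StarSubalgebra.centralizer ℂ
      (StarSubalgebra.centralizer ℂ Γ.mulOps : Set ((Tower.base Γ).L2 →L[ℂ] (Tower.base Γ).L2)) :=
    a.2
  rw [StarSubalgebra.mem_centralizer_iff] at h2
  exact (DFunLike.congr_fun (h2 _ h1).1 x).symm

/-- Every element of `PB(Γ)` is the strong limit of a bounded sequence of elements of `A_∞`. -/
theorem exists_approx (a : Γ.vN.toStarSubalgebra) : ∃ α : ∀ k, Γ.X k ⟶ Γ.X k,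
    (∃ C : ℝ, ∀ k, ‖α k‖ ≤ C) ∧ ∀ x, Tendsto (fun k => Γ.mulOp k (α k) x) atTop
      (𝓝 ((a : (Tower.base Γ).L2 →L[ℂ] (Tower.base Γ).L2) x)) := by
  -- Compressions of `a` to the levels of L²(A_∞) are left multiplications by elements of A_k
  -- bounded by `‖a‖`; no density theorem for unit balls is needed.
  choose α hα hα' using fun k => Tower.exists_compression (Q := Tower.base Γ) (R := Tower.base Γ)
    (a : (Tower.base Γ).L2 →L[ℂ] (Tower.base Γ).L2) k (Γ.vN_comm_rightOp a k)
  exact ⟨α, ⟨_, hα⟩, Tower.tendsto_leftOp_compression _ hα hα'⟩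

/-- The cyclic trace vector of `L²(A_∞)`. -/
noncomputable def vac : (Tower.base Γ).L2 := (Tower.base Γ).lev 0 (show Γ.X 0 ⟶ Γ.X 0 from 𝟙 _)

theorem vac_eq (k : ℕ) : Γ.vac = (Tower.base Γ).lev k (show Γ.X k ⟶ Γ.X k from 𝟙 _) := by
  induction k with
  | zero => rfl
  | succ k ih =>
    rw [ih, ← Tower.lev_step, Tower.step_base]
    exact congrArg ((Tower.base Γ).lev (k + 1)) ((Γ.F k).map_id _)

/-- The antirepresentation of `PB(Γ)` by right multiplications `b ↦ J b† J`. -/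
noncomputable def rightRep :
    (Γ.vN.toStarSubalgebra)ᵐᵒᵖ →⋆ₐ[ℂ] ((Tower.base Γ).L2 →L[ℂ] (Tower.base Γ).L2) where
  toFun b := (Tower.conj Γ).comp (((star b.unop : Γ.vN.toStarSubalgebra) :
    (Tower.base Γ).L2 →L[ℂ] (Tower.base Γ).L2).comp (Tower.conj Γ))
  map_one' := by
    ext x
    simp [Tower.conj_conj]
  map_mul' a b := by
    ext x
    simp [Tower.conj_conj]
  map_zero' := by
    ext x
    simp
  map_add' a b := by
    ext x
    simp
  commutes' c := by
    ext x
    simp [Algebra.algebraMap_eq_smul_one, Tower.conj_conj]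
  map_star' b := by
    refine ((ContinuousLinearMap.eq_adjoint_iff _ _).2 fun x y => ?_)
    simp only [ContinuousLinearMap.comp_apply, MulOpposite.unop_star, star_star]
    have h1 : ∀ z w : (Tower.base Γ).L2, inner ℂ z (Tower.conj Γ w) =
        inner ℂ w (Tower.conj Γ z) := fun z w => by
      rw [← inner_conj_symm, Tower.inner_conj, inner_conj_symm]
    rw [Tower.inner_conj, h1]
    exact (ContinuousLinearMap.adjoint_inner_left
      ((b.unop : Γ.vN.toStarSubalgebra) : (Tower.base Γ).L2 →L[ℂ] (Tower.base Γ).L2) _ _).symm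

end ZeroCell

/-- On `f ≫ dag f` the trace is a sum of nonnegative terms weighted by `μ`. It is applied to the
weights of Δ pulled back along Λ_k. -/
theorem Tr_mono_weight {C : Type u} [Category.{v} C] [CStarCategory C] [FinSemisimple C]
    {μ μ' : Vert C → ℝ} {M : ℝ} (h : ∀ v, μ' v ≤ M * μ v) {x y : C} (f : x ⟶ y) :
    (Tr μ' x (f ≫ dag f)).re ≤ M * (Tr μ x (f ≫ dag f)).re := by
  rw [Tr_comp_dag, Tr_comp_dag, Complex.ofReal_re, Complex.ofReal_re, Finset.mul_sum]
  refine Finset.sum_le_sum fun v _ => ?_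
  rw [Finset.mul_sum]
  refine Finset.sum_le_sum fun i _ => ?_
  rw [← mul_assoc]
  gcongr
  exact h v

/-! ### Bounded orbit maps from L²(B_∞) and L²(A_∞) -/

namespace Tower

variable {Δ : ZeroCell.{v, u}}

theorem norm_step_le (Q : Tower Δ) (k : ℕ) (ξ : Δ.X k ⟶ Q.obj k) : ‖Q.step k ξ‖ ≤ ‖ξ‖ := by
  calc _ ≤ ‖(Δ.F k).map ξ‖ * ‖Q.conn k‖ := norm_comp_le _ _
    _ ≤ ‖ξ‖ * 1 := by
      gcongr
      · exact (Δ.starLinear k).norm_map_le ξ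
      · exact norm_unitary_le (Q.unitary k)
    _ = ‖ξ‖ := mul_one _

/-- Steps are contractive, so after the coherence threshold the norms no longer increase and
finitely many terms dominate. -/
theorem exists_norm_val_le {Q : Tower Δ} (ξ : Q.Pre) : ∃ C : ℝ, 0 ≤ C ∧ ∀ n, ‖val ξ n‖ ≤ C := by
  obtain ⟨N, hN⟩ := val_coherent ξ
  refine ⟨∑ i ∈ Finset.range (N + 1), ‖val ξ i‖, Finset.sum_nonneg fun i _ => norm_nonneg _,
    fun n => ?_⟩
  have h1 : ∀ i ≤ N, ‖val ξ i‖ ≤ ∑ i ∈ Finset.range (N + 1), ‖val ξ i‖ := fun i hi =>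
    Finset.single_le_sum (f := fun i => ‖val ξ i‖) (fun i _ => norm_nonneg _)
      (Finset.mem_range.2 (by omega))
  rcases le_total n N with h | h
  · exact h1 n h
  · induction n, h using Nat.le_induction with
    | base => exact h1 N le_rfl
    | succ n hn ih =>
      rw [hN n hn]
      exact (norm_step_le Q n _).trans ih

/-- The map `β ↦ ξ ∘ β` from `L²(B_∞)`, for `ξ ∈ Hom(Δ_k ⋯ Δ_1 n₀, Q k)`. -/
theorem exists_rightOrbit {Q : Tower Δ} (ξ : Q.Pre) : ∃ (R : (base Δ).L2 →L[ℂ] Q.L2) (N : ℕ),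
    ∀ n ≥ N, ∀ β : Δ.X n ⟶ Δ.X n, R ((base Δ).lev n β) = Q.lev n (β ≫ val ξ n) := by
  obtain ⟨C, hC0, hC⟩ := exists_norm_val_le ξ
  let L : (base Δ).Pre →ₗ[ℂ] Q.Pre :=
    { toFun := fun β => ⟨fun n => (show Δ.X n ⟶ Δ.X n from val β n) ≫ val ξ n, by
        obtain ⟨N, hN⟩ := val_coherent ξ
        obtain ⟨N', hN'⟩ := val_coherent β
        refine ⟨max N N', fun n hn => ?_⟩
        dsimp only
        rw [hN n (le_trans (le_max_left _ _) hn), hN' n (le_trans (le_max_right _ _) hn), step_base,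
          map_comp_step]⟩
      map_add' := fun β β' => pre_ext fun n => CStarCategory.add_comp _ _ _
      map_smul' := fun c β => pre_ext fun n => CStarCategory.smul_comp _ _ _ }
  have hL : ∀ β n, val (L β) n = (show Δ.X n ⟶ Δ.X n from val β n) ≫ val ξ n := fun β n => rfl
  have hb : ∀ β, ‖L β‖ ≤ C * ‖β‖ := fun β => norm_le_of_tr hC0 fun n => by
    rw [trInner, hL]
    exact Tr_comp_le (Δ.μ_pos n) (show Δ.X n ⟶ Δ.X n from val β n) (val ξ n) (hC n)
  obtain ⟨N, hN⟩ := val_coherent ξ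
  refine ⟨(L.mkContinuous C hb).completion, N, fun n hn β => ?_⟩
  rw [lev_eq, ContinuousLinearMap.completion_apply_coe, LinearMap.mkContinuous_apply]
  have hk : ∀ m ≥ n, val (L ((base Δ).ofLevel n β)) (m + 1) =
      Q.step m (val (L ((base Δ).ofLevel n β)) m) := by
    intro m hm
    rw [hL, hL, val_ofLevel _ hm, val_ofLevel _ (le_trans hm m.le_succ), push_succ _ hm,
      hN m (le_trans hn hm), step_base, map_comp_step]
  rw [coe_eq_lev hk le_rfl, hL, val_ofLevel _ le_rfl, push_self]

end Tower

namespace OneCell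

variable {Γ : ZeroCell.{v₁, u₁}} {Δ : ZeroCell.{v₂, u₂}} (Λ : OneCell Γ Δ)

/-- The left action of `A_k = End(Γ_k ⋯ Γ_1 m₀)` on `Λ_k Γ_k ⋯ Γ_1 m₀`. -/
noncomputable def act (k : ℕ) (α : Γ.X k ⟶ Γ.X k) : Λ.tower.obj k ⟶ Λ.tower.obj k := (Λ.Λ k).map α

theorem act_id (k : ℕ) : Λ.act k (𝟙 _) = 𝟙 _ := (Λ.Λ k).map_id _

theorem act_comp (k : ℕ) (α β : Γ.X k ⟶ Γ.X k) : Λ.act k (α ≫ β) = Λ.act k α ≫ Λ.act k β :=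
  (Λ.Λ k).map_comp α β

theorem act_add (k : ℕ) (α β : Γ.X k ⟶ Γ.X k) : Λ.act k (α + β) = Λ.act k α + Λ.act k β :=
  (Λ.starLinear k).map_add α β

theorem act_smul (k : ℕ) (c : ℂ) (α : Γ.X k ⟶ Γ.X k) : Λ.act k (c • α) = c • Λ.act k α :=
  (Λ.starLinear k).map_smul c α

theorem act_dag (k : ℕ) (α : Γ.X k ⟶ Γ.X k) : Λ.act k (dag α) = dag (Λ.act k α) :=
  (Λ.starLinear k).map_dag α

theorem norm_act_le (k : ℕ) (α : Γ.X k ⟶ Γ.X k) : ‖Λ.act k α‖ ≤ ‖α‖ :=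
  (Λ.starLinear k).norm_map_le α

/-- Naturality and unitarity of `W`: conjugation by `W` carries the action of A_k to that of its
image in A_{k+1}. -/
theorem transport_act (k : ℕ) (α : Γ.X k ⟶ Γ.X k) :
    Tower.transport Λ.tower Λ.tower k (Λ.act k α) = Λ.act (k + 1) ((Γ.F k).map α) := by
  have h := (Λ.W k).naturality α
  simp only [Functor.comp_map] at h
  refine (congrArg (dag ((Λ.W k).app (Γ.X k)) ≫ ·) h).trans ?_
  refine (Category.assoc _ _ _).symm.trans ?_
  exact (congrArg (· ≫ _) (Λ.unitary k (Γ.X k)).2).trans (Category.id_comp _)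

theorem lift_act {k n : ℕ} (h : k ≤ n) (α : Γ.X k ⟶ Γ.X k) :
    Tower.lift Λ.tower Λ.tower h (Λ.act k α) =
      Λ.act n (show Γ.X n ⟶ Γ.X n from Tower.lift (Tower.base Γ) (Tower.base Γ) h α) := by
  induction n, h using Nat.le_induction with
  | base => rw [Tower.lift_self, Tower.lift_self]
  | succ n hn ih =>
    rw [Tower.lift_succ hn, Tower.lift_succ hn, Tower.transport_base, ih, transport_act]

theorem step_comp_act (k : ℕ) (ξ : Δ.X k ⟶ Λ.tower.obj k) (α : Γ.X k ⟶ Γ.X k) :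
    Λ.tower.step k ξ ≫ Λ.act (k + 1) ((Γ.F k).map α) = Λ.tower.step k (ξ ≫ Λ.act k α) := by
  rw [← transport_act, Tower.step_comp_transport]

/-- The trace property moves `ξ` to the outside, where it costs `‖ξ‖ ^ 2`. What remains is the trace
of Λ_k(α†α up to order), which is a trace on `Γ.X k` for the pulled back weight, at most `M` times
that of `Γ.μ k`. This is the source of `√M`. -/
theorem Tr_comp_act_le {M : ℝ} (hM0 : 0 ≤ M) (k : ℕ)
    (hM : ∀ v, ∑ w, (adjacency (Λ.Λ k) w v : ℝ) * Δ.μ k w ≤ M * Γ.μ k v) {C : ℝ}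
    (ξ : Δ.X k ⟶ Λ.tower.obj k) (hξ : ‖ξ‖ ≤ C) (α : Γ.X k ⟶ Γ.X k) :
    (Tr (Δ.μ k) (Δ.X k) ((ξ ≫ Λ.act k α) ≫ dag (ξ ≫ Λ.act k α))).re ≤
      (C * √M) ^ 2 * (Tr (Γ.μ k) (Γ.X k) (α ≫ dag α)).re := by
  have h1 := Tower.Tr_comp_le (Δ.μ_pos k) (dag (Λ.act k α)) (dag ξ) ((norm_dag ξ).le.trans hξ)
  have h3 : Tr (Δ.μ k) (Λ.tower.obj k) (Λ.act k (dag α ≫ α)) = Tr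
      (fun v => ∑ w, (adjacency (Λ.Λ k) w v : ℝ) * Δ.μ k w) (Γ.X k) (dag α ≫ α) :=
    Tr_map (Λ.starLinear k) (fun v => rfl) _ _
  rw [← dag_comp, dag_dag, dag_dag, Tr_comm, ← act_dag, ← act_comp, h3] at h1
  have h2 := Tr_mono_weight hM (dag α)
  rw [dag_dag, Tr_comm (Γ.μ k)] at h2
  refine h1.trans ?_
  rw [mul_pow, Real.sq_sqrt hM0, mul_assoc]
  gcongr

/-- The map `α ↦ Λ α ∘ ξ` from `L²(A_∞)`, for `ξ ∈ H_k`. -/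
theorem exists_leftOrbit (ξ : Λ.tower.Pre) : ∃ (R : (Tower.base Γ).L2 →L[ℂ] Λ.H) (N : ℕ),
    ∀ n ≥ N, ∀ α : Γ.X n ⟶ Γ.X n, R ((Tower.base Γ).lev n α) =
      Λ.tower.lev n (Tower.val ξ n ≫ Λ.act n α) := by
  obtain ⟨C, hC0, hC⟩ := Tower.exists_norm_val_le ξ
  obtain ⟨ε, M, -, hM0, hM⟩ := Λ.bounded
  let L : (Tower.base Γ).Pre →ₗ[ℂ] Λ.tower.Pre :=
    { toFun := fun α => ⟨fun n => Tower.val ξ n ≫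
          Λ.act n (show Γ.X n ⟶ Γ.X n from Tower.val α n), by
        obtain ⟨N, hN⟩ := Tower.val_coherent ξ
        obtain ⟨N', hN'⟩ := Tower.val_coherent α
        refine ⟨max N N', fun n hn => ?_⟩
        dsimp only
        rw [hN n (le_trans (le_max_left _ _) hn), hN' n (le_trans (le_max_right _ _) hn),
          Tower.step_base]
        exact Λ.step_comp_act n _ _⟩
      map_add' := fun α α' => Tower.pre_ext fun n =>
        (congrArg (Tower.val ξ n ≫ ·) (Λ.act_add n _ _)).trans
          (CStarCategory.comp_add _ _ _)
      map_smul' := fun c α => Tower.pre_ext fun n =>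
        (congrArg (Tower.val ξ n ≫ ·) (Λ.act_smul n _ _)).trans
          (CStarCategory.comp_smul _ _ _) }
  have hL : ∀ α n, Tower.val (L α) n = Tower.val ξ n ≫
    Λ.act n (show Γ.X n ⟶ Γ.X n from Tower.val α n) := fun α n => rfl
  have hb : ∀ α, ‖L α‖ ≤ C * √M * ‖α‖ := fun α => by
    have h1 := le_of_tendsto_of_tendsto' (Λ.tower.tendsto_norm (L α))
      (((Tower.base Γ).tendsto_norm α).const_mul ((C * √M) ^ 2)) fun n =>
        Λ.Tr_comp_act_le hM0.le n (fun v => (hM n v).2) (Tower.val ξ n) (hC n) (Tower.val α n)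
    rw [← mul_pow] at h1
    exact abs_le_of_sq_le_sq' h1 (by positivity) |>.2
  obtain ⟨N, hN⟩ := Tower.val_coherent ξ
  refine ⟨(L.mkContinuous (C * √M) hb).completion, N, fun n hn α => ?_⟩
  rw [Tower.lev_eq, ContinuousLinearMap.completion_apply_coe, LinearMap.mkContinuous_apply]
  have hk : ∀ m ≥ n, Tower.val (L ((Tower.base Γ).ofLevel n α)) (m + 1) =
      Λ.tower.step m (Tower.val (L ((Tower.base Γ).ofLevel n α)) m) := by
    intro m hm
    rw [hL, hL, Tower.val_ofLevel _ hm, Tower.val_ofLevel _ (le_trans hm m.le_succ),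
      Tower.push_succ _ hm, hN m (le_trans hn hm), Tower.step_base]
    exact Λ.step_comp_act m _ _
  rw [Tower.coe_eq_lev hk le_rfl, hL, Tower.val_ofLevel _ le_rfl, Tower.push_self]

end OneCell

/-! ### Normal functionals along bounded strong limits -/

section normal

variable {K : Type u} [NormedAddCommGroup K] [InnerProductSpace ℂ K] [CompleteSpace K]

/-- Each vector functional in the series converges, and the norm bound on `a k` allows dominated
convergence. -/
theorem IsNormalFunctional.tendsto {A : VonNeumannAlgebra K} {φ : A.toStarSubalgebra → ℂ}
    (hφ : IsNormalFunctional A φ) {a : ℕ → A.toStarSubalgebra} {b : A.toStarSubalgebra} {C : ℝ}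
    (hC : ∀ k, ‖(a k : K →L[ℂ] K)‖ ≤ C)
    (h : ∀ x, Tendsto (fun k => (a k : K →L[ℂ] K) x) atTop (𝓝 ((b : K →L[ℂ] K) x))) :
    Tendsto (fun k => φ (a k)) atTop (𝓝 (φ b)) := by
  obtain ⟨x, y, hx, hy, hφ⟩ := hφ
  simp only [hφ]
  have hC0 : 0 ≤ C := (norm_nonneg _).trans (hC 0)
  refine tendsto_tsum_of_dominated_convergence (bound := fun n => C * (‖x n‖ ^ 2 + ‖y n‖ ^ 2))
    ((hx.add hy).mul_left C) (fun n => (tendsto_const_nhds.inner (h (x n)))) ?_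
  refine Eventually.of_forall fun k n => ?_
  calc _ ≤ ‖y n‖ * ‖(a k : K →L[ℂ] K) (x n)‖ := norm_inner_le_norm _ _
    _ ≤ ‖y n‖ * (C * ‖x n‖) := by
      gcongr
      exact ((a k : K →L[ℂ] K).le_opNorm _).trans (by gcongr; exact hC k)
    _ = C * (‖x n‖ * ‖y n‖) := by ring
    _ ≤ C * (‖x n‖ ^ 2 + ‖y n‖ ^ 2) := by
      gcongr
      nlinarith [sq_nonneg (‖x n‖ - ‖y n‖), sq_nonneg (‖x n‖ + ‖y n‖)]

/-- An operator which intertwines the restrictions to `A_∞` of two normal actions of `PB(Γ)`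
intertwines the actions. -/
theorem IsNormalAction.intertwine {Γ : ZeroCell.{v₁, u₁}}
    {H : Type w} [NormedAddCommGroup H] [InnerProductSpace ℂ H] [CompleteSpace H]
    {G : Type w} [NormedAddCommGroup G] [InnerProductSpace ℂ G] [CompleteSpace G]
    {π : Γ.vN.toStarSubalgebra → (H →L[ℂ] H)} {π' : Γ.vN.toStarSubalgebra → (G →L[ℂ] G)}
    (hπ : IsNormalAction Γ.vN π) (hπ' : IsNormalAction Γ.vN π') (T : H →L[ℂ] G)
    (h : ∀ k α ξ, T (π (Γ.toVN k α) ξ) = π' (Γ.toVN k α) (T ξ)) (a : Γ.vN.toStarSubalgebra)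
    (ξ : H) : T (π a ξ) = π' a (T ξ) := by
  obtain ⟨α, ⟨C, hC⟩, hα⟩ := Γ.exists_approx a
  have hb : ∀ k, ‖(Γ.toVN k (α k) : (Tower.base Γ).L2 →L[ℂ] (Tower.base Γ).L2)‖ ≤ C := fun k =>
    (Tower.norm_leftOp_le (Q := Tower.base Γ) (R := Tower.base Γ) k (α k)).trans (hC k)
  refine ext_inner_left ℂ fun ζ => ?_
  -- Moving `T` to the other side makes `⟨ζ, T π(a) ξ⟩` a matrix coefficient of `π`, to which
  -- normality applies.
  have h1 := (hπ ξ (ContinuousLinearMap.adjoint T ζ)).tendsto (a := fun k => Γ.toVN k (α k)) hb hα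
  have h2 := (hπ' (T ξ) ζ).tendsto (a := fun k => Γ.toVN k (α k)) hb hα
  simp only [ContinuousLinearMap.adjoint_inner_left, h] at h1
  exact tendsto_nhds_unique h1 h2

end normal

/-! ### Existence and uniqueness of the bimodule structure -/

namespace ZeroCell

theorem rightRep_toVN (Δ : ZeroCell.{v, u}) (k : ℕ) (β : Δ.X k ⟶ Δ.X k) :
    Δ.rightRep (MulOpposite.op (Δ.toVN k β)) = (Tower.base Δ).rightOp k β := by
  ext x
  rw [← Tower.conj_leftOp]
  change Tower.conj Δ ((star (Δ.toVN k β) : Δ.vN.toStarSubalgebra).1 (Tower.conj Δ x)) = _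
  rw [star_toVN]
  rfl

theorem norm_conj (Δ : ZeroCell.{v, u}) (x : (Tower.base Δ).L2) : ‖Tower.conj Δ x‖ = ‖x‖ := by
  have h := Tower.inner_conj x (Tower.conj Δ x)
  rw [Tower.conj_conj, inner_self_eq_norm_sq_to_K, inner_self_eq_norm_sq_to_K] at h
  have h2 : ‖Tower.conj Δ x‖ ^ 2 = ‖x‖ ^ 2 := by exact_mod_cast h
  exact (pow_left_inj₀ (norm_nonneg _) (norm_nonneg _) two_ne_zero).1 h2

/-- A vector functional of the right representation is a vector functional of `b` itself, with the
two vectors conjugated and exchanged. Normality of the right action follows from this. -/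
theorem inner_rightRep (Δ : ZeroCell.{v, u}) (b : Δ.vN.toStarSubalgebra) (x y : (Tower.base Δ).L2) :
    inner ℂ y (Δ.rightRep (MulOpposite.op b) x) = inner ℂ (Tower.conj Δ x)
      ((b : (Tower.base Δ).L2 →L[ℂ] (Tower.base Δ).L2) (Tower.conj Δ y)) := by
  change inner ℂ y (Tower.conj Δ ((star b : Δ.vN.toStarSubalgebra).1 (Tower.conj Δ x))) = _
  rw [← inner_conj_symm, Tower.inner_conj, inner_conj_symm]
  exact ContinuousLinearMap.adjoint_inner_left
    (b : (Tower.base Δ).L2 →L[ℂ] (Tower.base Δ).L2) _ _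

end ZeroCell

namespace Tower

variable {Δ : ZeroCell.{v, u}}

/-- The right action of `PB(Δ)` on the Hilbert space of a tower. -/
theorem exists_rightAction (Q : Tower Δ) :
    ∃ π : (Δ.vN.toStarSubalgebra)ᵐᵒᵖ →⋆ₐ[ℂ] (Q.L2 →L[ℂ] Q.L2),
      (∀ k β, π (MulOpposite.op (Δ.toVN k β)) = Q.rightOp k β) ∧
      IsNormalAction Δ.vN fun b => π (MulOpposite.op b) := by
  choose R N hR using fun ξ : Q.Pre => exists_rightOrbit ξ
  obtain ⟨π, h1, h2⟩ := exists_normal_extension Δ.rightRep Δ.vac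
    (ι := AddMonoidHom.mk' ((↑) : Q.Pre → Q.L2) UniformSpace.Completion.coe_add) Q.denseRange_coe R
    (fun ξ => by
      obtain ⟨M, hM⟩ := exists_coe_eq_lev ξ
      change _ = (ξ : Q.L2)
      rw [hM _ (le_max_right (N ξ) M), Δ.vac_eq (max (N ξ) M), hR ξ _ (le_max_left _ _)]
      exact congrArg _ (Category.id_comp _))
    (fun s T => ∃ k β, s = MulOpposite.op (Δ.toVN k β) ∧ T = Q.rightOp k β)
    (by
      rintro _ _ ⟨k, β, rfl, rfl⟩ ξ x
      rw [Δ.rightRep_toVN]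
      refine congrFun (eq_of_lev (f := fun x => R ξ ((base Δ).rightOp k β x))
        (g := fun x => Q.rightOp k β (R ξ x)) (by fun_prop) (by fun_prop) (max k (N ξ))
        fun n hn α => ?_) x
      have hk := le_trans (le_max_left k (N ξ)) hn
      have hN := le_trans (le_max_right k (N ξ)) hn
      rw [rightOp_lev _ hk, hR ξ n hN, hR ξ n hN, rightOp_lev _ hk, Category.assoc])
    (by
      rintro _ _ ⟨k, β, rfl, rfl⟩
      exact ⟨k, dag β, by rw [← MulOpposite.op_star, Δ.star_toVN], adjoint_rightOp Q k β⟩)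
    (by
      intro b
      -- Right multiplication by `b` is `J b† J`, so it is `b†` that must be approximated strongly;
      -- the approximants are then the adjoints of the `β k`.
      obtain ⟨β, ⟨C, hC⟩, hβ⟩ := Δ.exists_approx (star b.unop)
      refine ⟨fun k => MulOpposite.op (Δ.toVN k (dag (β k))), fun k => Q.rightOp k (dag (β k)), C,
        fun k => ⟨k, _, rfl, rfl⟩,
        fun k => (norm_rightOp_le Q k _).trans ((norm_dag _).le.trans (hC k)), fun x => ?_⟩
      refine (((conj Δ).continuous.tendsto _).comp (hβ (conj Δ x))).congr fun k => ?_
      rw [Δ.rightRep_toVN, ← conj_leftOp, dag_dag]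
      rfl)
  refine ⟨π, fun k β => h1 _ _ ⟨k, β, rfl, rfl⟩, fun ξ ζ => ?_⟩
  obtain ⟨x, y, hx, hy, hxy⟩ := h2 ξ ζ
  refine ⟨fun n => conj Δ (y n), fun n => conj Δ (x n), ?_, ?_, fun b => ?_⟩
  · simpa only [Δ.norm_conj] using hy
  · simpa only [Δ.norm_conj] using hx
  · refine (hxy _).trans ?_
    exact tsum_congr fun n => Δ.inner_rightRep b _ _

end Tower

namespace OneCell

variable {Γ : ZeroCell.{v₁, u₁}} {Δ : ZeroCell.{v₂, u₂}} (Λ Ω : OneCell Γ Δ)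

/-- The left action of `PB(Γ)` on the Hilbert space of a `1`-cell. -/
theorem exists_leftAction : ∃ π : Γ.vN.toStarSubalgebra →⋆ₐ[ℂ] (Λ.H →L[ℂ] Λ.H),
      (∀ k (α : Γ.X k ⟶ Γ.X k), π (Γ.toVN k α) =
        Tower.leftOp (Q := Λ.tower) (R := Λ.tower) k (Λ.act k α)) ∧
      IsNormalAction Γ.vN π := by
  choose R N hR using Λ.exists_leftOrbit
  obtain ⟨π, h1, h2⟩ := exists_normal_extension
    (Γ.vN.toStarSubalgebra.subtype) Γ.vac
    (ι := AddMonoidHom.mk' ((↑) : Λ.tower.Pre → Λ.H) UniformSpace.Completion.coe_add)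
    Λ.tower.denseRange_coe R
    (fun ξ => by
      obtain ⟨M, hM⟩ := Tower.exists_coe_eq_lev ξ
      change _ = (ξ : Λ.H)
      rw [hM _ (le_max_right (N ξ) M), Γ.vac_eq (max (N ξ) M), hR ξ _ (le_max_left _ _),
        Λ.act_id]
      exact congrArg _ (Category.comp_id _))
    (fun s T => ∃ k α, s = Γ.toVN k α ∧
      T = Tower.leftOp (Q := Λ.tower) (R := Λ.tower) k (Λ.act k α))
    (by
      rintro _ _ ⟨k, α, rfl, rfl⟩ ξ x
      change R ξ (Tower.leftOp (Q := Tower.base Γ) (R := Tower.base Γ) k α x) = _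
      refine congrFun (Tower.eq_of_lev
        (f := fun x => R ξ (Tower.leftOp (Q := Tower.base Γ) (R := Tower.base Γ) k α x))
        (g := fun x => Tower.leftOp (Q := Λ.tower) (R := Λ.tower) k (Λ.act k α) (R ξ x))
        (by fun_prop) (by fun_prop) (max k (N ξ)) fun n hn α' => ?_) x
      have hk := le_trans (le_max_left k (N ξ)) hn
      have hN := le_trans (le_max_right k (N ξ)) hn
      rw [Tower.leftOp_lev hk, hR ξ n hN, hR ξ n hN, Tower.leftOp_lev hk, Λ.lift_act hk,
        Category.assoc]
      exact congrArg (fun f => Λ.tower.lev n (Tower.val ξ n ≫ f)) (Λ.act_comp n _ _))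
    (by
      rintro _ _ ⟨k, α, rfl, rfl⟩
      refine ⟨k, dag α, Γ.star_toVN k α, ?_⟩
      rw [Tower.adjoint_leftOp, act_dag])
    (by
      intro a
      obtain ⟨α, ⟨C, hC⟩, hα⟩ := Γ.exists_approx a
      exact ⟨fun k => Γ.toVN k (α k),
        fun k => Tower.leftOp (Q := Λ.tower) (R := Λ.tower) k (Λ.act k (α k)), C,
        fun k => ⟨k, _, rfl, rfl⟩, fun k => (Tower.norm_leftOp_le _ _).trans
          ((Λ.norm_act_le k _).trans (hC k)), hα⟩)
  exact ⟨π, fun k α => h1 _ _ ⟨k, α, rfl, rfl⟩, h2⟩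

theorem exists_isPB : ∃ 𝓗 : VNBimodule Γ.vN Δ.vN Λ.H, Λ.IsPB 𝓗 := by
  obtain ⟨π, h1, h2⟩ := Λ.exists_leftAction
  obtain ⟨ρ, h3, h4⟩ := Λ.tower.exists_rightAction
  refine ⟨⟨π, ρ, h2, h4, fun a b => ?_⟩, h1, h3⟩
  -- Commutation is extended in one variable at a time: from B_∞ to all of `Δ.vN` with `α` in A_k
  -- fixed, and then from A_∞ to `Γ.vN`.
  have key : ∀ k (α : Γ.X k ⟶ Γ.X k) b x, π (Γ.toVN k α) (ρ (MulOpposite.op b) x) =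
      ρ (MulOpposite.op b) (π (Γ.toVN k α) x) := by
    intro k α b x
    refine IsNormalAction.intertwine h4 h4 (π (Γ.toVN k α)) (fun j β x => ?_) b x
    rw [h1, h3]
    exact Tower.leftOp_rightOp _ _ _ _ _
  ext x
  exact (IsNormalAction.intertwine h2 h2 (ρ b) (fun k α x => (key k α b.unop x).symm) a x).symm

/-- The identity operator intertwines the two structures on A_∞ and B_∞, hence by normality
everywhere. -/
theorem isPB_unique {𝓗 𝓗' : VNBimodule Γ.vN Δ.vN Λ.H} (h : Λ.IsPB 𝓗) (h' : Λ.IsPB 𝓗') :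
    𝓗 = 𝓗' := by
  refine VNBimodule.ext ?_ ?_
  · refine DFunLike.ext _ _ fun a => ContinuousLinearMap.ext fun x => ?_
    exact IsNormalAction.intertwine 𝓗.left_normal 𝓗'.left_normal (ContinuousLinearMap.id ℂ Λ.H)
      (fun k α ξ => by rw [h.1, h'.1]; rfl) a x
  · refine DFunLike.ext _ _ fun b => ContinuousLinearMap.ext fun x => ?_
    exact IsNormalAction.intertwine 𝓗.right_normal 𝓗'.right_normal (ContinuousLinearMap.id ℂ Λ.H)
      (fun k α ξ => by rw [h.2, h'.2]; rfl) b.unop x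

end OneCell

/-! ### Bounded quasi-flat sequences and intertwiners -/

namespace OneCell

variable {Γ : ZeroCell.{v₁, u₁}} {Δ : ZeroCell.{v₂, u₂}} {Λ Ω : OneCell Γ Δ}

/-- The component of a natural transformation `Λ_k ⟶ Ω_k` at `Γ_k ⋯ Γ_1 m₀`. -/
noncomputable def component (k : ℕ) (η : Λ.Λ k ⟶ Ω.Λ k) : Λ.tower.obj k ⟶ Ω.tower.obj k :=
  η.app (Γ.X k)

theorem Φ_eq (k : ℕ) (η : Λ.Λ k ⟶ Ω.Λ k) : Φ k η = Tower.leftOp k (component k η) := rfl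

/-- Quasi-flatness, read at `Γ.X k`, is compatibility with the conditional expectations of the
towers. As `Γ.X k` is full, nothing is lost by looking only there. -/
theorem component_loop (k : ℕ) (η : Λ.Λ (k + 1) ⟶ Ω.Λ (k + 1)) :
    component k (loop Λ Ω k η) = Tower.expect Λ.tower Ω.tower k (component (k + 1) η) := rfl

theorem act_comp_component (k : ℕ) (η : Λ.Λ k ⟶ Ω.Λ k) (α : Γ.X k ⟶ Γ.X k) :
    Λ.act k α ≫ component k η = component k η ≫ Ω.act k α := η.naturality α

theorem component_injective (k : ℕ) :
    Function.Injective (component (Λ := Λ) (Ω := Ω) k) := fun _ _ h =>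
  (Γ.isFull_X k).nat_ext (Λ.starLinear k) h

theorem exists_component (k : ℕ) (γ : Λ.tower.obj k ⟶ Ω.tower.obj k)
    (h : ∀ α, Λ.act k α ≫ γ = γ ≫ Ω.act k α) : ∃ η : Λ.Λ k ⟶ Ω.Λ k, component k η = γ :=
  (Γ.isFull_X k).exists_nat (Λ.starLinear k) (Ω.starLinear k) γ h

theorem norm_app_le_component (k : ℕ) (η : Λ.Λ k ⟶ Ω.Λ k) (x : Γ.M k) :
    ‖η.app x‖ ≤ ‖component k η‖ :=
  (Γ.isFull_X k).norm_app_le (Λ.starLinear k) (Ω.starLinear k) η x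

/-- Bounded quasi-flat sequences converge strongly. -/
theorem exists_limit (η : BQFS Λ Ω) : ∃ T : Λ.H →L[ℂ] Ω.H,
    (∀ x, Tendsto (fun k => Φ k (η.1 k) x) atTop (𝓝 (T x))) ∧
    ∀ k ξ ζ, inner ℂ (Ω.tower.lev k ζ) (Ω.tower.lev k (ξ ≫ component k (η.1 k))) =
      inner ℂ (Ω.tower.lev k ζ) (T (Λ.tower.lev k ξ)) := by
  obtain ⟨hloop, c, hc⟩ := η.2
  exact Tower.exists_limit_of_expect (γ := fun k => component k (η.1 k)) (fun k => hc k (Γ.X k))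
    fun k => by
      rw [← component_loop, hloop]

/-- The limit of a bounded quasi-flat sequence. -/
noncomputable def limit (η : BQFS Λ Ω) : Λ.H →L[ℂ] Ω.H := (exists_limit η).choose

theorem tendsto_limit (η : BQFS Λ Ω) (x : Λ.H) :
    Tendsto (fun k => Φ k (η.1 k) x) atTop (𝓝 (limit η x)) :=
  (exists_limit η).choose_spec.1 x

theorem inner_limit (η : BQFS Λ Ω) (k : ℕ) (ξ : Δ.X k ⟶ Λ.tower.obj k)
    (ζ : Δ.X k ⟶ Ω.tower.obj k) :
    inner ℂ (Ω.tower.lev k ζ) (Ω.tower.lev k (ξ ≫ component k (η.1 k))) =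
      inner ℂ (Ω.tower.lev k ζ) (limit η (Λ.tower.lev k ξ)) :=
  (exists_limit η).choose_spec.2 k ξ ζ

/-- Operators with the inner products of the compressions of `limit η` are equal to it. -/
theorem limit_eq_of_inner (η : BQFS Λ Ω) {T : Λ.H →L[ℂ] Ω.H}
    (h : ∀ k ξ ζ, inner ℂ (Ω.tower.lev k ζ) (Ω.tower.lev k (ξ ≫ component k (η.1 k))) =
      inner ℂ (Ω.tower.lev k ζ) (T (Λ.tower.lev k ξ))) : limit η = T := by
  obtain ⟨-, c, hc⟩ := η.2
  ext x
  exact tendsto_nhds_unique (tendsto_limit η x)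
    (Tower.tendsto_leftOp_compression T (fun k => hc k (Γ.X k)) h x)

theorem limit_add (η η' : BQFS Λ Ω) : limit (η + η') = limit η + limit η' := by
  refine limit_eq_of_inner _ fun k ξ ζ => ?_
  have e : component k ((η + η').1 k) = component k (η.1 k) + component k (η'.1 k) := rfl
  rw [e, CStarCategory.comp_add, map_add, inner_add_right, inner_limit, inner_limit, add_apply,
    inner_add_right]

theorem limit_smul (c : ℂ) (η : BQFS Λ Ω) : limit (c • η) = c • limit η := by
  refine limit_eq_of_inner _ fun k ξ ζ => ?_
  have e : component k ((c • η).1 k) = c • component k (η.1 k) := rfl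
  rw [e, CStarCategory.comp_smul, map_smul, inner_smul_right, inner_limit, smul_apply,
    inner_smul_right]

theorem limit_leftOp (η : BQFS Λ Ω) (k : ℕ) (α : Γ.X k ⟶ Γ.X k) (x : Λ.H) :
    limit η (Tower.leftOp (Q := Λ.tower) (R := Λ.tower) k (Λ.act k α) x) =
      Tower.leftOp (Q := Ω.tower) (R := Ω.tower) k (Ω.act k α) (limit η x) := by
  refine tendsto_nhds_unique (tendsto_limit η _)
    ((((Tower.leftOp k (Ω.act k α)).continuous.tendsto _).comp (tendsto_limit η x)).congr' ?_)
  -- From level `k` on, α can be lifted to level `n`, where naturality of η^(n) gives exact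
  -- commutation.
  filter_upwards [eventually_ge_atTop k] with n hn
  rw [Function.comp, Φ_eq, ← Tower.leftOp_lift hn, ← Tower.leftOp_lift hn, Tower.leftOp_comp,
    Tower.leftOp_comp, lift_act, lift_act, act_comp_component]

theorem limit_rightOp (η : BQFS Λ Ω) (k : ℕ) (β : Δ.X k ⟶ Δ.X k) (x : Λ.H) :
    limit η (Λ.tower.rightOp k β x) = Ω.tower.rightOp k β (limit η x) := by
  refine tendsto_nhds_unique (tendsto_limit η _)
    ((((Ω.tower.rightOp k β).continuous.tendsto _).comp (tendsto_limit η x)).congr fun n => ?_)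
  rw [Function.comp, Φ_eq, Tower.leftOp_rightOp]

section intertwiners

variable {𝓗 : VNBimodule Γ.vN Δ.vN Λ.H} {𝓖 : VNBimodule Γ.vN Δ.vN Ω.H}

theorem limit_mem_intertwiners (h𝓗 : Λ.IsPB 𝓗) (h𝓖 : Ω.IsPB 𝓖) (η : BQFS Λ Ω) :
    limit η ∈ 𝓗.intertwiners 𝓖 := by
  refine ⟨fun a ξ => ?_, fun b ξ => ?_⟩
  · refine IsNormalAction.intertwine 𝓗.left_normal 𝓖.left_normal (limit η) (fun k α x => ?_) a ξ
    rw [h𝓗.1, h𝓖.1]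
    exact limit_leftOp η k α x
  · refine IsNormalAction.intertwine 𝓗.right_normal 𝓖.right_normal (limit η) (fun k β x => ?_)
      b.unop ξ
    rw [h𝓗.2, h𝓖.2]
    exact limit_rightOp η k β x

/-- The limit remembers each η^(k) as its compression to level `k`. -/
theorem limit_injective : Function.Injective (limit (Λ := Λ) (Ω := Ω)) := by
  intro η η' h
  refine Subtype.ext (funext fun k => component_injective k (Tower.eq_of_inner_lev fun ξ ζ => ?_))
  rw [inner_limit, inner_limit, h]

/-- Every intertwiner is the limit of a bounded quasi-flat sequence. -/
theorem exists_limit_eq (h𝓗 : Λ.IsPB 𝓗) (h𝓖 : Ω.IsPB 𝓖) {T : Λ.H →L[ℂ] Ω.H}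
    (hT : T ∈ 𝓗.intertwiners 𝓖) : ∃ η : BQFS Λ Ω, limit η = T := by
  have hr : ∀ k (β : Δ.X k ⟶ Δ.X k) x, T (Λ.tower.rightOp k β x) = Ω.tower.rightOp k β (T x) := by
    intro k β x
    have h := hT.2 (MulOpposite.op (Δ.toVN k β)) x
    rwa [h𝓗.2, h𝓖.2] at h
  have hl : ∀ k (α : Γ.X k ⟶ Γ.X k) x,
      T (Tower.leftOp (Q := Λ.tower) (R := Λ.tower) k (Λ.act k α) x) =
        Tower.leftOp (Q := Ω.tower) (R := Ω.tower) k (Ω.act k α) (T x) := by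
    intro k α x
    have h := hT.1 (Γ.toVN k α) x
    rwa [h𝓗.1, h𝓖.1] at h
  choose γ hγ hγ' using fun k => Tower.exists_compression T k (hr k)
  have hnat : ∀ k α, Λ.act k α ≫ γ k = γ k ≫ Ω.act k α := by
    intro k α
    -- Level `k` is stable under the action of α and of its adjoint, so compressing `T` to it
    -- preserves commutation with A_k.
    refine Tower.eq_of_inner_lev fun ξ ζ => ?_
    rw [← Category.assoc, hγ', ← Tower.leftOp_lev_self, hl, ← Tower.inner_leftOp,
      Tower.leftOp_lev_self, ← hγ', ← Tower.leftOp_lev_self, Tower.inner_leftOp,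
      Tower.leftOp_lev_self, Category.assoc]
  choose η hη using fun k => exists_component k (γ k) (hnat k)
  have hloop : ∀ k, loop Λ Ω k (η (k + 1)) = η k := by
    intro k
    refine component_injective k (Tower.eq_of_inner_lev fun ξ ζ => ?_)
    -- Compression in stages: `ξ` and `ζ` are viewed in level `k + 1`, where the compression of `T`
    -- has the matrix coefficients of `T`.
    rw [component_loop, Tower.inner_expect, hη, hη, hγ', ← Λ.tower.lev_step, ← Ω.tower.lev_step,
      Tower.leftOp_lev_self, hγ']
  -- The bound `‖T‖` on the components at `Γ.X k` spreads to all objects by fullness.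
  refine ⟨⟨η, hloop, ‖T‖, fun k x => (norm_app_le_component k _ x).trans ?_⟩, ?_⟩
  · rw [hη]
    exact hγ k
  · refine limit_eq_of_inner _ fun k ξ ζ => ?_
    rw [← hγ', ← hη]

end intertwiners

end OneCell

end UC

theorem mainTheorem2 (Γ : UC.ZeroCell.{v₁, u₁}) (Δ : UC.ZeroCell.{v₂, u₂}) (Λ Ω : UC.OneCell Γ Δ) :
    (∃! 𝓗 : UC.VNBimodule Γ.vN Δ.vN Λ.H, Λ.IsPB 𝓗) ∧
    (∃! 𝓖 : UC.VNBimodule Γ.vN Δ.vN Ω.H, Ω.IsPB 𝓖) ∧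
    ∀ (𝓗 : UC.VNBimodule Γ.vN Δ.vN Λ.H) (𝓖 : UC.VNBimodule Γ.vN Δ.vN Ω.H),
      Λ.IsPB 𝓗 → Ω.IsPB 𝓖 →
      ∃ PB : UC.OneCell.BQFS Λ Ω ≃ₗ[ℂ] 𝓗.intertwiners 𝓖,
        ∀ (η : UC.OneCell.BQFS Λ Ω) (ξ : Λ.H),
          Filter.Tendsto (fun k => UC.OneCell.Φ k (η.1 k) ξ) Filter.atTop
            (nhds ((PB η : Λ.H →L[ℂ] Ω.H) ξ)) := by
  refine ⟨existsUnique_of_exists_of_unique Λ.exists_isPB fun _ _ => Λ.isPB_unique,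
    existsUnique_of_exists_of_unique Ω.exists_isPB fun _ _ => Ω.isPB_unique,
    fun 𝓗 𝓖 h𝓗 h𝓖 => ?_⟩
  let L : UC.OneCell.BQFS Λ Ω →ₗ[ℂ] 𝓗.intertwiners 𝓖 :=
    { toFun := fun η => ⟨UC.OneCell.limit η, UC.OneCell.limit_mem_intertwiners h𝓗 h𝓖 η⟩
      map_add' := fun η η' => Subtype.ext (UC.OneCell.limit_add η η')
      map_smul' := fun c η => Subtype.ext (UC.OneCell.limit_smul c η) }
  refine ⟨LinearEquiv.ofBijective L ⟨fun η η' h => ?_, fun T => ?_⟩, fun η ξ => ?_⟩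
  · exact UC.OneCell.limit_injective (congrArg Subtype.val h)
  · obtain ⟨η, hη⟩ := UC.OneCell.exists_limit_eq h𝓗 h𝓖 T.2
    exact ⟨η, Subtype.ext hη⟩
  · exact UC.OneCell.tendsto_limit η ξ
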